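/- Let $G=(V,E,w)$ be an undirected graph with $n\ge 1$ vertices and weights $w\colon E\to\mathbb R_{\ge 0}$, and let $k\ge 2$ be an integer. Write $\delta_G$ for the distance in $G$ ($\infty$ between different components), $\delta_G(u,S)=\min_{s\in S}\delta_G(u,s)$ ($\infty$ if $S=\varnothing$), and $W_i(P)$ for the weight of the $i$-th heaviest edge of a path $P$ ($0$ if there is none). Let $V=S_0\supseteq S_1\supseteq\dots\supseteq S_{k-1}$ be random sets, where each vertex of $S_{i-1}$ is put into $S_i$ independently with probability $n^{-1/k}$, and let $S_i=\varnothing$ for $i\ge k$. Let $p_i(u)$ be a vertex of $S_i$ nearest to $u$, let $B(u,i,j)=\{s\in S_i:\delta_G(u,s)<\delta_G(u,S_j)\}$, and let $E_i$ be the set of edges $(u,v)\in E$ with $w(u,v)<\delta_G(u,S_i)$ or $w(u,v)<\delta_G(v,S_i)$ (so $E_k=E$). Put $$D=\{(u,p_i(u)):u\in V,\ 1\le i\le k-1\},$$ $$B_1(V)=\{(u,s):u\in V,\ s\in B(u,i,i+1),\ 0\le i\le k-1\},$$ $$B_2(S_1)=\{(u,s):u\in S_1,\ s\in B(u,i,i+2),\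 0\le i\le k-2\}.$$ Consider the following algorithm. It samples $S_1,\dots,S_{k-1}$, computes by one multi-source Dijkstra search for each $i\in\{1,\dots,k-1\}$ the pivots $p_i(u)$ and the distances $\delta_G(u,p_i(u))$, and computes $E_1,\dots,E_k$ from them. It maintains a symmetric matrix $d$ of distance estimates, which is $0$ on the diagonal, $\infty$ elsewhere, and is then lowered to $w(x,y)$ at each edge $(x,y)\in E$, to $\delta_G(u,p_i(u))$ at each pair $(u,p_i(u))$, to $\delta_G(x,p_i(x))+w(x,y)+\delta_G(y,p_j(y))$ at $(p_i(x),p_j(y))$ for each edge $(x,y)\in E$ and all $i,j\in\{1,\dots,k-1\}$, and to the distances found by Dijkstra's algorithm run from each $s\in S_i$, $0\le i\le k-1$, on the graph $(V,E_{\min(i+2,k)})$. Finally it outputs the edges of $$F=D\cup E_1\cup B_1(V)\cup B_2(S_1)\cup\bigcup_{i=1}^{k}S_{i-1}\times S_{k-i},$$ where membership in $B_1(V)$ and $B_2(S_1)$ is decided by using $d$ in place of $\delta_G$, where each pair $(u,v)\in F$ has weight $w_H(u,v)=d[u,v]$, and where pairs with $u=v$ or $d[u,v]=\infty$ are left out.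 Let $H=(V,F,w_H)$. There are absolute constants $C,c$ such that for all $k,n,G$ as above, $G$ being given by weighted adjacency lists, the following holds. 1. (Stretch) For every outcome of the sampling, $H$ is a $\bigl(2\lfloor k/2\rfloor-1,\ 2\lceil k/2\rceil W_1+\max\{0,2(\lceil k/2\rceil-2)\}W_2\bigr)$-emulator of $G$: for all $u,v\in V$ we have $\delta_G(u,v)\le\delta_H(u,v)$, and for every shortest path $P$ from $u$ to $v$, $$\delta_H(u,v)\le\bigl(2\lfloor k/2\rfloor-1\bigr)\delta_G(u,v)+2\lceil k/2\rceil W_1(P)+\max\{0,2(\lceil k/2\rceil-2)\}W_2(P).$$ 2. (Weights) For every outcome of the sampling, each pair of distinct vertices at finite distance that belongs to $D$, $E_1$, $B_1(V)$ (which contains the pairs of $V\times S_{k-1}$ at finite distance) or $B_2(S_1)$ (which contains the pairs of $S_1\times S_{k-2}$ at finite distance) is an edge of $H$ of weight exactly $\delta_G(u,v)$. For each $(x,y)\in E$ and $i,j\ge 1$ with $i+j=k-1$ such that $p_i(x)$ and $p_j(y)$ are at finite distance from $x$ and $y$, respectively, and distinct, $(p_i(x),p_j(y))$ is an edge of $H$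 and $w_H(p_i(x),p_j(y))\le\delta_G(x,p_i(x))+w(x,y)+\delta_G(y,p_j(y))$. 3. (Size) The expected number of edges that are output is at most $C\,(k\log(n+1))^{c}\,n^{1+1/k}$, that is, $\tilde O(n^{1+1/k})$. 4. (Running time) The expected number of elementary steps of the algorithm (array and list accesses, priority-queue node operations, comparisons and additions of weights, coin tosses) is at most $C\,(k\log(n+1))^{c}\,n^{2+2/k}$, that is, $\tilde O(n^{2+2/k})$. -/

import Mathlib

open scoped NNReal ENNReal

noncomputable section

/-! ## Weighted graphs, distances, balls, emulators -/

/-- An undirected graph with non-negative real edge weights. Only the values of `weight` on the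
edges of `graph` are ever used. -/
structure WGraph (V : Type) where
  graph : SimpleGraph V
  weight : Sym2 V → ℝ≥0

namespace WGraph

variable {V : Type}

/-- The weight of a walk: the sum of the weights of its edges. -/
def walkWeight (G : WGraph V) {u v : V} (p : G.graph.Walk u v) : ℝ≥0 :=
  (p.edges.map G.weight).sum

/-- The distance `δ(u, v)`, equal to `⊤` if `v` cannot be reached from `u`. -/
def dist (G : WGraph V) (u v : V) : ℝ≥0∞ :=
  ⨅ p : G.graph.Walk u v, (G.walkWeight p : ℝ≥0∞)

/-- A walk of minimum weight between its endpoints. -/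
def IsShortest (G : WGraph V) {u v : V} (p : G.graph.Walk u v) : Prop :=
  (G.walkWeight p : ℝ≥0∞) = G.dist u v

/-- `W_i(P)` for `i ≥ 1`: the weight of the `i`-th heaviest edge of `P`
(`0` if `P` has fewer than `i` edges). -/
def heaviest (G : WGraph V) (i : ℕ) {u v : V} (p : G.graph.Walk u v) : ℝ≥0 :=
  ((p.edges.map G.weight).insertionSort (· ≥ ·)).getD (i - 1) 0

/-- The distance `δ(u, S)` from a vertex to a set of vertices, `⊤` for the empty set. -/
def distSet (G : WGraph V) (u : V) (S : Set V) : ℝ≥0∞ :=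
  ⨅ s ∈ S, G.dist u s

/-- `B(u, A, S)`: the members of `A` that are strictly closer to `u` than the set `S`. -/
def ball (G : WGraph V) (u : V) (A S : Set V) : Set V :=
  {a | a ∈ A ∧ G.dist u a < G.distSet u S}

/-- `E_S`: the edges that are strictly lighter than the distance of one of
their endpoints to `S`. -/
def InE (G : WGraph V) (S : Set V) (u v : V) : Prop :=
  G.graph.Adj u v ∧
    ((G.weight s(u, v) : ℝ≥0∞) < G.distSet u S ∨ (G.weight s(u, v) : ℝ≥0∞) < G.distSet v S)

/-- `H` is an `(α, β)`-emulator of `G`, where the additive term `β P` may depend on a shortest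
path `P` between the two vertices; the upper bound is required for every shortest path. -/
def IsEmulator (G H : WGraph V) (α : ℝ≥0)
    (β : ∀ ⦃u v : V⦄, G.graph.Walk u v → ℝ≥0) : Prop :=
  ∀ u v : V, G.dist u v ≤ H.dist u v ∧
    ∀ p : G.graph.Walk u v, G.IsShortest p →
      H.dist u v ≤ (α : ℝ≥0∞) * G.dist u v + (β p : ℝ≥0∞)

/-- `adj` is an adjacency-list representation of `G`: the list `adj u` contains each neighbour
of `u` exactly once, together with the weight of the edge. -/
def IsAdjList {n : ℕ} (G : WGraph (Fin n)) (adj : Fin n → List (Fin n × ℝ≥0)) : Prop :=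
  ∀ u, (adj u).Nodup ∧
    ∀ v x, (v, x) ∈ adj u ↔ G.graph.Adj u v ∧ x = G.weight s(u, v)

/-- The list `L` of weighted vertex pairs lists the edges of `H` with their weights: every entry
is an edge of `H` with its weight, and every edge of `H` is listed at least once, in one of
its two orientations. -/
def IsEdgeList {n : ℕ} (H : WGraph (Fin n)) (L : List (Fin n × Fin n × ℝ≥0∞)) : Prop :=
  (∀ u v x, (u, v, x) ∈ L → H.graph.Adj u v ∧ x = (H.weight s(u, v) : ℝ≥0∞)) ∧
    ∀ u v, H.graph.Adj u v → ∃ x, (u, v, x) ∈ L ∨ (v, u, x) ∈ L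

end WGraph

/-! ## The random hierarchy -/

/-- The coin tosses: the coin `ω j v` decides whether `v`, if it belongs to `S_j`, is sampled
into `S_{j+1}`. -/
abbrev Coins (k n : ℕ) : Type := Fin (k - 1) → Fin n → Bool

/-- The hierarchy `V = S_0 ⊇ S_1 ⊇ ⋯ ⊇ S_{k-1}`, with `S_i = ∅` for `i ≥ k`. -/
def hier {k n : ℕ} (ω : Coins k n) (i : ℕ) : Set (Fin n) :=
  {v | i < k ∧ ∀ j : Fin (k - 1), (j : ℕ) < i → ω j v = true}

/-- The sampling probability `n ^ (-1/k)`. -/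
def sampleProb (k n : ℕ) : ℝ := (n : ℝ) ^ (-(1 / (k : ℝ)))

/-- The probability of an outcome of the coin tosses: all coins are independent and show `true`
with probability `n ^ (-1/k)`. -/
def coinProb {k n : ℕ} (ω : Coins k n) : ℝ :=
  ∏ j, ∏ v, if ω j v then sampleProb k n else 1 - sampleProb k n

/-- The expectation of a random variable over the coin tosses. -/
def expect {k n : ℕ} (X : Coins k n → ℝ) : ℝ := ∑ ω, coinProb ω * X ω

/-- What has to hold for the weights of the auxiliary edges of `H`, with respect to a hierarchy
`S` with `k` levels and a choice `piv i u` of pivots `p_i(u)`. Pairs of equal vertices (whose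
distance is `0`) need no edge. -/
structure AuxWeights {V : Type} (G H : WGraph V) (k : ℕ) (S : ℕ → Set V)
    (piv : ℕ → V → V) : Prop where
  /-- `piv i u` is a nearest vertex of `S_i`, whenever `u` can reach `S_i`. -/
  pivot : ∀ i u, 1 ≤ i → i < k → G.distSet u (S i) ≠ ⊤ →
    piv i u ∈ S i ∧ G.dist u (piv i u) = G.distSet u (S i)
  /-- The edges of `D`, from each vertex to its pivots, are present with exact weight. -/
  toPivot : ∀ i u, 1 ≤ i → i < k → G.distSet u (S i) ≠ ⊤ → u ≠ piv i u →
    H.graph.Adj u (piv i u) ∧ (H.weight s(u, piv i u) : ℝ≥0∞) = G.dist u (piv i u)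
  /-- The edges of `E_1` are present with exact weight. -/
  inE1 : ∀ u v, G.InE (S 1) u v →
    H.graph.Adj u v ∧ (H.weight s(u, v) : ℝ≥0∞) = G.dist u v
  /-- The edges of `B_1(V)` are present with exact weight; for `i = k - 1` these are the pairs of
  `V × S_{k-1}` at finite distance. -/
  bunch1 : ∀ i u s, i + 1 ≤ k → s ∈ G.ball u (S i) (S (i + 1)) → u ≠ s →
    H.graph.Adj u s ∧ (H.weight s(u, s) : ℝ≥0∞) = G.dist u s
  /-- The edges of `B_2(S_1)` are present with exact weight; for `i = k - 2` these are the pairs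
  of `S_1 × S_{k-2}` at finite distance. -/
  bunch2 : ∀ i u s, i + 2 ≤ k → u ∈ S 1 → s ∈ G.ball u (S i) (S (i + 2)) → u ≠ s →
    H.graph.Adj u s ∧ (H.weight s(u, s) : ℝ≥0∞) = G.dist u s
  /-- An edge of `S_i × S_j`, `i + j = k - 1`, between pivots of the endpoints of an edge `xy`
  of `G` is present with a weight that is at most the weight of the path from `p_i(x)` through
  `x` and `y` to `p_j(y)`. -/
  product : ∀ i j x y, 1 ≤ i → 1 ≤ j → i + j + 1 = k → G.graph.Adj x y →
    G.distSet x (S i) ≠ ⊤ → G.distSet y (S j) ≠ ⊤ → piv i x ≠ piv j y →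
    H.graph.Adj (piv i x) (piv j y) ∧
      (H.weight s(piv i x, piv j y) : ℝ≥0∞) ≤
        G.dist x (piv i x) + (G.weight s(x, y) : ℝ≥0∞) + G.dist y (piv j y)

/-! ## Step-counting computations

A computation returns its value together with the number of elementary steps it takes. The
elementary steps are: reading or writing one cell of an array, allocating one cell, creating or
inspecting one node of a list or of a heap, starting one pass of a loop, one bounded group of
comparisons and additions of weights or small integers, and reading one coin. -/

/-- A value together with the number of steps spent to compute it. -/
structure TimeM (α : Type) where
  val : α
  time : ℕ

namespace TimeM

instance : Monad TimeM where
  pure a := ⟨a, 0⟩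
  bind m f := ⟨(f m.val).val, m.time + (f m.val).time⟩

/-- One elementary step. -/
def tick : TimeM Unit := ⟨(), 1⟩

/-- Read one array cell. -/
def rd {ι α : Type} (a : ι → α) (i : ι) : TimeM α := ⟨a i, 1⟩

/-- Write one array cell. -/
def wr {ι α : Type} [DecidableEq ι] (a : ι → α) (i : ι) (x : α) : TimeM (ι → α) :=
  ⟨Function.update a i x, 1⟩

/-- Allocate an array of `N` cells, the cell `i` being initialised by `f i`. -/
def alloc {ι α : Type} (N : ℕ) (f : ι → α) : TimeM (ι → α) := ⟨f, N⟩

/-- Run `f` once for each entry of a list, passing on a state; one step for each pass, and one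
for leaving the loop, are charged on top of the steps of the body. -/
def loop {α σ : Type} : List α → σ → (σ → α → TimeM σ) → TimeM σ
  | [], s, _ => do
    tick
    pure s
  | a :: l, s, f => do
    tick
    let s' ← f s a
    loop l s' f

end TimeM

open TimeM

/-! ## A mergeable priority queue (leftist heap) -/

/-- A heap node stores its rank, a key, and two vertices as data. -/
inductive Heap (n : ℕ) : Type
  | nil : Heap n
  | node (rank : ℕ) (key : ℝ≥0∞) (v r : Fin n) (left right : Heap n) : Heap n

namespace Heap

variable {n : ℕ}

def rank : Heap n → ℕ
  | nil => 0
  | node k _ _ _ _ _ => k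

/-- Join two heaps below a new root, the one of larger rank on the left. -/
def join (x : ℝ≥0∞) (v r : Fin n) (a b : Heap n) : Heap n :=
  if b.rank ≤ a.rank then node (b.rank + 1) x v r a b else node (a.rank + 1) x v r b a

/-- Merge two heaps along their right spines. -/
def merge : Heap n → Heap n → TimeM (Heap n)
  | nil, b => do
    tick
    pure b
  | node k x v r l t, nil => do
    tick
    pure (node k x v r l t)
  | node k x v r l t, node k' x' v' r' l' t' => do
    tick
    if x ≤ x' then
      let m ← merge t (node k' x' v' r' l' t')
      pure (join x v r l m)
    else
      let m ← merge (node k x v r l t) t'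
      pure (join x' v' r' l' m)
termination_by a b => sizeOf a + sizeOf b

/-- Insert an entry. -/
def push (h : Heap n) (x : ℝ≥0∞) (v r : Fin n) : TimeM (Heap n) := do
  tick
  merge (node 1 x v r nil nil) h

/-- Remove an entry of minimum key. -/
def pop : Heap n → TimeM (Option (ℝ≥0∞ × Fin n × Fin n × Heap n))
  | nil => do
    tick
    pure none
  | node _ x v r a b => do
    tick
    let h ← merge a b
    pure (some (x, v, r, h))

end Heap

/-! ## Shortest paths from a set of sources -/

/-- Adjacency lists with weights. -/
abbrev AdjArray (n : ℕ) : Type := Fin n → List (Fin n × ℝ≥0)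

/-- The result of a shortest path computation: the array of distances to the nearest source
(`⊤` if no source can be reached), and the array of nearest sources. -/
structure SPResult (n : ℕ) : Type where
  dist : Fin n → ℝ≥0∞
  root : Fin n → Fin n

/-- The result in which no vertex is reached. -/
def noSource (n : ℕ) : TimeM (SPResult n) := do
  let d ← alloc n fun _ => ⊤
  let r ← alloc n fun v => v
  pure ⟨d, r⟩

/-- The main loop of Dijkstra's algorithm. A vertex is settled when its distance is below `⊤`.
The loop ends when the heap is empty; the first argument bounds the number of its passes. -/
def dijkstraLoop {n : ℕ} (adj : AdjArray n) : ℕ → Heap n → SPResult n → TimeM (SPResult n)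
  | 0, _, t => pure t
  | fuel + 1, h, t => do
    match ← h.pop with
    | none => pure t
    | some (x, v, r, h) => do
      let dv ← rd t.dist v
      tick
      if dv < ⊤ then
        dijkstraLoop adj fuel h t
      else
        let dist ← wr t.dist v x
        let root ← wr t.root v r
        let nbrs ← rd adj v
        let h ← loop nbrs h fun h e => h.push (x + (e.2 : ℝ≥0∞)) e.1 r
        dijkstraLoop adj fuel h ⟨dist, root⟩

/-- Dijkstra's algorithm, over the graph given by `adj`, from a list of sources. At most one heap
entry is created for each source and for each entry of `adj`; their number is counted first. -/
def dijkstra {n : ℕ} (adj : AdjArray n) (src : List (Fin n)) : TimeM (SPResult n) := do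
  let t ← noSource n
  let m ← loop (List.finRange n) 0 fun m u => do
    let nbrs ← rd adj u
    loop nbrs m fun m _ => pure (m + 1)
  let (h, m) ← loop src (Heap.nil, m) fun (h, m) s => do
    let h ← h.push 0 s s
    pure (h, m + 1)
  dijkstraLoop adj m h t

/-! ## The emulator algorithm -/

section Algorithm

variable {k n : ℕ}

/-- The largest `i ≤ k - 1` with `v ∈ S_i`, found by tossing the coins of `v` in turn. -/
def findLevel (ω : Coins k n) (v : Fin n) : TimeM ℕ := do
  let (_, l) ← loop (List.finRange (k - 1)) (true, 0) fun (alive, l) j => do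
    let c ← rd (ω j) v
    if alive && c then pure (true, l + 1) else pure (false, l)
  pure l

/-- The list of the vertices of level at least `i`. -/
def members (lev : Fin n → ℕ) (i : ℕ) : TimeM (List (Fin n)) :=
  loop (List.finRange n) [] fun L v => do
    let l ← rd lev v
    tick
    if i ≤ l then pure (v :: L) else pure L

/-- The adjacency lists of `E_S`, given the distances of all vertices to `S`. -/
def restrictEdges (adj : AdjArray n) (t : SPResult n) : TimeM (AdjArray n) := do
  let E ← alloc n fun _ => []
  loop (List.finRange n) E fun E u => do
    let nbrs ← rd adj u
    let du ← rd t.dist u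
    let L ← loop nbrs [] fun L e => do
      let dv ← rd t.dist e.1
      tick
      if (e.2 : ℝ≥0∞) < du ∨ (e.2 : ℝ≥0∞) < dv then pure (e :: L) else pure L
    wr E u L

/-- The matrix `d[u, v]` of distance estimates. -/
abbrev Estimates (n : ℕ) : Type := Fin n × Fin n → ℝ≥0∞

/-- Lower `d[u, v]` and `d[v, u]` to `x` if `x` is smaller. -/
def relax (d : Estimates n) (u v : Fin n) (x : ℝ≥0∞) : TimeM (Estimates n) := do
  let y ← rd d (u, v)
  tick
  if x < y then
    let d ← wr d (u, v) x
    wr d (v, u) x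
  else pure d

/-- Put the pair `u, v` with weight `d[u, v]` on the output list, unless `u = v` or `d[u, v]` is
infinite. -/
def addEdge (d : Estimates n) (F : List (Fin n × Fin n × ℝ≥0∞)) (u v : Fin n) :
    TimeM (List (Fin n × Fin n × ℝ≥0∞)) := do
  let x ← rd d (u, v)
  tick
  if u ≠ v ∧ x < ⊤ then pure ((u, v, x) :: F) else pure F

/-- The distance estimates: exact distances to the pivots, paths `p_i(x) — x — y — p_j(y)` through
the edges `xy` of the graph, and for each `i` shortest paths over the edge set `E_{i+2}` from each
vertex of `S_i` (with `E_{k+1} = E_k = E`; as `E_{i+1} ⊆ E_{i+2}`, this covers the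
shortest paths over `E_{i+1}`).
Here `S i` lists `S_i`, `P i` holds the pivots and the distances to `S_i`, and `E i`
holds `E_i`. -/
def estimate (k : ℕ) (adj : AdjArray n) (S : ℕ → List (Fin n)) (P : ℕ → SPResult n)
    (E : ℕ → AdjArray n) : TimeM (Estimates n) := do
  let d ← alloc (n * n) fun p => if p.1 = p.2 then 0 else ⊤
  let d ← loop (List.range (k - 1)) d fun d i => do
    let t ← rd P (i + 1)
    loop (List.finRange n) d fun d u => do
      let p ← rd t.root u
      let x ← rd t.dist u
      relax d u p x
  let d ← loop (List.finRange n) d fun d x => do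
    let nbrs ← rd adj x
    loop nbrs d fun d e => do
      let d ← relax d x e.1 (e.2 : ℝ≥0∞)
      loop (List.range (k - 1)) d fun d i => do
        let ti ← rd P (i + 1)
        let p ← rd ti.root x
        let dx ← rd ti.dist x
        loop (List.range (k - 1)) d fun d j => do
          let tj ← rd P (j + 1)
          let q ← rd tj.root e.1
          let dy ← rd tj.dist e.1
          relax d p q (dx + (e.2 : ℝ≥0∞) + dy)
  loop (List.range k) d fun d i => do
    let Ei ← rd E (min (i + 2) k)
    let Si ← rd S i
    loop Si d fun d s => do
      let t ← dijkstra Ei [s]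
      loop (List.finRange n) d fun d v => do
        let x ← rd t.dist v
        relax d s v x

/-- The output list `F`: the union of `D`, `E_1`, `B_1(V)`, `B_2(S_1)` and the products
`S_i × S_{k-1-i}`, where each pair gets its distance estimate as weight. -/
def collect (k : ℕ) (S : ℕ → List (Fin n)) (P : ℕ → SPResult n) (E : ℕ → AdjArray n)
    (d : Estimates n) : TimeM (List (Fin n × Fin n × ℝ≥0∞)) := do
  let F ← loop (List.range (k - 1)) [] fun F i => do
    let t ← rd P (i + 1)
    loop (List.finRange n) F fun F u => do
      let p ← rd t.root u
      addEdge d F u p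
  let E1 ← rd E 1
  let F ← loop (List.finRange n) F fun F u => do
    let nbrs ← rd E1 u
    loop nbrs F fun F e => addEdge d F u e.1
  let F ← loop (List.range k) F fun F i => do
    let Si ← rd S i
    let t ← rd P (i + 1)
    loop (List.finRange n) F fun F u => do
      let du ← rd t.dist u
      loop Si F fun F s => do
        let x ← rd d (u, s)
        tick
        if x < du then addEdge d F u s else pure F
  let S1 ← rd S 1
  let F ← loop (List.range (k - 1)) F fun F i => do
    let Si ← rd S i
    let t ← rd P (i + 2)
    loop S1 F fun F u => do
      let du ← rd t.dist u
      loop Si F fun F s => do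
        let x ← rd d (u, s)
        tick
        if x < du then addEdge d F u s else pure F
  loop (List.range k) F fun F i => do
    let Si ← rd S i
    let Sj ← rd S (k - 1 - i)
    loop Si F fun F a => loop Sj F fun F b => addEdge d F a b

/-- The algorithm. Its input is the parameter `k`, the number `n` of vertices, the adjacency lists
of a weighted graph and the coins; its output is the list of the edges of the
emulator with their weights. -/
def emulatorAlg (k n : ℕ) (adj : AdjArray n) (ω : Coins k n) :
    TimeM (List (Fin n × Fin n × ℝ≥0∞)) := do
  -- the hierarchy; the list of S_k stays empty
  let lev ← alloc n fun _ => 0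
  let lev ← loop (List.finRange n) lev fun lev v => do
    let l ← findLevel ω v
    wr lev v l
  let S ← alloc (k + 1) fun _ => []
  let S ← loop (List.range k) S fun S i => do
    let Si ← members lev i
    wr S i Si
  -- pivots and distances to S_1, ..., S_{k-1}; all distances to S_k stay infinite
  let t ← noSource n
  let P ← alloc (k + 1) fun _ => t
  let P ← loop (List.range (k - 1)) P fun P i => do
    let Si ← rd S (i + 1)
    let t ← dijkstra adj Si
    wr P (i + 1) t
  -- the edge sets E_1, ..., E_k
  let E ← alloc (k + 1) fun _ => adj
  let E ← loop (List.range k) E fun E i => do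
    let t ← rd P (i + 1)
    let Ei ← restrictEdges adj t
    wr E (i + 1) Ei
  let d ← estimate k adj S P E
  collect k S P E d

end Algorithm

end

/-! Stretch. Every edge of `E_1` is an edge of `H` with exact weight, so a shortest path `P` needs
detours only around its edges outside `E_1`, and both endpoints of such an edge lie within its
weight of `S_1` (`distSet_le_of_not_inE`). All detours come from one climbing argument, `ladder`.
Let `a`, `b` be at distance at most `D`, and let `p` in `S_i` be near `a`. Either `p` lies in the
bunch of `b`, which closes the route, or `b` has a pivot in `S_{i+c}` at distance at most `D` more,
and `a` and `b` change roles. The climb stops because `S_k` is empty. If only one edge of `P` is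
missing from `E_1`, a climb by single levels over `B_1(V)` bridges it with stretch `2k - 1`.
Otherwise the segment from the first to the last missing edge is bridged as a whole: its ends move
to pivots in `S_1`, and a climb by two levels over `B_2(S_1)` halves the number of swaps. For odd
`k` the double steps lead from level 1 exactly to level `k` (`dist_le_of_odd`); for even `k` a
single step comes first (`dist_le_of_even`). `dist_le_of_walk` charges the excess to the two
heaviest edges.

Weights. If `s` is closer to `u` than `S_j` is, then along a nearly shortest walk from `u` to `s`
the remaining weight always stays below the distance to `S_j`, so the walk uses only `E_j`
(`dist_restrict_le`). Hence searches from `S_i` over `E_{i+2}` give exact distances for all bunches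
of one or two levels. Estimates are never below distances, so `H` never underestimates.

Expectations. Apart from `D`, with at most `kn` pairs, each family is counted by one kind of event:
`t` lies in `S_a`, `s` lies in `S_b`, and no candidate ranked up to `s` lies in `S_c`, for a ranking
that does not depend on the coins. Coins of different vertices are independent, so a geometric sum
gives the expected count `3 p ^ (a + b) / p ^ c` with `p = n ^ (-1/k)` (`expect_bunch_le`). In the
output `c = a + b + 1`, which gives `3 / p` per vertex and level. For the searches `a = i`, `b = 0`
and `c = min (i + 2) k`, which gives at most `3 / p ^ 2` per pair of a source and an endpoint.
Requiring `t` in `S_i` within the event takes care of the dependence between `S_i` and `E_{i+2}`.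
Leftist heaps make each search linear in its input up to a logarithm (`dijkstra_spec`), and the
other phases take `k ^ 2 n ^ 2` steps up to a logarithm. -/

open scoped NNReal ENNReal

open TimeM
noncomputable section

/-! ### Values and running times of loops -/

namespace TimeM

variable {α β σ ι : Type}

@[simp] theorem val_pure (a : α) : (pure a : TimeM α).val = a := rfl
@[simp] theorem time_pure (a : α) : (pure a : TimeM α).time = 0 := rfl
@[simp] theorem val_bind (m : TimeM α) (f : α → TimeM β) : (m >>= f).val = (f m.val).val := rfl
@[simp] theorem time_bind (m : TimeM α) (f : α → TimeM β) :
    (m >>= f).time = m.time + (f m.val).time := rfl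

theorem bind_bind {γ : Type} (m : TimeM α) (f : α → TimeM β) (g : β → TimeM γ) :
    m >>= f >>= g = m >>= fun x => f x >>= g := by
  change TimeM.mk _ _ = TimeM.mk _ _
  exact congrArg (TimeM.mk _) (Nat.add_assoc _ _ _)

@[simp] theorem time_tick : tick.time = 1 := rfl
@[simp] theorem val_rd (a : ι → α) (i : ι) : (rd a i).val = a i := rfl
@[simp] theorem time_rd (a : ι → α) (i : ι) : (rd a i).time = 1 := rfl
@[simp] theorem val_wr [DecidableEq ι] (a : ι → α) (i : ι) (x : α) :
    (wr a i x).val = Function.update a i x := rfl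
@[simp] theorem time_wr [DecidableEq ι] (a : ι → α) (i : ι) (x : α) : (wr a i x).time = 1 := rfl
@[simp] theorem val_alloc (N : ℕ) (f : ι → α) : (alloc N f).val = f := rfl
@[simp] theorem time_alloc (N : ℕ) (f : ι → α) : (alloc N f).time = N := rfl
@[simp] theorem val_loop_nil (s : σ) (f : σ → α → TimeM σ) : (loop [] s f).val = s := rfl
@[simp] theorem time_loop_nil (s : σ) (f : σ → α → TimeM σ) : (loop [] s f).time = 1 := rfl
@[simp] theorem val_loop_cons (a : α) (l : List α) (s : σ) (f : σ → α → TimeM σ) :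
    (loop (a :: l) s f).val = (loop l (f s a).val f).val := rfl
@[simp] theorem time_loop_cons (a : α) (l : List α) (s : σ) (f : σ → α → TimeM σ) :
    (loop (a :: l) s f).time = 1 + ((f s a).time + (loop l (f s a).val f).time) := rfl

/-- Invariants of loops. -/
theorem loop_invariant (P : σ → Prop) {f : σ → α → TimeM σ} :
    ∀ (l : List α) (s : σ), P s → (∀ s, ∀ a ∈ l, P s → P (f s a).val) → P (loop l s f).val
  | [], _, hs, _ => hs
  | a :: l, s, hs, h => by
    rw [val_loop_cons]
    exact loop_invariant P l _ (h s a (by simp) hs) fun s b hb => h s b (by simp [hb])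

/-- The time of a loop, if the time of a pass is bounded while an invariant holds. -/
theorem time_loop_le (P : σ → Prop) (T : α → ℕ) {f : σ → α → TimeM σ} :
    ∀ (l : List α) (s : σ), P s →
      (∀ s, ∀ a ∈ l, P s → P (f s a).val ∧ (f s a).time ≤ T a) →
      (loop l s f).time ≤ (l.map fun a => T a + 1).sum + 1
  | [], _, _, _ => by simp
  | a :: l, s, hs, h => by
    have h1 := h s a (by simp) hs
    have h2 := time_loop_le P T l _ h1.1 fun s b hb => h s b (by simp [hb])
    simp only [time_loop_cons, List.map_cons, List.sum_cons]
    omega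

theorem time_loop_le_mul (T : ℕ) {f : σ → α → TimeM σ} (l : List α) (s : σ)
    (h : ∀ s, ∀ a ∈ l, (f s a).time ≤ T) : (loop l s f).time ≤ l.length * (T + 1) + 1 := by
  have := time_loop_le (fun _ => True) (fun _ => T) l s trivial
    fun s a ha _ => ⟨trivial, h s a ha⟩
  simpa using this

/-- A loop that writes the cells `φ a` of an array, at a position that no pass writes. -/
theorem loop_update_of_notMem [DecidableEq ι] {f : (ι → β) → α → TimeM (ι → β)} (φ : α → ι)
    (g : α → β) (hf : ∀ A a, (f A a).val = Function.update A (φ a) (g a)) (j : ι) :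
    ∀ (l : List α) (A : ι → β), (∀ a ∈ l, φ a ≠ j) → (loop l A f).val j = A j
  | [], _, _ => rfl
  | a :: l, A, h => by
    rw [val_loop_cons, loop_update_of_notMem φ g hf j l _ fun b hb => h b (by simp [hb]), hf,
      Function.update_of_ne (h a (by simp)).symm]

/-- A loop that writes the cells `φ a` of an array, at a position that some pass writes. -/
theorem loop_update_of_mem [DecidableEq ι] {f : (ι → β) → α → TimeM (ι → β)} (φ : α → ι)
    (hφ : Function.Injective φ)
    (g : α → β) (hf : ∀ A a, (f A a).val = Function.update A (φ a) (g a)) (j : α) :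
    ∀ (l : List α) (A : ι → β), j ∈ l → (loop l A f).val (φ j) = g j
  | a :: l, A, h => by
    rw [val_loop_cons]
    by_cases hj : j ∈ l
    · exact loop_update_of_mem φ hφ g hf j l _ hj
    · obtain rfl : j = a := by simpa [hj] using h
      rw [loop_update_of_notMem φ g hf (φ j) l _
        fun b hb he => hj (hφ he ▸ hb), hf, Function.update_self]

/-- A loop that collects the members of a list with a given property. -/
theorem loop_filter {p : α → Prop} [DecidablePred p] {f : List β → α → TimeM (List β)} {g : α → β}
    (hf : ∀ L a, (f L a).val = if p a then g a :: L else L) :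
    ∀ (l : List α) (L : List β),
      (loop l L f).val = (((l.filter p).map g).reverse ++ L)
  | [], _ => by simp
  | a :: l, L => by
    rw [val_loop_cons, loop_filter hf l, hf]
    by_cases h : p a <;> simp [h]

theorem loop_count {f : ℕ → α → TimeM ℕ} {g : α → ℕ} (hf : ∀ m a, (f m a).val = m + g a) :
    ∀ (l : List α) (m : ℕ), (loop l m f).val = m + (l.map g).sum
  | [], _ => by simp
  | a :: l, m => by
    rw [val_loop_cons, loop_count hf l, hf]
    simp [Nat.add_assoc]

end TimeM

/-! ### Leftist heaps -/

namespace Heap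

variable {n : ℕ}

@[simp] theorem rank_nil : (nil : Heap n).rank = 0 := rfl
@[simp] theorem rank_node (k : ℕ) (x : ℝ≥0∞) (v r : Fin n) (a b : Heap n) :
    (node k x v r a b).rank = k := rfl

/-- The entries of a heap. -/
def entries : Heap n → Multiset (ℝ≥0∞ × Fin n × Fin n)
  | nil => 0
  | node _ x v r a b => (x, v, r) ::ₘ (a.entries + b.entries)

/-- The heap order. -/
def Ordered : Heap n → Prop
  | nil => True
  | node _ x _ _ a b =>
    (∀ e ∈ a.entries, x ≤ e.1) ∧ (∀ e ∈ b.entries, x ≤ e.1) ∧ a.Ordered ∧ b.Ordered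

/-- The shape of a leftist heap with correct ranks. -/
def Leftist : Heap n → Prop
  | nil => True
  | node k _ _ _ a b => k = b.rank + 1 ∧ b.rank ≤ a.rank ∧ a.Leftist ∧ b.Leftist

theorem entries_join (x : ℝ≥0∞) (v r : Fin n) (a b : Heap n) :
    (join x v r a b).entries = (x, v, r) ::ₘ (a.entries + b.entries) := by
  unfold join
  split_ifs
  · rfl
  · simp [entries, add_comm]

theorem Leftist.join {a b : Heap n} (ha : a.Leftist) (hb : b.Leftist) (x : ℝ≥0∞) (v r : Fin n) :
    (Heap.join x v r a b).Leftist := by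
  unfold Heap.join
  split_ifs with h
  · exact ⟨rfl, h, ha, hb⟩
  · exact ⟨rfl, by omega, hb, ha⟩

theorem Ordered.join {a b : Heap n} (ha : a.Ordered) (hb : b.Ordered) {x : ℝ≥0∞} {v r : Fin n}
    (hxa : ∀ e ∈ a.entries, x ≤ e.1) (hxb : ∀ e ∈ b.entries, x ≤ e.1) :
    (Heap.join x v r a b).Ordered := by
  unfold Heap.join
  split_ifs with h
  · exact ⟨hxa, hxb, ha, hb⟩
  · exact ⟨hxb, hxa, hb, ha⟩

theorem entries_merge (a b : Heap n) : (merge a b).val.entries = a.entries + b.entries := by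
  induction a, b using merge.induct with
  | case1 b => simp [merge, entries]
  | case2 => simp [merge, entries]
  | case3 k x v r l t k' x' v' r' l' t' ih1 ih2 =>
    rw [merge]
    by_cases h : x ≤ x'
    · simp only [h, if_true, val_bind, val_pure, entries_join, ih1, entries,
        ← Multiset.singleton_add]
      abel
    · simp only [h, if_false, val_bind, val_pure, entries_join, ih2, entries,
        ← Multiset.singleton_add]
      abel

theorem Leftist.merge {a b : Heap n} (ha : a.Leftist) (hb : b.Leftist) :
    (Heap.merge a b).val.Leftist := by
  induction a, b using merge.induct with
  | case1 b => simpa [Heap.merge] using hb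
  | case2 => simpa [Heap.merge] using ha
  | case3 k x v r l t k' x' v' r' l' t' ih1 ih2 =>
    rw [Heap.merge]
    by_cases h : x ≤ x'
    · simpa [h] using Leftist.join ha.2.2.1 (ih1 ha.2.2.2 hb) x v r
    · simpa [h] using Leftist.join hb.2.2.1 (ih2 ha hb.2.2.2) x' v' r'

theorem Ordered.key_le {k : ℕ} {x : ℝ≥0∞} {v r : Fin n} {a b : Heap n}
    (h : (node k x v r a b).Ordered) : ∀ e ∈ (node k x v r a b).entries, x ≤ e.1 := by
  intro e he
  simp only [entries, Multiset.mem_cons, Multiset.mem_add] at he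
  rcases he with rfl | he | he
  exacts [le_rfl, h.1 e he, h.2.1 e he]

theorem Ordered.merge {a b : Heap n} (ha : a.Ordered) (hb : b.Ordered) :
    (Heap.merge a b).val.Ordered := by
  induction a, b using merge.induct with
  | case1 b => simpa [Heap.merge] using hb
  | case2 => simpa [Heap.merge] using ha
  | case3 k x v r l t k' x' v' r' l' t' ih1 ih2 =>
    rw [Heap.merge]
    by_cases h : x ≤ x'
    · simp only [h, if_true, val_bind, val_pure]
      refine Ordered.join ha.2.2.1 (ih1 ha.2.2.2 hb) ha.1 fun e he => ?_
      rw [entries_merge, Multiset.mem_add] at he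
      exact he.elim (ha.2.1 e) fun he => h.trans (hb.key_le e he)
    · simp only [h, if_false, val_bind, val_pure]
      refine Ordered.join hb.2.2.1 (ih2 ha hb.2.2.2) hb.1 fun e he => ?_
      rw [entries_merge, Multiset.mem_add] at he
      exact he.elim (fun he => (not_le.1 h).le.trans (ha.key_le e he)) (hb.2.1 e)

/-- Each recursive call moves one step down the right spine of one of the two heaps, and a correct
rank is the length of that spine. -/
theorem time_merge_le {a b : Heap n} (ha : a.Leftist) (hb : b.Leftist) :
    (Heap.merge a b).time ≤ a.rank + b.rank + 1 := by
  induction a, b using merge.induct with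
  | case1 b => simp [Heap.merge]
  | case2 => simp [Heap.merge]
  | case3 k x v r l t k' x' v' r' l' t' ih1 ih2 =>
    rw [Heap.merge]
    have h1 := ha.1
    have h2 := hb.1
    by_cases h : x ≤ x'
    · have := ih1 ha.2.2.2 hb
      simp only [h, if_true, time_bind, time_pure, time_tick, rank_node] at this ⊢
      omega
    · have := ih2 ha hb.2.2.2
      simp only [h, if_false, time_bind, time_pure, time_tick, rank_node] at this ⊢
      omega

/-- Both children have rank at least one less than the root, so the size bound doubles with each
rank. This makes heap operations logarithmic. -/
theorem Leftist.two_pow_rank_le {h : Heap n} (hh : h.Leftist) :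
    2 ^ h.rank ≤ h.entries.card + 1 := by
  induction h with
  | nil => simp [rank, entries]
  | node k x v r a b iha ihb =>
    obtain ⟨rfl, hr, ha, hb⟩ := hh
    have h1 := iha ha
    have h2 := ihb hb
    have h3 : 2 ^ b.rank ≤ 2 ^ a.rank := Nat.pow_le_pow_right two_pos hr
    simp only [rank_node, entries, Multiset.card_cons, Multiset.card_add, pow_succ]
    omega

theorem Leftist.rank_le {h : Heap n} (hh : h.Leftist) {M : ℕ} (hM : h.entries.card ≤ M) :
    h.rank ≤ Nat.log 2 (M + 1) :=
  Nat.le_log_of_pow_le one_lt_two (hh.two_pow_rank_le.trans (by omega))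

/-- A heap with the heap order and correct ranks. -/
def Valid (h : Heap n) : Prop := h.Ordered ∧ h.Leftist

theorem entries_push (h : Heap n) (x : ℝ≥0∞) (v r : Fin n) :
    (h.push x v r).val.entries = (x, v, r) ::ₘ h.entries := by
  simp [push, entries_merge, entries]

theorem Valid.push {h : Heap n} (hh : h.Valid) (x : ℝ≥0∞) (v r : Fin n) :
    (h.push x v r).val.Valid := by
  refine ⟨Ordered.merge (a := node 1 x v r nil nil) ?_ hh.1,
    Leftist.merge (a := node 1 x v r nil nil) ?_ hh.2⟩
  · simp [Ordered, entries]
  · simp [Leftist]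

theorem time_push_le {h : Heap n} (hh : h.Valid) {M : ℕ} (hM : h.entries.card ≤ M)
    (x : ℝ≥0∞) (v r : Fin n) : (h.push x v r).time ≤ Nat.log 2 (M + 1) + 3 := by
  have h1 := time_merge_le (a := node 1 x v r nil nil) (by simp [Leftist]) hh.2
  have h2 := hh.2.rank_le hM
  simp only [Heap.push, time_bind, time_tick]
  simp only [rank_node] at h1
  omega

theorem pop_eq_none {h : Heap n} : h.pop.val = none ↔ h.entries = 0 := by
  cases h <;> simp [pop, entries]

theorem Valid.pop {h h' : Heap n} (hh : h.Valid) {x : ℝ≥0∞} {v r : Fin n}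
    (hp : h.pop.val = some (x, v, r, h')) :
    h'.Valid ∧ h.entries = (x, v, r) ::ₘ h'.entries ∧ ∀ e ∈ h.entries, x ≤ e.1 := by
  cases h with
  | nil => simp [Heap.pop] at hp
  | node k x0 v0 r0 a b =>
    simp only [Heap.pop, val_bind, val_pure, Option.some.injEq, Prod.mk.injEq] at hp
    obtain ⟨rfl, rfl, rfl, rfl⟩ := hp
    refine ⟨⟨hh.1.2.2.1.merge hh.1.2.2.2, hh.2.2.2.1.merge hh.2.2.2.2⟩, ?_, hh.1.key_le⟩
    rw [entries_merge, entries]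

theorem time_pop_le {h : Heap n} (hh : h.Valid) {M : ℕ} (hM : h.entries.card ≤ M) :
    h.pop.time ≤ 2 * Nat.log 2 (M + 1) + 2 := by
  cases h with
  | nil => simp [Heap.pop]
  | node k x0 v0 r0 a b =>
    have h1 := time_merge_le hh.2.2.2.1 hh.2.2.2.2
    simp only [entries, Multiset.card_cons, Multiset.card_add] at hM
    have h2 := hh.2.2.2.1.rank_le (M := M) (by omega)
    have h3 := hh.2.2.2.2.rank_le (M := M) (by omega)
    simp only [Heap.pop, time_bind, time_tick, time_pure]
    omega

end Heap
end

/-! ### Distances and restricted edge sets -/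

open TimeM
noncomputable section

namespace WGraph

variable {V : Type} (G : WGraph V)

theorem dist_le_walk {u v : V} (p : G.graph.Walk u v) : G.dist u v ≤ G.walkWeight p :=
  iInf_le _ p

@[simp] theorem walkWeight_nil (u : V) :
    G.walkWeight (SimpleGraph.Walk.nil : G.graph.Walk u u) = 0 := rfl

@[simp] theorem walkWeight_cons {u v w : V} (h : G.graph.Adj u v) (p : G.graph.Walk v w) :
    G.walkWeight (.cons h p) = G.weight s(u, v) + G.walkWeight p := by
  simp [walkWeight]

theorem walkWeight_append {u v w : V} (p : G.graph.Walk u v) (q : G.graph.Walk v w) :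
    G.walkWeight (p.append q) = G.walkWeight p + G.walkWeight q := by
  simp [walkWeight]

theorem walkWeight_reverse {u v : V} (p : G.graph.Walk u v) :
    G.walkWeight p.reverse = G.walkWeight p := by
  simp [walkWeight, List.sum_reverse]

@[simp] theorem dist_self (u : V) : G.dist u u = 0 := by
  simpa using G.dist_le_walk (SimpleGraph.Walk.nil : G.graph.Walk u u)

theorem dist_comm (u v : V) : G.dist u v = G.dist v u := by
  have h : ∀ u v, G.dist u v ≤ G.dist v u := fun u v => le_iInf fun p => by
    simpa [walkWeight_reverse] using G.dist_le_walk p.reverse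
  exact le_antisymm (h u v) (h v u)

theorem dist_triangle (u v w : V) : G.dist u w ≤ G.dist u v + G.dist v w := by
  unfold dist
  simp only [ENNReal.iInf_add, ENNReal.add_iInf]
  refine le_iInf fun p => le_iInf fun q => ?_
  have h := G.dist_le_walk (q.append p)
  rwa [walkWeight_append, ENNReal.coe_add] at h

theorem dist_le_weight {u v : V} (h : G.graph.Adj u v) : G.dist u v ≤ G.weight s(u, v) := by
  simpa using G.dist_le_walk (.cons h .nil)

theorem distSet_le {S : Set V} {s : V} (hs : s ∈ S) (u : V) : G.distSet u S ≤ G.dist u s :=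
  iInf₂_le s hs

theorem distSet_eq_zero {S : Set V} {s : V} (hs : s ∈ S) : G.distSet s S = 0 := by
  simpa using G.distSet_le hs s

theorem distSet_le_add (S : Set V) (u v : V) : G.distSet u S ≤ G.dist u v + G.distSet v S := by
  unfold distSet
  simp only [ENNReal.add_iInf]
  exact le_iInf₂ fun s hs => (iInf₂_le s hs).trans (G.dist_triangle u v s)

@[simp] theorem distSet_empty (u : V) : G.distSet u ∅ = ⊤ := by simp [distSet]

theorem distSet_anti {S T : Set V} (h : S ⊆ T) (u : V) : G.distSet u T ≤ G.distSet u S :=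
  biInf_mono h

theorem InE.symm {G : WGraph V} {S : Set V} {u v : V} (h : G.InE S u v) : G.InE S v u := by
  refine ⟨h.1.symm, ?_⟩
  rw [Sym2.eq_swap]
  exact h.2.symm

/-- The graph `(V, E_S)`. -/
def restrict (S : Set V) : WGraph V where
  graph :=
    { Adj := G.InE S
      symm := ⟨fun _ _ h => h.symm⟩
      loopless := ⟨fun _ h => h.1.ne rfl⟩ }
  weight := G.weight

theorem dist_le_dist_restrict (S : Set V) (u v : V) : G.dist u v ≤ (G.restrict S).dist u v := by
  refine le_iInf fun p => ?_
  induction p with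
  | nil => simp
  | cons h p ih =>
    rw [walkWeight_cons, ENNReal.coe_add]
    exact (G.dist_triangle _ _ _).trans (add_le_add (G.dist_le_weight h.1) ih)

/-- The hypothesis passes to every suffix of the walk: a step along an edge lowers the distance to
`S` by at most the weight that it removes from the walk. So every edge is lighter than the distance
from its tail to `S`. -/
theorem dist_restrict_le_walk (S : Set V) {u v : V} (p : G.graph.Walk u v)
    (hp : (G.walkWeight p : ℝ≥0∞) < G.distSet u S) :
    (G.restrict S).dist u v ≤ G.walkWeight p := by
  induction p with
  | nil => simp
  | @cons u u' v h p ih =>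
    rw [walkWeight_cons, ENNReal.coe_add] at hp ⊢
    have h1 : (G.walkWeight p : ℝ≥0∞) < G.distSet u' S := by
      refine lt_of_add_lt_add_left (hp.trans_le ((G.distSet_le_add S u u').trans ?_))
      exact add_le_add_left (G.dist_le_weight h) _
    have h2 : (G.restrict S).graph.Adj u u' := ⟨h, Or.inl (lt_of_le_of_lt le_self_add hp)⟩
    exact ((G.restrict S).dist_triangle _ _ _).trans
      (add_le_add ((G.restrict S).dist_le_weight h2) (ih h1))

/-- Shortest paths to the vertices closer than `S` use only the edges of `E_S`. -/
theorem dist_restrict_le (S : Set V) {u v : V} (h : G.dist u v < G.distSet u S) :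
    (G.restrict S).dist u v ≤ G.dist u v := by
  refine le_of_forall_gt fun c hc => ?_
  -- A walk close enough to the infimum suffices; attainment of the infimum is not needed.
  obtain ⟨p, hp⟩ := iInf_lt_iff.1 (lt_min hc h)
  exact (G.dist_restrict_le_walk S p (hp.trans_le (min_le_right _ _))).trans_lt
    (hp.trans_le (min_le_left _ _))

end WGraph

/-! ### Correctness and running time of Dijkstra's algorithm -/

variable {n : ℕ}

theorem entries_loop_push (x : ℝ≥0∞) (r : Fin n) :
    ∀ (l : List (Fin n × ℝ≥0)) (h : Heap n),
      (loop l h fun h e => h.push (x + (e.2 : ℝ≥0∞)) e.1 r).val.entries =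
        (l.map fun e => (x + (e.2 : ℝ≥0∞), e.1, r) : Multiset _) + h.entries
  | [], _ => by simp
  | e :: l, h => by
    rw [val_loop_cons, entries_loop_push x r l, Heap.entries_push, List.map_cons,
      ← Multiset.cons_coe, Multiset.cons_add, Multiset.add_cons]

theorem valid_loop_push (x : ℝ≥0∞) (r : Fin n) (l : List (Fin n × ℝ≥0)) (h : Heap n)
    (hh : h.Valid) : (loop l h fun h e => h.push (x + (e.2 : ℝ≥0∞)) e.1 r).val.Valid :=
  loop_invariant _ l h hh fun _ _ _ hs => hs.push _ _ _

theorem time_loop_push_le (x : ℝ≥0∞) (r : Fin n) {M : ℕ} :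
    ∀ (l : List (Fin n × ℝ≥0)) (h : Heap n), h.Valid → h.entries.card + l.length ≤ M →
      (loop l h fun h e => h.push (x + (e.2 : ℝ≥0∞)) e.1 r).time ≤
        l.length * (Nat.log 2 (M + 1) + 4) + 1
  | [], _, _, _ => by simp
  | e :: l, h, hh, hM => by
    simp only [List.length_cons] at hM
    have h1 := Heap.time_push_le hh (M := M) (by omega) (x + (e.2 : ℝ≥0∞)) e.1 r
    have h2 := time_loop_push_le x r (M := M) l _ (hh.push (x + (e.2 : ℝ≥0∞)) e.1 r)
      (by rw [Heap.entries_push, Multiset.card_cons]; omega)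
    rw [time_loop_cons, List.length_cons, Nat.add_mul]
    omega

/-- The invariant of Dijkstra's algorithm. -/
structure DijkstraInv (G : WGraph (Fin n)) (src : Set (Fin n)) (h : Heap n) (t : SPResult n) :
    Prop where
  valid : h.Valid
  entry : ∀ x v r, (x, v, r) ∈ h.entries → x < ⊤ ∧ r ∈ src ∧ G.dist v r ≤ x
  settled : ∀ v, t.dist v < ⊤ →
    t.root v ∈ src ∧ G.dist v (t.root v) ≤ t.dist v ∧ t.dist v ≤ G.distSet v src
  source : ∀ s ∈ src, t.dist s < ⊤ ∨ ∃ r, (0, s, r) ∈ h.entries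
  nbr : ∀ u v, t.dist u < ⊤ → G.graph.Adj u v →
    t.dist v < ⊤ ∨ ∃ x r, (x, v, r) ∈ h.entries ∧ x ≤ t.dist u + G.weight s(u, v)

namespace DijkstraInv

variable {G : WGraph (Fin n)} {src : Set (Fin n)} {h : Heap n} {t : SPResult n}

/-- The walk must leave the settled vertices, and where it does so a heap entry has a key no larger
than the length travelled. As long as it stays among them, exactness of settled distances makes
`t.dist` grow by at most the weight of each edge. -/
theorem le_walk (hI : DijkstraInv G src h t) {x : ℝ≥0∞} (hx : ∀ e ∈ h.entries, x ≤ e.1)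
    {u v : Fin n} (p : G.graph.Walk u v) (hu : t.dist u < ⊤) (hv : ¬ t.dist v < ⊤) :
    x ≤ t.dist u + G.walkWeight p := by
  induction p with
  | nil => exact absurd hu hv
  | @cons u u' v ha p ih =>
    rw [WGraph.walkWeight_cons, ENNReal.coe_add, ← add_assoc]
    rcases hI.nbr u u' hu ha with h' | ⟨y, r, hy, hle⟩
    · refine (ih h' hv).trans (add_le_add_left ?_ _)
      have h1 := (hI.settled u' h').2.2
      have h2 := (hI.settled u hu)
      refine h1.trans ((G.distSet_le h2.1 u').trans ((G.dist_triangle u' u _).trans ?_))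
      rw [add_comm, G.dist_comm u' u]
      exact add_le_add h2.2.1 (G.dist_le_weight ha)
    · exact (hx _ hy).trans (hle.trans le_self_add)

/-- An unsettled vertex is at least as far from the sources as the least key of the heap. -/
theorem le_distSet (hI : DijkstraInv G src h t) {x : ℝ≥0∞} (hx : ∀ e ∈ h.entries, x ≤ e.1)
    {v : Fin n} (hv : ¬ t.dist v < ⊤) : x ≤ G.distSet v src := by
  refine le_iInf₂ fun s hs => ?_
  rw [G.dist_comm]
  refine le_iInf fun p => ?_
  rcases hI.source s hs with h' | ⟨r, hr⟩
  · have := hI.le_walk hx p h' hv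
    have h0 := (hI.settled s h').2.2
    rw [G.distSet_eq_zero hs, nonpos_iff_eq_zero] at h0
    simpa [h0] using this
  · have := hx _ hr
    simp only [nonpos_iff_eq_zero] at this
    simp [this]

theorem dist_eq (hI : DijkstraInv G src h t) (hh : h.entries = 0) (v : Fin n) :
    t.dist v = G.distSet v src := by
  by_cases hv : t.dist v < ⊤
  · obtain ⟨h1, h2, h3⟩ := hI.settled v hv
    exact le_antisymm h3 ((G.distSet_le h1 v).trans h2)
  · have h1 := hI.le_distSet (x := ⊤) (by simp [hh]) hv
    rw [top_le_iff] at h1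
    rw [h1]
    simpa using hv

theorem skip (hI : DijkstraInv G src h t) {h' : Heap n} {x : ℝ≥0∞} {v r : Fin n}
    (hp : h.pop.val = some (x, v, r, h')) (hv : t.dist v < ⊤) : DijkstraInv G src h' t := by
  obtain ⟨h1, h2, h3⟩ := hI.valid.pop hp
  refine ⟨h1, fun y w q hy => hI.entry y w q (by simp [h2, hy]), hI.settled, fun s hs => ?_,
    fun u w hu ha => ?_⟩
  · rcases hI.source s hs with h' | ⟨q, hq⟩
    · exact .inl h'
    · rw [h2, Multiset.mem_cons] at hq
      rcases hq with hq | hq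
      · simp only [Prod.mk.injEq] at hq
        exact .inl (hq.2.1 ▸ hv)
      · exact .inr ⟨q, hq⟩
  · rcases hI.nbr u w hu ha with h' | ⟨y, q, hq, hle⟩
    · exact .inl h'
    · rw [h2, Multiset.mem_cons] at hq
      rcases hq with hq | hq
      · simp only [Prod.mk.injEq] at hq
        exact .inl (hq.2.1 ▸ hv)
      · exact .inr ⟨y, q, hq, hle⟩

/-- The popped key is the exact distance: it is at least the distance to its root by `entry`, and at
most the distance to the sources by `le_distSet`. The new entries provide what `nbr` demands for the
neighbours of `v`. -/
theorem settle (hI : DijkstraInv G src h t) {adj : AdjArray n} (hadj : G.IsAdjList adj)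
    {h' : Heap n} {x : ℝ≥0∞} {v r : Fin n}
    (hp : h.pop.val = some (x, v, r, h')) (hv : ¬ t.dist v < ⊤) :
    DijkstraInv G src (loop (adj v) h' fun h e => h.push (x + (e.2 : ℝ≥0∞)) e.1 r).val
      ⟨Function.update t.dist v x, Function.update t.root v r⟩ := by
  obtain ⟨h1, h2, h3⟩ := hI.valid.pop hp
  obtain ⟨hx, hr, hd⟩ := hI.entry x v r (by simp [h2])
  have hset : ∀ w, t.dist w < ⊤ → Function.update t.dist v x w < ⊤ := fun w hw => by
    rwa [Function.update_of_ne]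
    rintro rfl
    exact hv hw
  have hmem : ∀ e, e ∈ (loop (adj v) h' fun h e => h.push (x + (e.2 : ℝ≥0∞)) e.1 r).val.entries ↔
      (∃ a ∈ adj v, (x + (a.2 : ℝ≥0∞), a.1, r) = e) ∨ e ∈ h'.entries := fun e => by
    rw [entries_loop_push, Multiset.mem_add, Multiset.mem_coe, List.mem_map]
  have hold : ∀ y w q, (y, w, q) ∈ h.entries → w ≠ v →
      (y, w, q) ∈ (loop (adj v) h' fun h e => h.push (x + (e.2 : ℝ≥0∞)) e.1 r).val.entries := by
    intro y w q hy hw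
    rw [hmem]
    rw [h2, Multiset.mem_cons] at hy
    refine hy.elim (fun hy => ?_) .inr
    simp only [Prod.mk.injEq] at hy
    exact absurd hy.2.1 hw
  refine ⟨valid_loop_push _ _ _ _ h1, fun y w q hy => ?_, fun w hw => ?_, fun s hs => ?_,
    fun u w hu ha => ?_⟩
  · rw [hmem] at hy
    rcases hy with ⟨⟨w', ω⟩, he, heq⟩ | hy
    · simp only [Prod.mk.injEq] at heq
      obtain ⟨rfl, rfl, rfl⟩ := heq
      obtain ⟨ha, rfl⟩ := ((hadj v).2 _ _).1 he
      refine ⟨by simpa using hx, hr, (G.dist_triangle w' v r).trans ?_⟩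
      rw [add_comm, G.dist_comm w' v]
      exact add_le_add hd (G.dist_le_weight ha)
    · exact hI.entry y w q (by simp [h2, hy])
  · by_cases hwv : w = v
    · subst hwv
      simp only [Function.update_self]
      exact ⟨hr, hd, hI.le_distSet h3 hv⟩
    · simp only [Function.update_of_ne hwv] at hw ⊢
      exact hI.settled w hw
  · by_cases hsv : s = v
    · subst hsv
      exact .inl (by simpa using hx)
    · rcases hI.source s hs with h' | ⟨q, hq⟩
      · exact .inl (hset s h')
      · exact .inr ⟨q, hold _ _ _ hq hsv⟩
  · by_cases hwv : w = v
    · subst hwv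
      exact .inl (by simpa using hx)
    by_cases huv : u = v
    · subst huv
      refine .inr ⟨x + (G.weight s(u, w) : ℝ≥0∞), r, (hmem _).2 (.inl ⟨(w, G.weight s(u, w)), ?_, rfl⟩), ?_⟩
      · exact ((hadj u).2 _ _).2 ⟨ha, rfl⟩
      · simp
    · simp only [Function.update_of_ne huv] at hu ⊢
      rcases hI.nbr u w hu ha with h' | ⟨y, q, hq, hle⟩
      · exact .inl (hset w h')
      · exact .inr ⟨y, q, hold _ _ _ hq hwv, hle⟩

end DijkstraInv

/-- The total length of the adjacency lists of the unsettled vertices. -/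
def unsettledDegree (adj : AdjArray n) (t : SPResult n) : ℕ :=
  open scoped Classical in
  ∑ v, if t.dist v < ⊤ then 0 else (adj v).length

/-- The entries pushed when `v` is settled are paid for by the drop of this potential. The key must
be finite, since a distance below `⊤` is what marks `v` as settled. -/
theorem unsettledDegree_settle (adj : AdjArray n) (t : SPResult n) {v r : Fin n} {x : ℝ≥0∞}
    (hv : ¬ t.dist v < ⊤) (hx : x < ⊤) :
    unsettledDegree adj ⟨Function.update t.dist v x, Function.update t.root v r⟩ + (adj v).length =
      unsettledDegree adj t := by
  classical
  unfold unsettledDegree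
  rw [Fintype.sum_eq_add_sum_compl v, Fintype.sum_eq_add_sum_compl v]
  simp only [Function.update_self, hx, hv, if_true, if_false, zero_add]
  rw [add_comm]
  congr 1
  refine Finset.sum_congr rfl fun w hw => ?_
  have : w ≠ v := by simpa using hw
  simp only [Function.update_of_ne this]

/-- Heap size plus unsettled degree drops by exactly one in each pass that pops an entry, whether
the vertex is skipped or settled. So the fuel cannot run out before the heap is empty, and `M`
bounds every heap size that occurs. -/
theorem dijkstraLoop_spec {G : WGraph (Fin n)} {adj : AdjArray n} (hadj : G.IsAdjList adj)
    {src : Set (Fin n)} {M : ℕ} :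
    ∀ (fuel : ℕ) (h : Heap n) (t : SPResult n), DijkstraInv G src h t →
      h.entries.card + unsettledDegree adj t ≤ fuel → fuel ≤ M →
      (∃ h', h'.entries = 0 ∧ DijkstraInv G src h' (dijkstraLoop adj fuel h t).val) ∧
      (dijkstraLoop adj fuel h t).time ≤ (fuel + 1) * (2 * Nat.log 2 (M + 1) + 8) +
        unsettledDegree adj t * (Nat.log 2 (M + 1) + 4)
  | 0, h, t, hI, hf, _ => by
    refine ⟨⟨h, Multiset.card_eq_zero.1 (by omega), hI⟩, ?_⟩
    simp [dijkstraLoop]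
  | fuel + 1, h, t, hI, hf, hM => by
    have htp := Heap.time_pop_le hI.valid (M := M) (by omega)
    rw [Nat.succ_mul (fuel + 1)]
    cases hp : h.pop.val with
    | none =>
      have hv : (dijkstraLoop adj (fuel + 1) h t).val = t := by simp [dijkstraLoop, hp]
      have ht : (dijkstraLoop adj (fuel + 1) h t).time = h.pop.time := by simp [dijkstraLoop, hp]
      exact ⟨⟨h, Heap.pop_eq_none.1 hp, by rwa [hv]⟩, by omega⟩
    | some e =>
      obtain ⟨x, v, r, h'⟩ := e
      obtain ⟨-, hent, -⟩ := hI.valid.pop hp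
      rw [hent, Multiset.card_cons] at hf
      by_cases hv : t.dist v < ⊤
      · have hval : (dijkstraLoop adj (fuel + 1) h t).val = (dijkstraLoop adj fuel h' t).val := by
          simp [dijkstraLoop, hp, hv]
        have ht : (dijkstraLoop adj (fuel + 1) h t).time =
            h.pop.time + (1 + (1 + (dijkstraLoop adj fuel h' t).time)) := by
          simp [dijkstraLoop, hp, hv]
        obtain ⟨i1, i2⟩ := dijkstraLoop_spec hadj (M := M) fuel h' t (hI.skip hp hv) (by omega)
          (by omega)
        rw [hval, ht]
        exact ⟨i1, by omega⟩
      · have hval : (dijkstraLoop adj (fuel + 1) h t).val = (dijkstraLoop adj fuel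
            (loop (adj v) h' fun h e => h.push (x + (e.2 : ℝ≥0∞)) e.1 r).val
            ⟨Function.update t.dist v x, Function.update t.root v r⟩).val := by
          simp [dijkstraLoop, hp, hv]
        have ht : (dijkstraLoop adj (fuel + 1) h t).time =
            h.pop.time + (1 + (1 + (1 + (1 + (1 +
              ((loop (adj v) h' fun h e => h.push (x + (e.2 : ℝ≥0∞)) e.1 r).time +
                (dijkstraLoop adj fuel
            (loop (adj v) h' fun h e => h.push (x + (e.2 : ℝ≥0∞)) e.1 r).val
            ⟨Function.update t.dist v x, Function.update t.root v r⟩).time)))))) := by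
          simp [dijkstraLoop, hp, hv]
        have hx : x < ⊤ := (hI.entry x v r (by simp [hent])).1
        have hU := unsettledDegree_settle adj t (r := r) hv hx
        have htl := time_loop_push_le x r (M := M) (adj v) h' (hI.valid.pop hp).1 (by omega)
        obtain ⟨i1, i2⟩ := dijkstraLoop_spec hadj (M := M) fuel _ _ (hI.settle hadj hp hv)
          (by rw [entries_loop_push, Multiset.card_add, Multiset.coe_card, List.length_map]; omega)
          (by omega)
        rw [hval, ht]
        refine ⟨i1, ?_⟩
        rw [← hU, Nat.add_mul (unsettledDegree _ _)]
        omega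

/-- The number of entries of adjacency lists. -/
def totalDegree (adj : AdjArray n) : ℕ := ∑ v, (adj v).length

/-- One pass of the loop that puts the sources into the heap. -/
def pushSource (s : Heap n × ℕ) (v : Fin n) : TimeM (Heap n × ℕ) := do
  let h ← s.1.push 0 v v
  pure (h, s.2 + 1)

theorem loop_pushSource_spec {M : ℕ} :
    ∀ (l : List (Fin n)) (s : Heap n × ℕ), s.1.Valid → s.1.entries.card + l.length ≤ M →
      (loop l s pushSource).val.1.Valid ∧
      (loop l s pushSource).val.1.entries =
        (l.map fun v => ((0 : ℝ≥0∞), v, v) : Multiset _) + s.1.entries ∧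
      (loop l s pushSource).val.2 = s.2 + l.length ∧
      (loop l s pushSource).time ≤ l.length * (Nat.log 2 (M + 1) + 4) + 1
  | [], s, hs, _ => by simp [hs]
  | v :: l, s, hs, hM => by
    simp only [List.length_cons] at hM
    have h1 := Heap.time_push_le hs (M := M) (by omega) 0 v v
    obtain ⟨i1, i2, i3, i4⟩ := loop_pushSource_spec (M := M) l ((s.1.push 0 v v).val, s.2 + 1)
      (hs.push 0 v v) (by rw [Heap.entries_push, Multiset.card_cons]; omega)
    have hv : (pushSource s v).val = ((s.1.push 0 v v).val, s.2 + 1) := rfl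
    have ht : (pushSource s v).time = (s.1.push 0 v v).time := rfl
    rw [val_loop_cons, time_loop_cons, hv, ht, List.length_cons, Nat.add_mul]
    refine ⟨i1, ?_, ?_, ?_⟩
    · rw [i2, Heap.entries_push, List.map_cons, ← Multiset.cons_coe, Multiset.cons_add,
        Multiset.add_cons]
    · rw [i3]
      omega
    · omega

theorem dijkstra_spec {G : WGraph (Fin n)} {adj : AdjArray n} (hadj : G.IsAdjList adj)
    (src : List (Fin n)) :
    (∀ v, (dijkstra adj src).val.dist v = G.distSet v {s | s ∈ src}) ∧
    (∀ v, G.distSet v {s | s ∈ src} ≠ ⊤ → (dijkstra adj src).val.root v ∈ src ∧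
      G.dist v ((dijkstra adj src).val.root v) = G.distSet v {s | s ∈ src}) ∧
    (dijkstra adj src).time ≤ (n + totalDegree adj + src.length + 1) *
      (3 * Nat.log 2 (totalDegree adj + src.length + 1) + 20) := by
  set count : ℕ → Fin n → TimeM ℕ := fun m u => do
    let nbrs ← rd adj u
    loop nbrs m fun m _ => pure (m + 1) with hcount
  have hinner : ∀ (l : List (Fin n × ℝ≥0)) (m : ℕ),
      (loop l m fun m _ => (pure (m + 1) : TimeM ℕ)).val = m + l.length := fun l m => by
    rw [loop_count (g := fun _ => 1) fun _ _ => rfl]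
    simp
  have hm : (loop (List.finRange n) 0 count).val = totalDegree adj := by
    rw [loop_count (f := count) (g := fun u => (adj u).length) fun m u => hinner _ _, zero_add, totalDegree,
      ← List.sum_ofFn, List.ofFn_eq_map]
  have hmt : (loop (List.finRange n) 0 count).time ≤ totalDegree adj + 3 * n + 1 := by
    refine (time_loop_le (fun _ => True) (fun u => (adj u).length + 2) _ _ trivial
      fun m u _ _ => ⟨trivial, ?_⟩).trans ?_
    · have := time_loop_le_mul 0 (f := fun m (_ : Fin n × ℝ≥0) => (pure (m + 1) : TimeM ℕ)) (adj u) m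
        fun _ _ _ => le_rfl
      simp only [hcount, time_bind, time_rd, val_rd]
      omega
    · rw [← List.ofFn_eq_map, List.sum_ofFn, totalDegree]
      simp only [Finset.sum_add_distrib]
      simp
      omega
  set M := totalDegree adj + src.length with hM
  obtain ⟨s1, s2, s3, s4⟩ := loop_pushSource_spec (n := n) (M := M) src (.nil, totalDegree adj)
    (by simp [Heap.Valid, Heap.Ordered, Heap.Leftist]) (by simp [Heap.entries, hM])
  set s := loop src (Heap.nil, totalDegree adj) pushSource with hs
  have hent : ∀ x v r, (x, v, r) ∈ s.val.1.entries ↔ v ∈ src ∧ x = 0 ∧ v = r := fun x v r => by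
    rw [s2, Multiset.mem_add, Multiset.mem_coe, List.mem_map]
    simp only [Heap.entries, Multiset.notMem_zero, or_false, Prod.mk.injEq]
    constructor
    · rintro ⟨a, ha, rfl, rfl, rfl⟩
      exact ⟨ha, rfl, rfl⟩
    · rintro ⟨ha, rfl, rfl⟩
      exact ⟨_, ha, rfl, rfl, rfl⟩
  have hI : DijkstraInv G {s | s ∈ src} s.val.1 (noSource n).val := by
    refine ⟨s1, fun x v r hx => ?_, fun v hv => ?_, fun v hv => ?_, fun u v hu => ?_⟩
    · obtain ⟨h1, rfl, rfl⟩ := (hent x v r).1 hx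
      exact ⟨by simp, h1, by simp⟩
    · exact absurd hv (by simp [noSource])
    · exact .inr ⟨v, (hent 0 v v).2 ⟨hv, rfl, rfl⟩⟩
    · exact absurd hu (by simp [noSource])
  have hU : unsettledDegree adj (noSource n).val = totalDegree adj := by
    simp [unsettledDegree, totalDegree, noSource]
  have hcard : s.val.1.entries.card = src.length := by
    rw [s2]
    simp [Heap.entries]
  -- At the start there is one entry per source and every vertex is unsettled, so the potential
  -- equals `M`, which is also the fuel counted by the algorithm.
  obtain ⟨⟨h', h0, hI'⟩, ht⟩ := dijkstraLoop_spec hadj (M := M) M s.val.1 (noSource n).val hI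
    (by rw [hU, hcard]; omega) le_rfl
  have hval : (dijkstra adj src).val = (dijkstraLoop adj M s.val.1 (noSource n).val).val := by
    have : (dijkstra adj src).val = (dijkstraLoop adj
      (loop src (Heap.nil, (loop (List.finRange n) 0 count).val) pushSource).val.2
      (loop src (Heap.nil, (loop (List.finRange n) 0 count).val) pushSource).val.1
      (noSource n).val).val := rfl
    rw [this, hm, s3]
  have htime : (dijkstra adj src).time = (noSource n).time +
      ((loop (List.finRange n) 0 count).time + (s.time +
      (dijkstraLoop adj M s.val.1 (noSource n).val).time)) := by
    have : (dijkstra adj src).time = (noSource n).time +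
      ((loop (List.finRange n) 0 count).time +
      ((loop src (Heap.nil, (loop (List.finRange n) 0 count).val) pushSource).time +
      (dijkstraLoop adj
      (loop src (Heap.nil, (loop (List.finRange n) 0 count).val) pushSource).val.2
      (loop src (Heap.nil, (loop (List.finRange n) 0 count).val) pushSource).val.1
      (noSource n).val).time)) := rfl
    rw [this, hm, s3]
  rw [hval, htime]
  refine ⟨hI'.dist_eq h0, fun v hv => ?_, ?_⟩
  · rw [← hI'.dist_eq h0] at hv ⊢
    obtain ⟨i1, i2, i3⟩ := hI'.settled v (lt_top_iff_ne_top.2 hv)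
    exact ⟨i1, le_antisymm i2 (i3.trans (G.distSet_le i1 v))⟩
  · rw [hU] at ht
    have hn : (noSource n).time = 2 * n := by simp [noSource, two_mul]
    rw [hn]
    set L := Nat.log 2 (M + 1)
    have hM' : n + totalDegree adj + src.length + 1 = n + M + 1 := by omega
    rw [hM']
    have e1 : src.length * (L + 4) ≤ M * (L + 4) := Nat.mul_le_mul_right _ (by omega)
    have e2 : totalDegree adj * (L + 4) + src.length * (L + 4) = M * (L + 4) := by
      rw [hM, Nat.add_mul]
    have e3 : totalDegree adj ≤ M := by omega
    nlinarith [Nat.zero_le (n * L), Nat.zero_le (M * L)]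
end

/-! ### The stretch of the emulator -/

open TimeM
noncomputable section

theorem le_getD_insertionSort {l : List ℝ≥0} {a : ℝ≥0} (ha : a ∈ l) :
    a ≤ (l.insertionSort (· ≥ ·)).getD 0 0 := by
  have h1 := List.pairwise_insertionSort (· ≥ ·) l
  have h2 := (List.mem_insertionSort (· ≥ ·)).2 ha
  revert h1 h2
  generalize l.insertionSort (· ≥ ·) = s
  intro h1 h2
  cases s with
  | nil => simp at h2
  | cons m s =>
    rcases List.mem_cons.1 h2 with rfl | h2
    · exact le_rfl
    · exact (List.pairwise_cons.1 h1).1 a h2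

/-- At most one of the two entries can occupy the head of the sorted list; the other is bounded by
the second entry. Stated for list positions, so equal values cause no trouble. -/
theorem add_le_getD_insertionSort {l l' : List ℝ≥0} {a b : ℝ≥0} (h : l.Perm (a :: b :: l')) :
    a + b ≤ (l.insertionSort (· ≥ ·)).getD 0 0 + (l.insertionSort (· ≥ ·)).getD 1 0 := by
  have h1 := List.pairwise_insertionSort (· ≥ ·) l
  have h2 := (List.perm_insertionSort (· ≥ ·) l).trans h
  revert h1 h2
  generalize l.insertionSort (· ≥ ·) = s
  intro h1 h2
  match s, h1, h2 with
  | [], _, h2 => simp at h2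
  | [_], _, h2 => exact absurd h2.length_eq (by simp)
  | m :: m' :: s, h1, h2 =>
    obtain ⟨h3, h4⟩ := List.pairwise_cons.1 h1
    obtain ⟨h4, -⟩ := List.pairwise_cons.1 h4
    have h5 : ∀ c ∈ m' :: s, c ≤ m' := by
      intro c hc
      rcases List.mem_cons.1 hc with rfl | hc
      exacts [le_rfl, h4 c hc]
    have ha : a ∈ m :: m' :: s := h2.mem_iff.2 (by simp)
    have hb : b ∈ m :: m' :: s := h2.mem_iff.2 (by simp)
    simp only [List.getD_cons_zero, List.getD_cons_succ]
    rcases List.mem_cons.1 ha with rfl | ha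
    · have : b ∈ m' :: s := ((List.perm_cons a).1 h2).mem_iff.2 (by simp)
      exact add_le_add le_rfl (h5 b this)
    · rw [add_comm]
      refine add_le_add ?_ (h5 a ha)
      rcases List.mem_cons.1 hb with rfl | hb
      exacts [le_rfl, h3 b hb]

namespace AuxWeights

variable {V : Type} {G H : WGraph V} {k : ℕ} {S : ℕ → Set V} {piv : ℕ → V → V}

theorem dist_le_of_mem_ball (hA : AuxWeights G H k S piv) {i : ℕ} {u s : V} (hi : i + 1 ≤ k)
    (hs : s ∈ G.ball u (S i) (S (i + 1))) : H.dist u s ≤ G.dist u s := by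
  by_cases h : u = s
  · simp [h]
  · obtain ⟨h1, h2⟩ := hA.bunch1 i u s hi hs h
    exact (H.dist_le_weight h1).trans h2.le

theorem dist_le_of_mem_ball_two (hA : AuxWeights G H k S piv) {i : ℕ} {u s : V} (hi : i + 2 ≤ k)
    (hu : u ∈ S 1) (hs : s ∈ G.ball u (S i) (S (i + 2))) : H.dist u s ≤ G.dist u s := by
  by_cases h : u = s
  · simp [h]
  · obtain ⟨h1, h2⟩ := hA.bunch2 i u s hi hu hs h
    exact (H.dist_le_weight h1).trans h2.le

/-- A failed bunch test bounds the distance to the next set; this converts the bound into a pivot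
that is equally close in `H`. -/
theorem exists_pivot (hA : AuxWeights G H k S piv) {i : ℕ} {u : V} {r : ℝ≥0} (hi : 1 ≤ i)
    (hik : i < k) (h : G.distSet u (S i) ≤ r) : ∃ p ∈ S i, H.dist u p ≤ r := by
  have hr : G.distSet u (S i) ≠ ⊤ := (h.trans_lt ENNReal.coe_lt_top).ne
  obtain ⟨h1, h2⟩ := hA.pivot i u hi hik hr
  refine ⟨piv i u, h1, ?_⟩
  by_cases hu : u = piv i u
  · rw [← hu]
    simp
  · obtain ⟨h3, h4⟩ := hA.toPivot i u hi hik hr hu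
    exact (H.dist_le_weight h3).trans (by rw [h4, h2]; exact h)

/-- The ladder argument of Thorup and Zwick with steps of `c` levels, between two vertices of a set
`X` whose members have exact edges to the members of their bunches for steps of `c` levels. -/
theorem ladder (hA : AuxWeights G H k S piv) (hle : ∀ u v, G.dist u v ≤ H.dist u v)
    (hS : S k = ∅) {c : ℕ} (hc : 1 ≤ c) {X : Set V}
    (hX : ∀ i u s, i + c ≤ k → u ∈ X → s ∈ G.ball u (S i) (S (i + c)) →
      H.dist u s ≤ G.dist u s) (D : ℝ≥0) :
    ∀ (t i : ℕ) (a b p : V) (r : ℝ≥0), i + c * (t + 1) = k → a ∈ X → b ∈ X → p ∈ S i →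
      H.dist a p ≤ r → G.dist a b ≤ D →
      H.dist a b ≤ ((2 * r + (2 * t + 1) * D : ℝ≥0) : ℝ≥0∞) := by
  intro t
  induction t with
  | zero =>
    intro i a b p r hi ha hb hp hr hD
    rw [zero_add, mul_one] at hi
    have hbp : G.dist b p ≤ ((D + r : ℝ≥0) : ℝ≥0∞) := by
      rw [ENNReal.coe_add]
      refine (G.dist_triangle b a p).trans (add_le_add ?_ ((hle a p).trans hr))
      rwa [G.dist_comm]
    -- The next set is `S k = ∅`, at infinite distance, so a finite distance already puts `p` into
    -- the bunch.
    have h := hX i b p hi.le hb ⟨hp, by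
      rw [hi, hS, G.distSet_empty]
      exact hbp.trans_lt ENNReal.coe_lt_top⟩
    refine (H.dist_triangle a p b).trans ((add_le_add hr (H.dist_comm p b ▸ h.trans hbp)).trans ?_)
    rw [← ENNReal.coe_add]
    refine ENNReal.coe_le_coe.2 (le_of_eq ?_)
    push_cast
    ring
  | succ t ih =>
    intro i a b p r hi ha hb hp hr hD
    have hbp : G.dist b p ≤ ((D + r : ℝ≥0) : ℝ≥0∞) := by
      rw [ENNReal.coe_add]
      refine (G.dist_triangle b a p).trans (add_le_add ?_ ((hle a p).trans hr))
      rwa [G.dist_comm]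
    have hc' : i + c < k := by nlinarith
    by_cases hball : G.dist b p < G.distSet b (S (i + c))
    · have h := hX i b p hc'.le hb ⟨hp, hball⟩
      refine (H.dist_triangle a p b).trans
        ((add_le_add hr (H.dist_comm p b ▸ h.trans hbp)).trans ?_)
      rw [← ENNReal.coe_add]
      refine ENNReal.coe_le_coe.2 ?_
      calc r + (D + r) = 2 * r + 1 * D := by ring
        _ ≤ 2 * r + (2 * ((t + 1 : ℕ) : ℝ≥0) + 1) * D := by
          gcongr
          exact le_add_self
    -- The roles of `a` and `b` swap and the radius grows to `D + r`: the induction hypothesis gives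
    -- `2 (D + r) + (2 t + 1) D = 2 r + (2 (t + 1) + 1) D`.
    · obtain ⟨q, hq, hbq⟩ := hA.exists_pivot (by omega) hc' ((not_lt.1 hball).trans hbp)
      have := ih (i + c) b a q (D + r) (by rw [← hi]; ring) hb ha hq hbq (G.dist_comm a b ▸ hD)
      rw [H.dist_comm]
      refine this.trans (ENNReal.coe_le_coe.2 (le_of_eq ?_))
      push_cast
      ring

/-- The classical Thorup–Zwick bound: single steps from level `0`, where `x` serves as its own pivot
with radius `0`, allow `k - 1` swaps. -/
theorem dist_le_of_edge (hA : AuxWeights G H k S piv) (hle : ∀ u v, G.dist u v ≤ H.dist u v)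
    (hS : S k = ∅) (hS0 : S 0 = Set.univ) (hk : 2 ≤ k) {x y : V} {w : ℝ≥0}
    (h : G.dist x y ≤ w) : H.dist x y ≤ (((2 * k - 1 : ℕ) * w : ℝ≥0) : ℝ≥0∞) := by
  obtain ⟨t, rfl⟩ : ∃ t, k = t + 1 := ⟨k - 1, by omega⟩
  have := hA.ladder hle hS le_rfl (X := Set.univ)
    (fun i u s hi _ hs => hA.dist_le_of_mem_ball hi hs) w t 0 x y x 0 (by ring) trivial trivial
    (by simp [hS0]) (by simp) h
  refine this.trans (ENNReal.coe_le_coe.2 (le_of_eq ?_))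
  rw [show 2 * (t + 1) - 1 = 2 * t + 1 by omega]
  push_cast
  ring

/-- The route is `x`, `a`, `b`, `y` with pivots `a`, `b` in `S 1` at distance at most `D + w + w'`.
Since `k - 1` is even, `m + 1` double steps lead from level `1`, with radius `0`, to level `k`. -/
theorem dist_le_of_odd (hA : AuxWeights G H k S piv) (hle : ∀ u v, G.dist u v ≤ H.dist u v)
    (hS : S k = ∅) {m : ℕ} (hk : k = 2 * m + 3) {x y : V} {D w w' : ℝ≥0}
    (h : G.dist x y ≤ D) (hx : G.distSet x (S 1) ≤ w) (hy : G.distSet y (S 1) ≤ w') :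
    H.dist x y ≤ ((w + (2 * m + 1) * (D + w + w') + w' : ℝ≥0) : ℝ≥0∞) := by
  obtain ⟨a, ha, hxa⟩ := hA.exists_pivot le_rfl (by omega) hx
  obtain ⟨b, hb, hyb⟩ := hA.exists_pivot le_rfl (by omega) hy
  have hab : G.dist a b ≤ ((D + w + w' : ℝ≥0) : ℝ≥0∞) := by
    refine (G.dist_triangle a y b).trans ?_
    refine (add_le_add_left (G.dist_triangle a x y) _).trans ?_
    rw [ENNReal.coe_add, ENNReal.coe_add, add_comm (D : ℝ≥0∞), G.dist_comm a x]
    exact add_le_add (add_le_add ((hle _ _).trans hxa) h) ((hle _ _).trans hyb)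
  have := hA.ladder hle hS (c := 2) (by omega) (X := S 1)
    (fun i u s hi hu hs => hA.dist_le_of_mem_ball_two hi hu hs) _ m 1 a b a 0 (by rw [hk]; ring)
    ha hb ha (by simp) hab
  rw [mul_zero, zero_add] at this
  refine (H.dist_triangle x b y).trans ?_
  refine (add_le_add_left (H.dist_triangle x a b) _).trans ?_
  rw [ENNReal.coe_add, ENNReal.coe_add, H.dist_comm b y]
  exact add_le_add (add_le_add hxa this) hyb

/-- Double steps from level `1` would miss level `k`, so the climb starts with a single step, at the
vertex `y` itself: its bunch from level `1` to `2` is available because `B_1` covers all vertices. A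
double step at `a` leads on to level `4`, and only then does `y` have to be replaced by its pivot
`b`. -/
theorem dist_le_of_even (hA : AuxWeights G H k S piv) (hle : ∀ u v, G.dist u v ≤ H.dist u v)
    (hS : S k = ∅) {m : ℕ} (hk : k = 2 * m + 2) {x y : V} {D w w' : ℝ≥0}
    (h : G.dist x y ≤ D) (hx : G.distSet x (S 1) ≤ w) (hy : G.distSet y (S 1) ≤ w') :
    H.dist x y ≤ ((w + (2 * m + 1) * (D + w) + (2 * m - 2 : ℕ) * w' : ℝ≥0) : ℝ≥0∞) := by
  obtain ⟨a, ha, hxa⟩ := hA.exists_pivot le_rfl (by omega) hx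
  suffices hay : H.dist a y ≤ (((2 * m + 1) * (D + w) + (2 * m - 2 : ℕ) * w' : ℝ≥0) : ℝ≥0∞) by
    refine (H.dist_triangle x a y).trans ?_
    rw [add_assoc, ENNReal.coe_add]
    exact add_le_add hxa hay
  have hD : G.dist y a ≤ ((D + w : ℝ≥0) : ℝ≥0∞) := by
    refine (G.dist_triangle y x a).trans ?_
    rw [ENNReal.coe_add, G.dist_comm y x]
    exact add_le_add h ((hle _ _).trans hxa)
  set Δ : ℝ≥0 := D + w
  have key : ∀ {z : ℝ≥0}, H.dist a y ≤ z → z ≤ (2 * m + 1) * Δ + (2 * m - 2 : ℕ) * w' →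
      H.dist a y ≤ (((2 * m + 1) * Δ + (2 * m - 2 : ℕ) * w' : ℝ≥0) : ℝ≥0∞) :=
    fun h1 h2 => h1.trans (ENNReal.coe_le_coe.2 h2)
  by_cases h1 : G.dist y a < G.distSet y (S 2)
  · refine key (z := Δ) ?_ ?_
    · rw [H.dist_comm]
      exact (hA.dist_le_of_mem_ball (by omega) ⟨ha, h1⟩).trans hD
    · calc Δ = 1 * Δ + 0 := by ring
        _ ≤ _ := by
          gcongr
          · exact le_add_self
          · exact zero_le
  -- For `m = 0` the test was against `S 2 = S k = ∅` and could not have failed. The same reasoning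
  -- at level `4` excludes `m = 1` below.
  have hm : 1 ≤ m := by
    by_contra hm
    obtain rfl : m = 0 := by omega
    rw [mul_zero, zero_add] at hk
    rw [← hk, hS, G.distSet_empty] at h1
    exact h1 (hD.trans_lt ENNReal.coe_lt_top)
  obtain ⟨p, hp, hyp⟩ := hA.exists_pivot (by omega) (by omega) ((not_lt.1 h1).trans hD)
  have hap : G.dist a p ≤ ((2 * Δ : ℝ≥0) : ℝ≥0∞) := by
    refine (G.dist_triangle a y p).trans ?_
    rw [two_mul, ENNReal.coe_add, G.dist_comm a y]
    exact add_le_add hD ((hle _ _).trans hyp)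
  by_cases h2 : G.dist a p < G.distSet a (S 4)
  · refine key (z := 2 * Δ + Δ) ?_ ?_
    · refine (H.dist_triangle a p y).trans ?_
      rw [ENNReal.coe_add, H.dist_comm p y]
      exact add_le_add ((hA.dist_le_of_mem_ball_two (by omega) ha ⟨hp, h2⟩).trans hap) hyp
    · calc 2 * Δ + Δ = (2 * 1 + 1) * Δ + 0 := by ring
        _ ≤ _ := by
          gcongr
          · exact_mod_cast hm
          · exact zero_le
  have hm2 : 2 ≤ m := by
    by_contra hm2
    obtain rfl : m = 1 := by omega
    norm_num at hk
    rw [← hk, hS, G.distSet_empty] at h2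
    exact h2 (hap.trans_lt ENNReal.coe_lt_top)
  obtain ⟨m, rfl⟩ := Nat.exists_eq_add_of_le' hm2
  obtain ⟨q, hq, haq⟩ := hA.exists_pivot (by omega) (by omega) ((not_lt.1 h2).trans hap)
  -- The pivot `b` enters only here, at level `4` with radius `2 * Δ`. This late start is why `w'`
  -- gets the smaller coefficient `2 m - 2`, which later falls on the second heaviest edge.
  obtain ⟨b, hb, hyb⟩ := hA.exists_pivot le_rfl (by omega) hy
  have hab : G.dist a b ≤ ((Δ + w' : ℝ≥0) : ℝ≥0∞) := by
    refine (G.dist_triangle a y b).trans ?_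
    rw [ENNReal.coe_add, G.dist_comm a y]
    exact add_le_add hD ((hle _ _).trans hyb)
  have := hA.ladder hle hS (c := 2) (by omega) (X := S 1)
    (fun i u s hi hu hs => hA.dist_le_of_mem_ball_two hi hu hs) _ m 4 a b q _ (by rw [hk]; ring)
    ha hb hq haq hab
  refine key (z := (2 * (2 * Δ) + (2 * m + 1) * (Δ + w')) + w') ?_ ?_
  · refine (H.dist_triangle a b y).trans ?_
    rw [ENNReal.coe_add, H.dist_comm b y]
    exact add_le_add this hyb
  · rw [show 2 * (m + 2) - 2 = 2 * m + 2 by omega]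
    push_cast
    apply le_of_eq
    ring

/-- A walk either stays in `E_1` or has a first edge outside of `E_1`. -/
theorem first_edge (hA : AuxWeights G H k S piv) {u v : V} (p : G.graph.Walk u v) :
    H.dist u v ≤ G.walkWeight p ∨ ∃ (x y : V) (h : G.graph.Adj x y) (q : G.graph.Walk u x)
      (r : G.graph.Walk y v), p = q.append (.cons h r) ∧ ¬ G.InE (S 1) x y ∧
        H.dist u x ≤ G.walkWeight q := by
  induction p with
  | nil => simp
  | @cons u u' v h p ih =>
    by_cases hE : G.InE (S 1) u u'
    · have h1 : H.dist u u' ≤ G.weight s(u, u') := by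
        obtain ⟨h1, h2⟩ := hA.inE1 u u' hE
        exact (H.dist_le_weight h1).trans (h2.le.trans (G.dist_le_weight h))
      have h2 : ∀ {z} (q : G.graph.Walk u' z), H.dist u' z ≤ G.walkWeight q →
          H.dist u z ≤ G.walkWeight (.cons h q) := fun q hq => by
        rw [WGraph.walkWeight_cons, ENNReal.coe_add]
        exact (H.dist_triangle _ _ _).trans (add_le_add h1 hq)
      rcases ih with ih | ⟨x, y, h', q, r, rfl, hxy, hq⟩
      · exact .inl (h2 p ih)
      · exact .inr ⟨x, y, h', .cons h q, r, rfl, hxy, h2 q hq⟩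
    · exact .inr ⟨u, u', h, .nil, p, rfl, hE, by simp⟩

/-- A walk either stays in `E_1` or has a last edge outside of `E_1`. -/
theorem last_edge (hA : AuxWeights G H k S piv) {u v : V} (p : G.graph.Walk u v) :
    H.dist u v ≤ G.walkWeight p ∨ ∃ (x y : V) (h : G.graph.Adj x y) (q : G.graph.Walk u x)
      (r : G.graph.Walk y v), p = q.append (.cons h r) ∧ ¬ G.InE (S 1) x y ∧
        H.dist y v ≤ G.walkWeight r := by
  induction p with
  | nil => simp
  | @cons u u' v h p ih =>
    rcases ih with ih | ⟨x, y, h', q, r, rfl, hxy, hr⟩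
    · by_cases hE : G.InE (S 1) u u'
      · obtain ⟨h1, h2⟩ := hA.inE1 u u' hE
        have h3 := (H.dist_le_weight h1).trans (h2.le.trans (G.dist_le_weight h))
        rw [WGraph.walkWeight_cons, ENNReal.coe_add]
        exact .inl ((H.dist_triangle _ _ _).trans (add_le_add h3 ih))
      · exact .inr ⟨u, u', h, .nil, p, rfl, hE, ih⟩
    · exact .inr ⟨x, y, h', .cons h q, r, rfl, hxy, hr⟩

theorem distSet_le_of_not_inE {S : Set V} {x y : V} (h : G.graph.Adj x y) (hn : ¬ G.InE S x y) :
    G.distSet x S ≤ G.weight s(x, y) ∧ G.distSet y S ≤ G.weight s(x, y) := by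
  simp only [WGraph.InE, not_and, not_or, not_lt] at hn
  exact hn h

theorem dist_le_of_walk (hA : AuxWeights G H k S piv) (hle : ∀ u v, G.dist u v ≤ H.dist u v)
    (hS : S k = ∅) (hS0 : S 0 = Set.univ) (hk : 2 ≤ k) {u v : V} (p : G.graph.Walk u v) :
    H.dist u v ≤ ((((2 * (k / 2) - 1 : ℕ) : ℝ≥0) * G.walkWeight p +
      (((2 * ((k + 1) / 2) : ℕ) : ℝ≥0) * G.heaviest 1 p +
        ((2 * ((k + 1) / 2 - 2) : ℕ) : ℝ≥0) * G.heaviest 2 p) : ℝ≥0) : ℝ≥0∞) := by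
  have key : ∀ {z : ℝ≥0} {z' : ℝ≥0}, H.dist u v ≤ z → z ≤ z' → H.dist u v ≤ z' :=
    fun h1 h2 => h1.trans (ENNReal.coe_le_coe.2 h2)
  have h1α : (1 : ℝ≥0) ≤ ((2 * (k / 2) - 1 : ℕ) : ℝ≥0) := by
    exact_mod_cast (show 1 ≤ 2 * (k / 2) - 1 by omega)
  rcases hA.first_edge p with hp | ⟨x, y, h, q, p', rfl, hxy, hq⟩
  · exact key hp ((le_mul_of_one_le_left (zero_le) h1α).trans le_self_add)
  have hw := distSet_le_of_not_inE h hxy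
  -- The last missing edge is sought in the part behind `y`; if there is none, `xy` is the only edge
  -- that needs a detour.
  rcases hA.last_edge p' with hp | ⟨x', y', h', q', r, rfl, hxy', hr⟩
  · have hedge := hA.dist_le_of_edge hle hS hS0 hk (G.dist_le_weight h)
    have hW : G.weight s(x, y) ≤ G.heaviest 1 (q.append (.cons h p')) :=
      le_getD_insertionSort (List.mem_map.2 ⟨s(x, y), by simp, rfl⟩)
    set w := G.weight s(x, y)
    set W := G.heaviest 1 (q.append (.cons h p'))
    refine key (z := G.walkWeight q + (2 * k - 1 : ℕ) * w + G.walkWeight p') ?_ ?_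
    · refine (H.dist_triangle u y v).trans ?_
      refine (add_le_add_left (H.dist_triangle u x y) _).trans ?_
      rw [ENNReal.coe_add, ENNReal.coe_add]
      exact add_le_add (add_le_add hq hedge) hp
    · rw [WGraph.walkWeight_append, WGraph.walkWeight_cons, ← add_assoc, ← add_assoc]
      refine le_trans ?_ le_self_add
      -- The first summand is the multiplicative stretch, to which `w` contributes as part of the
      -- path; the second is charged to the heaviest edge.
      rw [show 2 * k - 1 = (2 * (k / 2) - 1) + 2 * ((k + 1) / 2) by omega]
      rw [Nat.cast_add]
      set α : ℝ≥0 := ((2 * (k / 2) - 1 : ℕ) : ℝ≥0)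
      set β : ℝ≥0 := ((2 * ((k + 1) / 2) : ℕ) : ℝ≥0)
      calc G.walkWeight q + (α + β) * w + G.walkWeight p'
          = 1 * G.walkWeight q + α * w + 1 * G.walkWeight p' + β * w := by ring
        _ ≤ α * G.walkWeight q + α * w + α * G.walkWeight p' + β * W := by gcongr
        _ = _ := by ring
  · have hw' := distSet_le_of_not_inE h' hxy'
    set P := q.append (.cons h (q'.append (.cons h' r))) with hP
    -- The two missing edges occupy different positions of the edge list, so their total weight is
    -- at most that of the two heaviest, even if the walk repeats an edge.
    have hperm : (P.edges.map G.weight).Perm (G.weight s(x, y) :: G.weight s(x', y') ::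
        (q.edges ++ (q'.edges ++ r.edges)).map G.weight) := by
      rw [← List.map_cons, ← List.map_cons]
      refine List.Perm.map _ ?_
      simp only [hP, SimpleGraph.Walk.edges_append, SimpleGraph.Walk.edges_cons]
      refine List.perm_middle.trans (List.Perm.cons _ ?_)
      rw [← List.append_assoc, ← List.append_assoc]
      exact List.perm_middle
    have hW : G.weight s(x, y) ≤ G.heaviest 1 P :=
      le_getD_insertionSort (hperm.mem_iff.2 (by simp))
    have hWW : G.weight s(x, y) + G.weight s(x', y') ≤ G.heaviest 1 P + G.heaviest 2 P :=
      add_le_getD_insertionSort hperm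
    have hW' : G.weight s(x', y') ≤ G.heaviest 1 P :=
      le_getD_insertionSort (hperm.mem_iff.2 (by simp))
    have hD : G.dist x y' ≤
        ((G.weight s(x, y) + G.walkWeight q' + G.weight s(x', y') : ℝ≥0) : ℝ≥0∞) := by
      have := G.dist_le_walk (.cons h (q'.append (.cons h' .nil)))
      rwa [WGraph.walkWeight_cons, WGraph.walkWeight_append, WGraph.walkWeight_cons,
        WGraph.walkWeight_nil, add_zero, ← add_assoc] at this
    have hwt : G.walkWeight P = G.walkWeight q + (G.weight s(x, y) + G.walkWeight q' +
        G.weight s(x', y')) + G.walkWeight r := by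
      rw [hP, WGraph.walkWeight_append, WGraph.walkWeight_cons, WGraph.walkWeight_append,
        WGraph.walkWeight_cons]
      ring
    rw [hwt]
    set D := G.weight s(x, y) + G.walkWeight q' + G.weight s(x', y')
    set w := G.weight s(x, y)
    set w' := G.weight s(x', y')
    set W := G.heaviest 1 P
    set W' := G.heaviest 2 P
    have comb : ∀ {z : ℝ≥0}, H.dist x y' ≤ z →
        H.dist u v ≤ ((G.walkWeight q + z + G.walkWeight r : ℝ≥0) : ℝ≥0∞) := fun hz => by
      refine (H.dist_triangle u y' v).trans ?_
      refine (add_le_add_left (H.dist_triangle u x y') _).trans ?_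
      rw [ENNReal.coe_add, ENNReal.coe_add]
      exact add_le_add (add_le_add hq hz) hr
    rcases Nat.even_or_odd' k with ⟨m, hm | hm⟩
    · obtain ⟨m, rfl⟩ : ∃ m', m = m' + 1 := ⟨m - 1, by omega⟩
      refine key (comb (hA.dist_le_of_even hle hS (m := m) (by omega) hD hw.1 hw'.2)) ?_
      rw [show 2 * (k / 2) - 1 = 2 * m + 1 by omega, show 2 * ((k + 1) / 2) = 2 * m + 2 by omega,
        show 2 * ((k + 1) / 2 - 2) = 2 * m - 2 by omega]
      -- Which of the two edges is heavier is unknown. Splitting the coefficient of `w` into `4` and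
      -- `2 m - 2` reduces the claim to `w ≤ W` and `w + w' ≤ W + W'`; for `m = 0` the natural
      -- subtraction gives `0`.
      have hfin : (2 * m + 2) * w + (2 * m - 2 : ℕ) * w' ≤
          (2 * m + 2) * W + (2 * m - 2 : ℕ) * W' := by
        rcases Nat.eq_zero_or_pos m with rfl | hm0
        · simpa using hW
        · obtain ⟨m, rfl⟩ := Nat.exists_eq_add_of_le' hm0
          rw [show 2 * (m + 1) - 2 = 2 * m by omega]
          push_cast
          calc (2 * ((m : ℝ≥0) + 1) + 2) * w + 2 * m * w' = 4 * w + 2 * m * (w + w') := by ring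
            _ ≤ 4 * W + 2 * m * (W + W') := by gcongr
            _ = _ := by ring
      generalize ((2 * m - 2 : ℕ) : ℝ≥0) = γ at hfin ⊢
      push_cast
      calc G.walkWeight q + (w + (2 * (m : ℝ≥0) + 1) * (D + w) + γ * w') + G.walkWeight r
          = 1 * G.walkWeight q + (2 * m + 1) * D + 1 * G.walkWeight r +
            ((2 * m + 2) * w + γ * w') := by ring
        _ ≤ (2 * m + 1) * G.walkWeight q + (2 * m + 1) * D + (2 * m + 1) * G.walkWeight r +
            ((2 * m + 2) * W + γ * W') := by
          gcongr ?_ * _ + _ + ?_ * _ + ?_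
          · exact le_add_self
          · exact le_add_self
        _ = _ := by ring
    · obtain ⟨m, rfl⟩ : ∃ m', m = m' + 1 := ⟨m - 1, by omega⟩
      refine key (comb (hA.dist_le_of_odd hle hS (m := m) (by omega) hD hw.1 hw'.2)) ?_
      rw [show 2 * (k / 2) - 1 = 2 * m + 1 by omega, show 2 * ((k + 1) / 2) = 2 * m + 4 by omega,
        show 2 * ((k + 1) / 2 - 2) = 2 * m by omega]
      push_cast
      -- Of the `2 m + 2` copies of `w + w'`, two are bounded by `2 W` each and the others by `W +
      -- W'`, whence the coefficients `2 m + 4` and `2 m`.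
      calc G.walkWeight q + (w + (2 * (m : ℝ≥0) + 1) * (D + w + w') + w') + G.walkWeight r
          = 1 * G.walkWeight q + (2 * m + 1) * D + 1 * G.walkWeight r +
            (2 * m * (w + w') + 2 * (w + w')) := by ring
        _ ≤ (2 * m + 1) * G.walkWeight q + (2 * m + 1) * D + (2 * m + 1) * G.walkWeight r +
            (2 * m * (W + W') + 2 * (W + W)) := by
          gcongr
          · exact le_add_self
          · exact le_add_self
        _ = _ := by ring

theorem isEmulator (hA : AuxWeights G H k S piv) (hle : ∀ u v, G.dist u v ≤ H.dist u v)
    (hS : S k = ∅) (hS0 : S 0 = Set.univ) (hk : 2 ≤ k) :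
    G.IsEmulator H ((2 * (k / 2) - 1 : ℕ) : ℝ≥0) (fun _ _ p =>
      ((2 * ((k + 1) / 2) : ℕ) : ℝ≥0) * G.heaviest 1 p +
        ((2 * ((k + 1) / 2 - 2) : ℕ) : ℝ≥0) * G.heaviest 2 p) := by
  refine fun u v => ⟨hle u v, fun p hp => ?_⟩
  have := hA.dist_le_of_walk hle hS hS0 hk p
  rwa [ENNReal.coe_add, ENNReal.coe_mul, hp] at this

end AuxWeights
end

/-! ### Sampling probabilities and expected bunch sizes -/

open TimeM
noncomputable section

section Expectation

variable {k n : ℕ}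

theorem sampleProb_pos (hn : 1 ≤ n) : 0 < sampleProb k n :=
  Real.rpow_pos_of_pos (by exact_mod_cast hn) _

theorem sampleProb_le_one (hn : 1 ≤ n) : sampleProb k n ≤ 1 :=
  Real.rpow_le_one_of_one_le_of_nonpos (by exact_mod_cast hn) (by simp)

theorem coinProb_nonneg (hn : 1 ≤ n) (ω : Coins k n) : 0 ≤ coinProb ω := by
  refine Finset.prod_nonneg fun j _ => Finset.prod_nonneg fun v _ => ?_
  split_ifs
  · exact (sampleProb_pos hn).le
  · exact sub_nonneg.2 (sampleProb_le_one hn)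

theorem expect_mono (hn : 1 ≤ n) {X Y : Coins k n → ℝ} (h : ∀ ω, X ω ≤ Y ω) :
    expect X ≤ expect Y :=
  Finset.sum_le_sum fun ω _ => mul_le_mul_of_nonneg_left (h ω) (coinProb_nonneg hn ω)

theorem expect_add (X Y : Coins k n → ℝ) :
    expect (fun ω => X ω + Y ω) = expect X + expect Y := by
  simp [expect, mul_add, Finset.sum_add_distrib]

theorem expect_const_mul (a : ℝ) (X : Coins k n → ℝ) :
    expect (fun ω => a * X ω) = a * expect X := by
  simp only [expect, Finset.mul_sum]
  exact Finset.sum_congr rfl fun ω _ => by ring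

theorem expect_sum {ι : Type} (s : Finset ι) (X : ι → Coins k n → ℝ) :
    expect (fun ω => ∑ i ∈ s, X i ω) = ∑ i ∈ s, expect (X i) := by
  simp only [expect, Finset.mul_sum]
  exact Finset.sum_comm

/-- The coins of different vertices are independent. -/
theorem expect_prod (g : Fin n → (Fin (k - 1) → Bool) → ℝ) :
    expect (fun ω : Coins k n => ∏ v, g v fun j => ω j v) =
      ∏ v, ∑ c : Fin (k - 1) → Bool,
        (∏ j, if c j then sampleProb k n else 1 - sampleProb k n) * g v c := by
  rw [Finset.prod_univ_sum, Fintype.piFinset_univ, expect,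
    ← (Equiv.piComm fun (_ : Fin (k - 1)) (_ : Fin n) => Bool).sum_comp]
  refine Finset.sum_congr rfl fun ω _ => ?_
  rw [coinProb, Finset.prod_comm, ← Finset.prod_mul_distrib]
  rfl

/-- The event that a vertex with coins `c` belongs to `S_i`. -/
def InLevel (k i : ℕ) (c : Fin (k - 1) → Bool) : Prop :=
  i < k ∧ ∀ j : Fin (k - 1), (j : ℕ) < i → c j = true

/-- The probability that a vertex belongs to `S_i`. -/
def levelProb (k n i : ℕ) : ℝ := if i < k then sampleProb k n ^ i else 0

theorem levelProb_nonneg (hn : 1 ≤ n) (i : ℕ) : 0 ≤ levelProb k n i := by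
  unfold levelProb
  split_ifs
  exacts [(pow_pos (sampleProb_pos hn) i).le, le_rfl]

theorem levelProb_le_one (hn : 1 ≤ n) (i : ℕ) : levelProb k n i ≤ 1 := by
  unfold levelProb
  split_ifs
  exacts [pow_le_one₀ (sampleProb_pos hn).le (sampleProb_le_one hn), zero_le_one]

theorem sum_coins (f : Fin (k - 1) → Bool → ℝ) :
    ∑ c : Fin (k - 1) → Bool, ∏ j, f j (c j) = ∏ j, (f j true + f j false) := by
  have := Finset.prod_univ_sum (fun _ : Fin (k - 1) => (Finset.univ : Finset Bool)) f
  rw [Fintype.piFinset_univ] at this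
  rw [← this]
  simp

theorem sum_coins_one :
    ∑ c : Fin (k - 1) → Bool, (∏ j, if c j then sampleProb k n else 1 - sampleProb k n) = 1 := by
  rw [sum_coins fun _ b => if b then sampleProb k n else 1 - sampleProb k n]
  simp

-- For `i < k` the indicator of membership in level `i` is a product over the coins, of which
-- exactly `i` matter; each of these contributes a factor `sampleProb k n`, and the others sum to
-- `1`.
open scoped Classical in
theorem sum_coins_inLevel (i : ℕ) :
    ∑ c : Fin (k - 1) → Bool, (∏ j, if c j then sampleProb k n else 1 - sampleProb k n) *
      (if InLevel k i c then 1 else 0) = levelProb k n i := by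
  unfold levelProb
  split_ifs with hi
  · have h : ∀ c : Fin (k - 1) → Bool,
        (∏ j, if c j then sampleProb k n else 1 - sampleProb k n) *
          (if InLevel k i c then 1 else 0) =
        ∏ j, (if c j then sampleProb k n else 1 - sampleProb k n) *
          (if (j : ℕ) < i then (if c j then 1 else 0) else 1) := by
      intro c
      rw [Finset.prod_mul_distrib]
      congr 1
      by_cases hc : InLevel k i c
      · rw [if_pos hc, Finset.prod_eq_one]
        intro j _
        split_ifs with h1 h2
        exacts [rfl, absurd (hc.2 j h1) h2, rfl]
      · rw [if_neg hc]
        simp only [InLevel, hi, true_and, not_forall] at hc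
        obtain ⟨j, h1, h2⟩ := hc
        exact (Finset.prod_eq_zero (Finset.mem_univ j) (by simp [h1, h2])).symm
    simp only [h]
    rw [sum_coins fun j b => (if b then sampleProb k n else 1 - sampleProb k n) *
          (if (j : ℕ) < i then (if b then 1 else 0) else 1)]
    have h2 : ∀ j : Fin (k - 1), ((if true then sampleProb k n else 1 - sampleProb k n) *
          (if (j : ℕ) < i then (if true then (1 : ℝ) else 0) else 1) +
        (if (false : Bool) = true then sampleProb k n else 1 - sampleProb k n) *
          (if (j : ℕ) < i then (if (false : Bool) = true then (1 : ℝ) else 0) else 1)) =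
        if (j : ℕ) < i then sampleProb k n else 1 := fun j => by
      by_cases hj : (j : ℕ) < i <;> simp [hj]
    rw [Finset.prod_congr rfl fun j _ => h2 j,
      Fin.prod_univ_eq_prod_range (fun j => if j < i then sampleProb k n else 1) (k - 1),
      Finset.prod_ite, Finset.prod_const, Finset.prod_const_one, mul_one]
    congr 1
    rw [show (Finset.range (k - 1)).filter (· < i) = Finset.range i by ext; simp; omega,
      Finset.card_range]
  · simp [InLevel, hi]

open scoped Classical in
theorem sum_coins_not_inLevel (i : ℕ) :
    ∑ c : Fin (k - 1) → Bool, (∏ j, if c j then sampleProb k n else 1 - sampleProb k n) *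
      (if InLevel k i c then 0 else 1) = 1 - levelProb k n i := by
  refine Eq.trans ?_ (congrArg₂ (· - ·) (sum_coins_one (k := k) (n := n)) (sum_coins_inLevel i))
  rw [← Finset.sum_sub_distrib]
  refine Finset.sum_congr rfl fun c _ => ?_
  split_ifs <;> ring

theorem mem_hier {ω : Coins k n} {i : ℕ} {v : Fin n} :
    v ∈ hier ω i ↔ InLevel k i fun j => ω j v := Iff.rfl

open scoped Classical in
theorem expect_mem_hier (t : Fin n) (a : ℕ) :
    expect (fun ω : Coins k n => if t ∈ hier ω a then (1 : ℝ) else 0) = levelProb k n a := by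
  have h : ∀ ω : Coins k n, (if t ∈ hier ω a then (1 : ℝ) else 0) =
      ∏ v, (fun v c => if v = t then (if InLevel k a c then (1 : ℝ) else 0) else 1) v
        fun j => ω j v := fun ω => by
    simp [mem_hier]
  rw [funext h]
  refine (expect_prod fun v c =>
    if v = t then (if InLevel k a c then (1 : ℝ) else 0) else 1).trans ?_
  rw [Finset.prod_eq_single t]
  · simpa using sum_coins_inLevel a
  · intro v _ hv
    simpa [hv] using sum_coins_one
  · simp

-- The indicator is at most a product with one factor per vertex, so independence applies. At `t`
-- and `s` only membership is retained and the condition of avoiding `S_c` is dropped; this costs at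
-- most two members of `A`, hence the exponent `A.card - 2`.
open scoped Classical in
theorem expect_pair_le (hn : 1 ≤ n) {t s : Fin n} (hst : s ≠ t) (a b c : ℕ) (A : Finset (Fin n)) :
    expect (fun ω : Coins k n =>
      if t ∈ hier ω a ∧ s ∈ hier ω b ∧ ∀ v ∈ A, v ∉ hier ω c then (1 : ℝ) else 0) ≤
    levelProb k n a * levelProb k n b * (1 - levelProb k n c) ^ (A.card - 2) := by
  set g : Fin n → (Fin (k - 1) → Bool) → ℝ := fun v x =>
    if v = t then (if InLevel k a x then 1 else 0) else
    if v = s then (if InLevel k b x then 1 else 0) else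
    if v ∈ A then (if InLevel k c x then 0 else 1) else 1 with hg
  have h : ∀ ω : Coins k n,
      (if t ∈ hier ω a ∧ s ∈ hier ω b ∧ ∀ v ∈ A, v ∉ hier ω c then (1 : ℝ) else 0) ≤
      ∏ v, g v fun j => ω j v := fun ω => by
    split_ifs with hω
    · rw [Finset.prod_eq_one]
      intro v _
      simp only [hg, ← mem_hier]
      by_cases h1 : v = t
      · subst h1
        simp [hω.1]
      by_cases h2 : v = s
      · subst h2
        simp [h1, hω.2.1]
      by_cases h3 : v ∈ A
      · simp [h1, h2, h3, hω.2.2 v h3]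
      · simp [h1, h2, h3]
    · refine Finset.prod_nonneg fun v _ => ?_
      simp only [hg]
      split_ifs <;> norm_num
  refine (expect_mono hn h).trans ?_
  rw [expect_prod, ← Finset.mul_prod_erase _ _ (Finset.mem_univ t),
    ← Finset.mul_prod_erase _ _ (Finset.mem_erase.2 ⟨hst, Finset.mem_univ s⟩), ← mul_assoc]
  have e1 : ∑ x, (∏ j, if x j then sampleProb k n else 1 - sampleProb k n) * g t x =
      levelProb k n a := by simpa [hg] using sum_coins_inLevel a
  have e2 : ∑ x, (∏ j, if x j then sampleProb k n else 1 - sampleProb k n) * g s x =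
      levelProb k n b := by simpa [hg, hst] using sum_coins_inLevel b
  rw [e1, e2]
  refine mul_le_mul_of_nonneg_left ?_ (mul_nonneg (levelProb_nonneg hn _) (levelProb_nonneg hn _))
  have e3 : ∀ v ∈ (Finset.univ.erase t).erase s,
      ∑ x, (∏ j, if x j then sampleProb k n else 1 - sampleProb k n) * g v x =
      if v ∈ A then 1 - levelProb k n c else 1 := by
    intro v hv
    simp only [Finset.mem_erase, Finset.mem_univ, and_true] at hv
    simp only [hg, hv.1, hv.2, if_false]
    split_ifs
    · exact sum_coins_not_inLevel c
    · simpa using sum_coins_one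
  rw [Finset.prod_congr rfl e3, Finset.prod_ite, Finset.prod_const, Finset.prod_const_one, mul_one]
  refine pow_le_pow_of_le_one (sub_nonneg.2 (levelProb_le_one hn c))
    (sub_le_self _ (levelProb_nonneg hn c)) ?_
  have : ((Finset.univ.erase t).erase s).filter (· ∈ A) = (A.erase t).erase s := by
    ext v
    simp
    tauto
  rw [this]
  have h1 := Finset.pred_card_le_card_erase (s := A) (a := t)
  have h2 := Finset.pred_card_le_card_erase (s := A.erase t) (a := s)
  omega

/-- Add the elements by increasing key: the newest one has everything at or below it, and the ranks
of the earlier ones can only grow, which for `r ≤ 1` lowers their terms. Ties only help. -/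
theorem sum_pow_rank_le {ι : Type} [DecidableEq ι] (key : ι → ℝ≥0∞) {r : ℝ} (h0 : 0 ≤ r)
    (h1 : r ≤ 1) (N : Finset ι) :
    ∑ s ∈ N, r ^ ((N.filter fun v => key v ≤ key s).card - 2) ≤
      ∑ i ∈ Finset.range N.card, r ^ (i - 1) := by
  refine Finset.induction_on_max_value key N (by simp) fun a N ha hmax ih => ?_
  ·
    rw [Finset.sum_insert ha, Finset.card_insert_of_notMem ha, Finset.sum_range_succ, add_comm]
    refine add_le_add (le_trans (Finset.sum_le_sum fun s hs => ?_) ih) (le_of_eq ?_)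
    · refine pow_le_pow_of_le_one h0 h1 (Nat.sub_le_sub_right (Finset.card_le_card ?_) 2)
      exact Finset.filter_subset_filter _ (Finset.subset_insert _ _)
    · rw [Finset.filter_true_of_mem, Finset.card_insert_of_notMem ha]
      · congr 1
      · intro v hv
        rcases Finset.mem_insert.1 hv with rfl | hv
        exacts [le_rfl, hmax v hv]

/-- The exponents are `0, 0, 1, 2, …`, so this is a geometric sum, at most `1 / q`, plus one extra
term `1 ≤ 1 / q`. -/
theorem sum_range_pow_pred_le {r q : ℝ} (hq : 0 < q) (h0 : 0 ≤ r) (h : r = 1 - q) (m : ℕ) :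
    ∑ i ∈ Finset.range m, r ^ (i - 1) ≤ 2 / q := by
  have hq1 : q ≤ 1 := by linarith
  cases m with
  | zero => simpa using (div_pos two_pos hq).le
  | succ m =>
    rw [Finset.sum_range_succ']
    simp only [Nat.add_sub_cancel, zero_le, Nat.sub_eq_zero_of_le, pow_zero]
    have h1 : ∑ i ∈ Finset.range m, r ^ i ≤ 1 / q := by
      rw [le_div_iff₀ hq, show q = 1 - r by linarith]
      have := geom_sum_mul r m
      have h2 : (0 : ℝ) ≤ r ^ m := pow_nonneg h0 m
      nlinarith
    have h2 : 1 ≤ 1 / q := by rwa [le_div_iff₀ hq, one_mul]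
    calc _ ≤ 1 / q + 1 / q := add_le_add h1 h2
      _ = 2 / q := by ring

theorem sampleProb_pow_self (hk : 2 ≤ k) (hn : 1 ≤ n) : sampleProb k n ^ k = 1 / n := by
  rw [sampleProb, ← Real.rpow_natCast, ← Real.rpow_mul (by positivity)]
  have : (k : ℝ) ≠ 0 := by positivity
  rw [neg_mul, one_div_mul_cancel this, Real.rpow_neg_one, one_div]

open scoped Classical in
/-- The expected number of members of `S_b` in `N` that are not farther than the nearest member
of `S_c`, counted if the vertex `t` belongs to `S_a`. -/
theorem expect_bunch_le (hk : 2 ≤ k) (hn : 1 ≤ n) (t : Fin n) {a b c : ℕ} (ha : a < k)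
    (hb : b < k) (hc : c ≤ k) (habc : min a b ≤ c) (N : Finset (Fin n)) (key : Fin n → ℝ≥0∞) :
    expect (fun ω : Coins k n => ∑ s ∈ N,
      if t ∈ hier ω a ∧ s ∈ hier ω b ∧ ∀ v ∈ N, key v ≤ key s → v ∉ hier ω c
        then (1 : ℝ) else 0) ≤ 3 * sampleProb k n ^ (a + b) / sampleProb k n ^ c := by
  have hp := sampleProb_pos (k := k) hn
  have hp1 := sampleProb_le_one (k := k) hn
  set p := sampleProb k n with hpdef
  have hqa : levelProb k n a = p ^ a := by simp [levelProb, ha, hpdef]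
  have hqb : levelProb k n b = p ^ b := by simp [levelProb, hb, hpdef]
  set r := 1 - levelProb k n c with hr
  have hr0 : 0 ≤ r := sub_nonneg.2 (levelProb_le_one hn c)
  have hr1 : r ≤ 1 := sub_le_self _ (levelProb_nonneg hn c)
  have hsum : ∑ s ∈ N, r ^ ((N.filter fun v => key v ≤ key s).card - 2) ≤ 2 / p ^ c := by
    refine (sum_pow_rank_le key hr0 hr1 N).trans ?_
    -- At `c = k` there is no geometric decay because `S_k` is empty, but then the trivial bound `n`
    -- equals `1 / p ^ k`.
    rcases hc.lt_or_eq with hc | rfl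
    · exact sum_range_pow_pred_le (pow_pos hp c) hr0 (by simp [hr, levelProb, hc, hpdef]) _
    · rw [sampleProb_pow_self hk hn]
      refine (Finset.sum_le_card_nsmul _ _ 1 fun i _ => pow_le_one₀ hr0 hr1).trans ?_
      have : (N.card : ℝ) ≤ n := by exact_mod_cast (Finset.card_le_univ N).trans (by simp)
      simp
      linarith
  have hterm : ∀ s ∈ N, expect (fun ω : Coins k n =>
      if t ∈ hier ω a ∧ s ∈ hier ω b ∧ ∀ v ∈ N, key v ≤ key s → v ∉ hier ω c
        then (1 : ℝ) else 0) ≤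
      p ^ (a + b) * r ^ ((N.filter fun v => key v ≤ key s).card - 2) +
        if s = t then p ^ max a b else 0 := by
    intro s _
    -- The diagonal term occurs at most once and has probability at most `p ^ max a b`. As `min a b
    -- ≤ c`, this is absorbed by one further copy of `p ^ (a + b) / p ^ c`.
    by_cases hst : s = t
    · subst hst
      rw [if_pos rfl]
      have h1 : expect (fun ω : Coins k n =>
          if s ∈ hier ω a ∧ s ∈ hier ω b ∧ ∀ v ∈ N, key v ≤ key s → v ∉ hier ω c
            then (1 : ℝ) else 0) ≤ levelProb k n (max a b) := by
        rw [← expect_mem_hier s]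
        refine expect_mono hn fun ω => ?_
        split_ifs with h1 h2
        · exact le_rfl
        · exact absurd (by rcases max_choice a b with h | h <;> rw [h] <;> tauto) h2
        · exact zero_le_one
        · exact le_rfl
      rw [levelProb, if_pos (max_lt ha hb)] at h1
      refine h1.trans (le_add_of_nonneg_left (by positivity))
    · rw [if_neg hst, add_zero, pow_add, ← hqa, ← hqb]
      refine le_trans (le_of_eq ?_) (expect_pair_le hn hst a b c (N.filter fun v => key v ≤ key s))
      simp only [Finset.mem_filter, and_imp]
  rw [expect_sum]
  refine (Finset.sum_le_sum hterm).trans ?_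
  rw [Finset.sum_add_distrib, ← Finset.mul_sum]
  have h2 : (∑ s ∈ N, if s = t then p ^ max a b else 0) ≤ p ^ (a + b) / p ^ c := by
    refine le_trans (b := p ^ max a b) ?_ ?_
    · rw [Finset.sum_ite_eq']
      split_ifs
      · exact le_rfl
      · positivity
    · rw [le_div_iff₀ (by positivity), ← max_add_min a b, pow_add]
      exact mul_le_mul_of_nonneg_left (pow_le_pow_of_le_one hp.le hp1 habc) (by positivity)
  calc _ ≤ p ^ (a + b) * (2 / p ^ c) + p ^ (a + b) / p ^ c :=
        add_le_add (mul_le_mul_of_nonneg_left hsum (by positivity)) h2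
    _ = 3 * p ^ (a + b) / p ^ c := by ring

end Expectation
end

/-! ### The computed hierarchy, pivots and edge sets -/

open TimeM
noncomputable section

section Setup

variable {k n : ℕ}

theorem hier_zero (ω : Coins k n) (hk : 0 < k) : hier ω 0 = Set.univ := by
  ext v
  simp [hier, hk]

theorem hier_self (ω : Coins k n) : hier ω k = ∅ := by
  ext v
  simp [hier]

theorem hier_anti (ω : Coins k n) : Antitone (hier ω) :=
  fun _ _ hij _ hv => ⟨hij.trans_lt hv.1, fun l hl => hv.2 l (hl.trans_le hij)⟩

theorem le_length_takeWhile {α : Type} (p : α → Bool) :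
    ∀ (l : List α) (i : ℕ), i ≤ (l.takeWhile p).length ↔
      i ≤ l.length ∧ ∀ (j : ℕ) (h : j < l.length), j < i → p l[j] = true
  | [], i => by simp
  | a :: l, 0 => by simp
  | a :: l, i + 1 => by
    rw [List.takeWhile_cons]
    by_cases ha : p a = true
    · simp only [ha, if_true, List.length_cons, Nat.add_le_add_iff_right,
        le_length_takeWhile p l i]
      refine and_congr_right fun _ => ⟨fun h j hj hji => ?_, fun h j hj hji => ?_⟩
      · cases j with
        | zero => simpa using ha
        | succ j => simpa using h j (by omega) (by omega)
      · have := h (j + 1) (by simpa using hj) (by omega)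
        rwa [List.getElem_cons_succ] at this
    · simp only [ha]
      simp only [List.length_cons, Bool.false_eq_true, if_false, List.length_nil, Nat.le_zero,
        Nat.add_eq_zero_iff, one_ne_zero, and_false, false_iff, not_and, not_forall]
      exact fun _ => ⟨0, by simp, by simp, by simpa using ha⟩

/-- One pass of the loop that determines the level of a vertex. -/
def tossCoin (ω : Coins k n) (v : Fin n) (s : Bool × ℕ) (j : Fin (k - 1)) :
    TimeM (Bool × ℕ) := do
  let c ← rd (ω j) v
  if s.1 && c then pure (true, s.2 + 1) else pure (false, s.2)

theorem val_loop_tossCoin (ω : Coins k n) (v : Fin n) :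
    ∀ (l : List (Fin (k - 1))) (b : Bool) (m : ℕ), (loop l (b, m) (tossCoin ω v)).val.2 =
      m + if b then (l.takeWhile fun j => ω j v).length else 0
  | [], b, m => by simp
  | j :: l, b, m => by
    rw [val_loop_cons]
    by_cases h : (b && ω j v) = true
    · have : (tossCoin ω v (b, m) j).val = (true, m + 1) := by
        simp only [Bool.and_eq_true] at h
        simp [tossCoin, h]
      rw [this, val_loop_tossCoin ω v l]
      simp only [Bool.and_eq_true] at h
      simp [h.1, h.2]
      omega
    · have : (tossCoin ω v (b, m) j).val = (false, m) := by
        simp only [Bool.and_eq_true] at h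
        simp [tossCoin, h]
      rw [this, val_loop_tossCoin ω v l]
      cases b <;> simp at h ⊢
      simp [h]

theorem le_findLevel (ω : Coins k n) (v : Fin n) {i : ℕ} (hi : i < k) :
    i ≤ (findLevel ω v).val ↔ v ∈ hier ω i := by
  have h : (findLevel ω v).val = (loop (List.finRange (k - 1)) (true, 0) (tossCoin ω v)).val.2 :=
    rfl
  rw [h, val_loop_tossCoin, if_pos rfl, zero_add, le_length_takeWhile]
  simp only [List.length_finRange, List.getElem_finRange, hier, Set.mem_ofPred_eq, hi, true_and]
  constructor
  · rintro ⟨_, h⟩ j hj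
    exact h j j.2 hj
  · exact fun h => ⟨by omega, fun j hj hji => h ⟨j, hj⟩ hji⟩

theorem time_findLevel_le (ω : Coins k n) (v : Fin n) : (findLevel ω v).time ≤ 2 * k + 1 := by
  have h : (findLevel ω v).time = (loop (List.finRange (k - 1)) (true, 0) (tossCoin ω v)).time :=
    rfl
  rw [h]
  refine (time_loop_le_mul 1 _ _ fun s j _ => ?_).trans ?_
  · simp only [tossCoin, time_bind, time_rd]
    split_ifs <;> simp
  · rw [List.length_finRange]
    omega

theorem members_val (lev : Fin n → ℕ) (i : ℕ) :
    (members lev i).val = ((List.finRange n).filter fun v => i ≤ lev v).reverse := by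
  unfold members
  rw [loop_filter (p := fun v => i ≤ lev v) (g := id)]
  · simp
  · intro L v
    by_cases h : i ≤ lev v <;> simp [h]

theorem time_members_le (lev : Fin n → ℕ) (i : ℕ) : (members lev i).time ≤ 3 * n + 1 := by
  refine (time_loop_le_mul 2 _ _ fun L v _ => ?_).trans ?_
  · simp only [time_bind, time_rd, time_tick]
    split_ifs <;> simp
  · rw [List.length_finRange]
    omega

/-- The lists that describe the edges `E_S`. -/
theorem restrictEdges_val (adj : AdjArray n) (t : SPResult n) (u : Fin n) :
    (restrictEdges adj t).val u = ((adj u).filter fun e =>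
      (e.2 : ℝ≥0∞) < t.dist u ∨ (e.2 : ℝ≥0∞) < t.dist e.1).reverse := by
  unfold restrictEdges
  simp only [val_bind, val_alloc]
  refine loop_update_of_mem id Function.injective_id
    (fun u => ((adj u).filter fun e =>
      (e.2 : ℝ≥0∞) < t.dist u ∨ (e.2 : ℝ≥0∞) < t.dist e.1).reverse) ?_ u _ _ (List.mem_finRange u)
  intro A u
  simp only [val_bind, val_rd, val_wr, id]
  rw [loop_filter (p := fun e : Fin n × ℝ≥0 =>
    (e.2 : ℝ≥0∞) < t.dist u ∨ (e.2 : ℝ≥0∞) < t.dist e.1) (g := id)]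
  · simp
  · intro L e
    by_cases h : (e.2 : ℝ≥0∞) < t.dist u ∨ (e.2 : ℝ≥0∞) < t.dist e.1 <;> simp [h]

theorem restrictEdges_isAdjList {G : WGraph (Fin n)} {adj : AdjArray n} (hadj : G.IsAdjList adj)
    {t : SPResult n} {S : Set (Fin n)} (ht : ∀ v, t.dist v = G.distSet v S) :
    (G.restrict S).IsAdjList (restrictEdges adj t).val := by
  intro u
  rw [restrictEdges_val]
  refine ⟨List.nodup_reverse.2 ((hadj u).1.filter _), fun v x => ?_⟩
  rw [List.mem_reverse, List.mem_filter, (hadj u).2, ht, ht]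
  simp only [decide_eq_true_eq]
  constructor
  · rintro ⟨⟨h1, rfl⟩, h2⟩
    exact ⟨⟨h1, h2⟩, rfl⟩
  · rintro ⟨⟨h1, h2⟩, rfl⟩
    exact ⟨⟨h1, rfl⟩, h2⟩

theorem length_adj_le {G : WGraph (Fin n)} {adj : AdjArray n} (hadj : G.IsAdjList adj)
    (u : Fin n) : (adj u).length ≤ n := by
  have hnd : ((adj u).map Prod.fst).Nodup := by
    refine List.Nodup.map_on ?_ (hadj u).1
    rintro ⟨v, x⟩ h ⟨v', x'⟩ h' (rfl : v = v')
    rw [(((hadj u).2 _ _).1 h).2, (((hadj u).2 _ _).1 h').2]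
  simpa using hnd.length_le_card

theorem totalDegree_le {G : WGraph (Fin n)} {adj : AdjArray n} (hadj : G.IsAdjList adj) :
    totalDegree adj ≤ n * n := by
  refine (Finset.sum_le_card_nsmul _ _ n fun u _ => length_adj_le hadj u).trans ?_
  simp

theorem time_restrictEdges_le {G : WGraph (Fin n)} {adj : AdjArray n} (hadj : G.IsAdjList adj)
    (t : SPResult n) : (restrictEdges adj t).time ≤ n + (n * (3 * n + 5) + 1) := by
  unfold restrictEdges
  simp only [time_bind, time_alloc]
  refine Nat.add_le_add_left ((time_loop_le_mul (3 * n + 4) _ _ fun E u _ => ?_).trans ?_) n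
  · have hle : (adj u).length * 3 + 1 ≤ 3 * n + 1 := by
      have := length_adj_le hadj u
      omega
    simp only [time_bind, time_rd, val_rd, time_wr]
    refine (Nat.add_le_add_left (Nat.add_le_add_left (Nat.add_le_add_right
      ((time_loop_le_mul 2 _ _ fun L e _ => ?_).trans hle) 1) 1) 1).trans (by omega)
    by_cases h : (e.2 : ℝ≥0∞) < t.dist u ∨ (e.2 : ℝ≥0∞) < t.dist e.1 <;> simp [h]
  · rw [List.length_finRange]

/-- The computation of the levels of the vertices. -/
def levels (ω : Coins k n) : TimeM (Fin n → ℕ) := do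
  let lev ← alloc n fun _ => 0
  loop (List.finRange n) lev fun lev v => do
    let l ← findLevel ω v
    wr lev v l

/-- The computation of the lists of the sets `S_i`. -/
def levelSets (k : ℕ) (lev : Fin n → ℕ) : TimeM (ℕ → List (Fin n)) := do
  let S ← alloc (k + 1) fun _ => []
  loop (List.range k) S fun S i => do
    let Si ← members lev i
    wr S i Si

/-- The computation of the pivots. -/
def pivots (k : ℕ) (adj : AdjArray n) (S : ℕ → List (Fin n)) : TimeM (ℕ → SPResult n) := do
  let t ← noSource n
  let P ← alloc (k + 1) fun _ => t
  loop (List.range (k - 1)) P fun P i => do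
    let Si ← rd S (i + 1)
    let t ← dijkstra adj Si
    wr P (i + 1) t

/-- The computation of the edge sets `E_i`. -/
def edgeSets (k : ℕ) (adj : AdjArray n) (P : ℕ → SPResult n) : TimeM (ℕ → AdjArray n) := do
  let E ← alloc (k + 1) fun _ => adj
  loop (List.range k) E fun E i => do
    let t ← rd P (i + 1)
    let Ei ← restrictEdges adj t
    wr E (i + 1) Ei

theorem emulatorAlg_eq (adj : AdjArray n) (ω : Coins k n) :
    emulatorAlg k n adj ω = (do
      let lev ← levels ω
      let S ← levelSets k lev
      let P ← pivots k adj S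
      let E ← edgeSets k adj P
      let d ← estimate k adj S P E
      collect k S P E d) := by
  simp only [emulatorAlg, levels, levelSets, pivots, edgeSets, bind_bind]

/-- What the first phase of the algorithm computes for a hierarchy `T`. -/
structure IsSetup (k : ℕ) (G : WGraph (Fin n)) (T : ℕ → Set (Fin n)) (S : ℕ → List (Fin n))
    (P : ℕ → SPResult n) (E : ℕ → AdjArray n) : Prop where
  mem_iff : ∀ i ≤ k, ∀ v, v ∈ S i ↔ v ∈ T i
  nodup : ∀ i ≤ k, (S i).Nodup
  dist_eq : ∀ i, 1 ≤ i → i ≤ k → ∀ v, (P i).dist v = G.distSet v (T i)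
  root : ∀ i, 1 ≤ i → i < k → ∀ v, G.distSet v (T i) ≠ ⊤ →
    (P i).root v ∈ T i ∧ G.dist v ((P i).root v) = G.distSet v (T i)
  isAdjList : ∀ i, 1 ≤ i → i ≤ k → (G.restrict (T i)).IsAdjList (E i)

theorem levelSets_spec (ω : Coins k n) :
    (∀ i ≤ k, ∀ v, v ∈ (levelSets k (levels ω).val).val i ↔ v ∈ hier ω i) ∧
      ∀ i ≤ k, ((levelSets k (levels ω).val).val i).Nodup := by
  have hlev : ∀ v, (levels ω).val v = (findLevel ω v).val := fun v =>
    loop_update_of_mem id Function.injective_id (fun v => (findLevel ω v).val) (fun _ _ => rfl) v _ _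
      (List.mem_finRange v)
  have hS : ∀ i < k, (levelSets k (levels ω).val).val i = (members (levels ω).val i).val :=
    fun i hi => loop_update_of_mem id Function.injective_id
      (fun i => (members (levels ω).val i).val) (fun _ _ => rfl) i _ _ (List.mem_range.2 hi)
  have hSk : (levelSets k (levels ω).val).val k = [] :=
    loop_update_of_notMem id (fun i => (members (levels ω).val i).val) (fun _ _ => rfl) k _ _
      fun i hi => (List.mem_range.1 hi).ne
  refine ⟨fun i hi v => ?_, fun i hi => ?_⟩
  · rcases hi.lt_or_eq with hi | rfl
    · rw [hS i hi, members_val, List.mem_reverse, List.mem_filter, ← le_findLevel ω v hi, ← hlev]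
      simp
    · simp [hSk, hier_self]
  · rcases hi.lt_or_eq with hi | rfl
    · rw [hS i hi, members_val]
      exact List.nodup_reverse.2 ((List.nodup_finRange n).filter _)
    · simp [hSk]

theorem isSetup {G : WGraph (Fin n)} {adj : AdjArray n} (hadj : G.IsAdjList adj)
    (ω : Coins k n) :
    let S := (levelSets k (levels ω).val).val
    let P := (pivots k adj S).val
    IsSetup k G (hier ω) S P (edgeSets k adj P).val := by
  intro S P
  obtain ⟨hmem, hnd⟩ := levelSets_spec ω
  have hset : ∀ i ≤ k, {s | s ∈ S i} = hier ω i := fun i hi => Set.ext fun v => hmem i hi v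
  have hinj : Function.Injective fun i : ℕ => i + 1 := fun _ _ => Nat.succ.inj
  have hP : ∀ i, i + 1 < k → P (i + 1) = (dijkstra adj (S (i + 1))).val := fun i hi =>
    loop_update_of_mem (fun i => i + 1) hinj (fun i => (dijkstra adj (S (i + 1))).val)
      (fun _ _ => rfl) i _ _ (List.mem_range.2 (by omega))
  -- No pass writes cell `k`, so it keeps the distances `⊤`, which are the correct ones to `S_k =
  -- ∅`. Comparison with them turns `E_k` into the whole edge set.
  have hPk : P k = (noSource n).val :=
    loop_update_of_notMem (fun i => i + 1) (fun i => (dijkstra adj (S (i + 1))).val)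
      (fun _ _ => rfl) k _ _ fun i hi => by
        have := List.mem_range.1 hi
        omega
  have hE : ∀ i, i < k → (edgeSets k adj P).val (i + 1) = (restrictEdges adj (P (i + 1))).val :=
    fun i hi => loop_update_of_mem (fun i => i + 1) hinj
      (fun i => (restrictEdges adj (P (i + 1))).val) (fun _ _ => rfl) i _ _ (List.mem_range.2 hi)
  have hdist : ∀ i, 1 ≤ i → i ≤ k → ∀ v, (P i).dist v = G.distSet v (hier ω i) := by
    intro i h1 hi v
    rcases hi.lt_or_eq with hi | rfl
    · obtain ⟨i, rfl⟩ := Nat.exists_eq_add_of_le' h1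
      rw [hP i hi, (dijkstra_spec hadj _).1, hset _ hi.le]
    · rw [hPk, hier_self]
      simp [noSource]
  refine ⟨hmem, hnd, hdist, fun i h1 hi v hv => ?_, fun i h1 hi => ?_⟩
  · obtain ⟨i, rfl⟩ := Nat.exists_eq_add_of_le' h1
    have := (dijkstra_spec hadj (S (i + 1))).2.1 v
    rw [hset _ hi.le, ← hP i hi] at this
    obtain ⟨h2, h3⟩ := this hv
    exact ⟨(hmem _ hi.le _).1 h2, h3⟩
  · obtain ⟨i, rfl⟩ := Nat.exists_eq_add_of_le' h1
    rw [hE i hi]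
    exact restrictEdges_isAdjList hadj (hdist _ h1 hi)

end Setup
end

/-! ### Exactness of the estimates and the output graph -/

open TimeM
noncomputable section

variable {k n : ℕ}

/-- Symmetric estimates that are never below the distance. -/
def Sound (G : WGraph (Fin n)) (d : Estimates n) : Prop :=
  (∀ u v, d (u, v) = d (v, u)) ∧ ∀ u v, G.dist u v ≤ d (u, v)

/-- `F` keeps estimates sound, never increases them, and establishes the bounds `B`. -/
def Lowers (G : WGraph (Fin n)) (B : Fin n → Fin n → ℝ≥0∞ → Prop)
    (F : Estimates n → Estimates n) : Prop :=
  ∀ d, Sound G d → Sound G (F d) ∧ (∀ p, F d p ≤ d p) ∧ ∀ u v x, B u v x → F d (u, v) ≤ x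

theorem lowers_relax {G : WGraph (Fin n)} {u v : Fin n} {x : ℝ≥0∞} (hx : G.dist u v ≤ x) :
    Lowers G (fun a b y => a = u ∧ b = v ∧ y = x) fun d => (relax d u v x).val := by
  rintro d ⟨hs, hd⟩
  by_cases h : x < d (u, v)
  · have hval : ∀ a b, (relax d u v x).val (a, b) =
        if (a = u ∧ b = v) ∨ (a = v ∧ b = u) then x else d (a, b) := by
      intro a b
      simp only [relax, val_bind, val_rd, h, if_true, val_wr, Function.update_apply,
        Prod.mk.injEq]
      split_ifs <;> first | rfl | tauto
    refine ⟨⟨fun a b => ?_, fun a b => ?_⟩, fun ⟨a, b⟩ => ?_, fun a b y => ?_⟩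
    · simp only [hval, hs a b]
      split_ifs <;> first | rfl | tauto
    · simp only [hval]
      split_ifs with h'
      · rcases h' with ⟨rfl, rfl⟩ | ⟨rfl, rfl⟩
        exacts [hx, G.dist_comm a b ▸ hx]
      · exact hd a b
    · simp only [hval]
      split_ifs with h'
      · rcases h' with ⟨rfl, rfl⟩ | ⟨rfl, rfl⟩
        exacts [h.le, hs a b ▸ h.le]
      · exact le_rfl
    · rintro ⟨rfl, rfl, rfl⟩
      exact ((hval a b).trans (if_pos (.inl ⟨rfl, rfl⟩))).le
  · have hval : (relax d u v x).val = d := by simp [relax, h]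
    simp only [hval]
    refine ⟨⟨hs, hd⟩, fun _ => le_rfl, ?_⟩
    rintro a b y ⟨rfl, rfl, rfl⟩
    exact not_lt.1 h

theorem Lowers.comp {G : WGraph (Fin n)} {B B' : Fin n → Fin n → ℝ≥0∞ → Prop}
    {F F' : Estimates n → Estimates n} (h : Lowers G B F) (h' : Lowers G B' F') :
    Lowers G (fun u v x => B u v x ∨ B' u v x) fun d => F' (F d) := by
  intro d hd
  obtain ⟨h1, h2, h3⟩ := h d hd
  obtain ⟨i1, i2, i3⟩ := h' _ h1
  exact ⟨i1, fun p => (i2 p).trans (h2 p),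
    fun u v x hB => hB.elim (fun hB => (i2 _).trans (h3 u v x hB)) (i3 u v x)⟩

theorem lowers_loop {G : WGraph (Fin n)} {α : Type} {B : α → Fin n → Fin n → ℝ≥0∞ → Prop}
    {f : Estimates n → α → TimeM (Estimates n)} :
    ∀ (l : List α), (∀ a ∈ l, Lowers G (B a) fun d => (f d a).val) →
      Lowers G (fun u v x => ∃ a ∈ l, B a u v x) fun d => (loop l d f).val
  | [], _ => fun d hd => ⟨hd, fun _ => le_rfl, by simp⟩
  | a :: l, h => by
    have h1 := (h a (by simp)).comp (lowers_loop l fun b hb => h b (by simp [hb]))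
    intro d hd
    obtain ⟨i1, i2, i3⟩ := h1 d hd
    refine ⟨i1, i2, fun u v x hB => i3 u v x ?_⟩
    simpa using hB

/-- Estimates from the pivots. -/
def estimatePivots (k : ℕ) (P : ℕ → SPResult n) (d : Estimates n) : TimeM (Estimates n) :=
  loop (List.range (k - 1)) d fun d i => do
    let t ← rd P (i + 1)
    loop (List.finRange n) d fun d u => do
      let p ← rd t.root u
      let x ← rd t.dist u
      relax d u p x

/-- Estimates from the edges. -/
def estimateEdges (k : ℕ) (adj : AdjArray n) (P : ℕ → SPResult n) (d : Estimates n) :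
    TimeM (Estimates n) :=
  loop (List.finRange n) d fun d x => do
    let nbrs ← rd adj x
    loop nbrs d fun d e => do
      let d ← relax d x e.1 (e.2 : ℝ≥0∞)
      loop (List.range (k - 1)) d fun d i => do
        let ti ← rd P (i + 1)
        let p ← rd ti.root x
        let dx ← rd ti.dist x
        loop (List.range (k - 1)) d fun d j => do
          let tj ← rd P (j + 1)
          let q ← rd tj.root e.1
          let dy ← rd tj.dist e.1
          relax d p q (dx + (e.2 : ℝ≥0∞) + dy)

/-- Estimates from the shortest paths over the edge sets `E_{i+2}`. -/
def estimatePaths (k : ℕ) (S : ℕ → List (Fin n)) (E : ℕ → AdjArray n) (d : Estimates n) :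
    TimeM (Estimates n) :=
  loop (List.range k) d fun d i => do
    let Ei ← rd E (min (i + 2) k)
    let Si ← rd S i
    loop Si d fun d s => do
      let t ← dijkstra Ei [s]
      loop (List.finRange n) d fun d v => do
        let x ← rd t.dist v
        relax d s v x

theorem estimate_eq (k : ℕ) (adj : AdjArray n) (S : ℕ → List (Fin n)) (P : ℕ → SPResult n)
    (E : ℕ → AdjArray n) : estimate k adj S P E = (do
      let d ← alloc (n * n) fun p => if p.1 = p.2 then 0 else ⊤
      let d ← estimatePivots k P d
      let d ← estimateEdges k adj P d
      estimatePaths k S E d) := rfl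

namespace IsSetup

variable {G : WGraph (Fin n)} {T : ℕ → Set (Fin n)} {S : ℕ → List (Fin n)} {P : ℕ → SPResult n}
  {E : ℕ → AdjArray n} {adj : AdjArray n}

/-- If `T i` cannot be reached, the stored root is meaningless, but the stored distance is `⊤`. So
relaxing along pivots is always sound. -/
theorem dist_root_le (hI : IsSetup k G T S P E) {i : ℕ} (h1 : 1 ≤ i) (hi : i < k) (v : Fin n) :
    G.dist v ((P i).root v) ≤ (P i).dist v := by
  rw [hI.dist_eq i h1 hi.le]
  by_cases h : G.distSet v (T i) = ⊤
  · simp [h]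
  · exact (hI.root i h1 hi v h).2.le

theorem lowers_estimatePivots (hI : IsSetup k G T S P E) :
    Lowers G (fun u v x => ∃ i ∈ List.range (k - 1), ∃ w ∈ List.finRange n,
      u = w ∧ v = (P (i + 1)).root w ∧ x = (P (i + 1)).dist w)
      fun d => (estimatePivots k P d).val := by
  refine lowers_loop _ fun i hi => ?_
  have := List.mem_range.1 hi
  refine lowers_loop (n := n) _ fun u _ => ?_
  exact lowers_relax (hI.dist_root_le (by omega) (by omega) u)

theorem lowers_estimateEdges (hI : IsSetup k G T S P E) (hadj : G.IsAdjList adj) :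
    Lowers G (fun u v x => ∃ y ∈ List.finRange n, ∃ e ∈ adj y,
      (u = y ∧ v = e.1 ∧ x = (e.2 : ℝ≥0∞)) ∨ ∃ i ∈ List.range (k - 1), ∃ j ∈ List.range (k - 1),
        u = (P (i + 1)).root y ∧ v = (P (j + 1)).root e.1 ∧
        x = (P (i + 1)).dist y + (e.2 : ℝ≥0∞) + (P (j + 1)).dist e.1)
      fun d => (estimateEdges k adj P d).val := by
  refine lowers_loop _ fun x _ => ?_
  refine lowers_loop (n := n) _ fun e he => ?_
  obtain ⟨hxe, hw⟩ := ((hadj x).2 e.1 e.2).1 he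
  have hle : G.dist x e.1 ≤ (e.2 : ℝ≥0∞) := hw ▸ G.dist_le_weight hxe
  refine (lowers_relax hle).comp (lowers_loop (n := n) _ fun i hi => ?_)
  have := List.mem_range.1 hi
  refine lowers_loop (n := n) _ fun j hj => ?_
  have := List.mem_range.1 hj
  refine lowers_relax ?_
  refine (G.dist_triangle _ e.1 _).trans (add_le_add ?_ (hI.dist_root_le (by omega) (by omega) _))
  refine (G.dist_triangle _ x _).trans (add_le_add ?_ hle)
  rw [G.dist_comm]
  exact hI.dist_root_le (by omega) (by omega) _

theorem dijkstra_singleton (hI : IsSetup k G T S P E) {i : ℕ} (h1 : 1 ≤ i) (hi : i ≤ k)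
    (s v : Fin n) : (dijkstra (E i) [s]).val.dist v = (G.restrict (T i)).dist s v := by
  rw [(dijkstra_spec (hI.isAdjList i h1 hi) [s]).1, (G.restrict (T i)).dist_comm]
  simp [WGraph.distSet]

theorem lowers_estimatePaths (hI : IsSetup k G T S P E) (hk : 2 ≤ k) :
    Lowers G (fun u v x => ∃ i ∈ List.range k, ∃ s ∈ S i, ∃ w ∈ List.finRange n,
      u = s ∧ v = w ∧ x = (dijkstra (E (min (i + 2) k)) [s]).val.dist w)
      fun d => (estimatePaths k S E d).val := by
  refine lowers_loop _ fun i hi => ?_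
  refine lowers_loop (n := n) _ fun s _ => ?_
  refine lowers_loop (n := n) _ fun v _ => ?_
  refine lowers_relax ?_
  refine le_of_le_of_eq ?_ (hI.dijkstra_singleton (by omega) (by omega) s v).symm
  exact G.dist_le_dist_restrict _ s v

/-- What the estimates satisfy. -/
structure IsEstimate (k : ℕ) (G : WGraph (Fin n)) (T : ℕ → Set (Fin n)) (P : ℕ → SPResult n)
    (d : Estimates n) : Prop where
  sound : Sound G d
  pivot : ∀ i, 1 ≤ i → i < k → ∀ u, d (u, (P i).root u) ≤ G.distSet u (T i)
  edge : ∀ i j, 1 ≤ i → i < k → 1 ≤ j → j < k → ∀ x y, G.graph.Adj x y →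
    d ((P i).root x, (P j).root y) ≤
      G.distSet x (T i) + (G.weight s(x, y) : ℝ≥0∞) + G.distSet y (T j)
  ball : ∀ i j, i < k → j ≤ i + 2 → j ≤ k → ∀ u, ∀ s ∈ G.ball u (T i) (T j),
    d (u, s) = G.dist u s

theorem isEstimate (hI : IsSetup k G T S P E) (hk : 2 ≤ k) (hadj : G.IsAdjList adj)
    (hT : Antitone T) : IsEstimate k G T P (estimate k adj S P E).val := by
  have hL := ((hI.lowers_estimatePivots).comp (hI.lowers_estimateEdges hadj)).comp
    (hI.lowers_estimatePaths hk)
  have h0 : Sound G (fun p => if p.1 = p.2 then 0 else ⊤) := by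
    refine ⟨fun u v => ?_, fun u v => ?_⟩
    · simp only [eq_comm]
    · by_cases h : u = v <;> simp [h]
  obtain ⟨hs, -, hB⟩ := hL _ h0
  have hval : (estimate k adj S P E).val = (estimatePaths k S E (estimateEdges k adj P
    (estimatePivots k P (fun p => if p.1 = p.2 then 0 else ⊤)).val).val).val := rfl
  rw [hval]
  refine ⟨hs, fun i h1 hi u => ?_, fun i j h1 hi h1' hj x y hxy => ?_, fun i j hi hj hjk u s hsb => ?_⟩
  · obtain ⟨i, rfl⟩ := Nat.exists_eq_add_of_le' h1
    refine hB _ _ _ (.inl (.inl ⟨i, List.mem_range.2 (by omega), u, List.mem_finRange u, rfl, rfl,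
      (hI.dist_eq _ h1 hi.le u).symm⟩))
  · obtain ⟨i, rfl⟩ := Nat.exists_eq_add_of_le' h1
    obtain ⟨j, rfl⟩ := Nat.exists_eq_add_of_le' h1'
    refine hB _ _ _ (.inl (.inr ⟨x, List.mem_finRange x, (y, G.weight s(x, y)),
      ((hadj x).2 _ _).2 ⟨hxy, rfl⟩, .inr ⟨i, List.mem_range.2 (by omega), j,
        List.mem_range.2 (by omega), rfl, rfl, ?_⟩⟩))
    rw [hI.dist_eq _ h1 hi.le, hI.dist_eq _ h1' hj.le]
  · refine le_antisymm ?_ (hs.2 u s)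
    -- The search starts at the centre `s`, whereas the ball surrounds `u`; symmetry of the
    -- estimates and of the restricted distance bridges this. The edge set for `min (i + 2) k`
    -- serves every `j` up to it, because its sampled set is contained in `T j`.
    refine (hs.1 u s).le.trans ((hB s u _ (.inr ⟨i, List.mem_range.2 hi, s, (hI.mem_iff i hi.le s).2 hsb.1, u,
      List.mem_finRange u, rfl, rfl, rfl⟩)).trans ?_)
    rw [hI.dijkstra_singleton (by omega) (by omega), WGraph.dist_comm]
    refine G.dist_restrict_le _ (hsb.2.trans_le (G.distSet_anti (hT ?_) u))
    omega

end IsSetup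

/-- `F` adds exactly the pairs `B`, each with its estimate as weight, and at most `N` entries. -/
def Adds (d : Estimates n) (B : Fin n → Fin n → Prop) (N : ℕ)
    (F : List (Fin n × Fin n × ℝ≥0∞) → List (Fin n × Fin n × ℝ≥0∞)) : Prop :=
  ∀ L, (∀ u v x, (u, v, x) ∈ F L ↔
    (u, v, x) ∈ L ∨ (B u v ∧ u ≠ v ∧ d (u, v) < ⊤ ∧ x = d (u, v))) ∧
    (F L).length ≤ L.length + N

theorem adds_addEdge (d : Estimates n) (u v : Fin n) :
    Adds d (fun a b => a = u ∧ b = v) 1 fun L => (addEdge d L u v).val := by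
  intro L
  by_cases h : u ≠ v ∧ d (u, v) < ⊤
  · have hval : (addEdge d L u v).val = (u, v, d (u, v)) :: L := by simp [addEdge, h]
    simp only [hval]
    refine ⟨fun a b x => ?_, by simp⟩
    simp only [List.mem_cons, Prod.mk.injEq]
    constructor
    · rintro (⟨rfl, rfl, rfl⟩ | h')
      exacts [.inr ⟨⟨rfl, rfl⟩, h.1, h.2, rfl⟩, .inl h']
    · rintro (h' | ⟨⟨rfl, rfl⟩, -, -, rfl⟩)
      exacts [.inr h', .inl ⟨rfl, rfl, rfl⟩]
  · have hval : (addEdge d L u v).val = L := by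
      simp only [addEdge, val_bind, val_rd, h, if_false, val_pure]
    simp only [hval]
    refine ⟨fun a b x => ⟨.inl, ?_⟩, by simp⟩
    rintro (h' | ⟨⟨rfl, rfl⟩, h1, h2, -⟩)
    exacts [h', absurd ⟨h1, h2⟩ h]

theorem adds_ite (d : Estimates n) (p : Prop) [Decidable p] {B : Fin n → Fin n → Prop} {N : ℕ}
    {f : List (Fin n × Fin n × ℝ≥0∞) → TimeM (List (Fin n × Fin n × ℝ≥0∞))}
    (hf : Adds d B N fun L => (f L).val) :
    Adds d (fun a b => p ∧ B a b) (if p then N else 0)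
      fun L => (if p then f L else pure L).val := by
  intro L
  by_cases h : p
  · simpa [h] using hf L
  · simp [h]

theorem Adds.comp {d : Estimates n} {B B' : Fin n → Fin n → Prop} {N N' : ℕ}
    {F F' : List (Fin n × Fin n × ℝ≥0∞) → List (Fin n × Fin n × ℝ≥0∞)}
    (h : Adds d B N F) (h' : Adds d B' N' F') :
    Adds d (fun u v => B u v ∨ B' u v) (N + N') fun L => F' (F L) := by
  intro L
  obtain ⟨h1, h2⟩ := h L
  obtain ⟨i1, i2⟩ := h' (F L)
  refine ⟨fun u v x => ?_, by simp only; omega⟩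
  rw [i1, h1]
  tauto

theorem adds_loop {d : Estimates n} {α : Type} {B : α → Fin n → Fin n → Prop} {N : α → ℕ}
    {f : List (Fin n × Fin n × ℝ≥0∞) → α → TimeM (List (Fin n × Fin n × ℝ≥0∞))} :
    ∀ (l : List α), (∀ a ∈ l, Adds d (B a) (N a) fun L => (f L a).val) →
      Adds d (fun u v => ∃ a ∈ l, B a u v) (l.map N).sum fun L => (loop l L f).val
  | [], _ => fun L => by simp
  | a :: l, h => by
    have h1 := (h a (by simp)).comp (adds_loop l fun b hb => h b (by simp [hb]))
    intro L
    simpa using h1 L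

/-- The edges of `D`. -/
def collectPivots (k : ℕ) (P : ℕ → SPResult n) (d : Estimates n)
    (F : List (Fin n × Fin n × ℝ≥0∞)) : TimeM (List (Fin n × Fin n × ℝ≥0∞)) :=
  loop (List.range (k - 1)) F fun F i => do
    let t ← rd P (i + 1)
    loop (List.finRange n) F fun F u => do
      let p ← rd t.root u
      addEdge d F u p

/-- The edges of `E_1`. -/
def collectEdges (E : ℕ → AdjArray n) (d : Estimates n)
    (F : List (Fin n × Fin n × ℝ≥0∞)) : TimeM (List (Fin n × Fin n × ℝ≥0∞)) := do
  let E1 ← rd E 1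
  loop (List.finRange n) F fun F u => do
    let nbrs ← rd E1 u
    loop nbrs F fun F e => addEdge d F u e.1

/-- The edges of `B_1(V)`. -/
def collectBunches (k : ℕ) (S : ℕ → List (Fin n)) (P : ℕ → SPResult n) (d : Estimates n)
    (F : List (Fin n × Fin n × ℝ≥0∞)) : TimeM (List (Fin n × Fin n × ℝ≥0∞)) :=
  loop (List.range k) F fun F i => do
    let Si ← rd S i
    let t ← rd P (i + 1)
    loop (List.finRange n) F fun F u => do
      let du ← rd t.dist u
      loop Si F fun F s => do
        let x ← rd d (u, s)
        tick
        if x < du then addEdge d F u s else pure F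

/-- The edges of `B_2(S_1)`. -/
def collectDoubleBunches (k : ℕ) (S : ℕ → List (Fin n)) (P : ℕ → SPResult n) (d : Estimates n)
    (F : List (Fin n × Fin n × ℝ≥0∞)) : TimeM (List (Fin n × Fin n × ℝ≥0∞)) := do
  let S1 ← rd S 1
  loop (List.range (k - 1)) F fun F i => do
    let Si ← rd S i
    let t ← rd P (i + 2)
    loop S1 F fun F u => do
      let du ← rd t.dist u
      loop Si F fun F s => do
        let x ← rd d (u, s)
        tick
        if x < du then addEdge d F u s else pure F

/-- The edges of the products `S_i × S_{k-1-i}`. -/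
def collectProducts (k : ℕ) (S : ℕ → List (Fin n)) (d : Estimates n)
    (F : List (Fin n × Fin n × ℝ≥0∞)) : TimeM (List (Fin n × Fin n × ℝ≥0∞)) :=
  loop (List.range k) F fun F i => do
    let Si ← rd S i
    let Sj ← rd S (k - 1 - i)
    loop Si F fun F a => loop Sj F fun F b => addEdge d F a b

theorem collect_eq (k : ℕ) (S : ℕ → List (Fin n)) (P : ℕ → SPResult n) (E : ℕ → AdjArray n)
    (d : Estimates n) : collect k S P E d = (do
      let F ← collectPivots k P d []
      let F ← collectEdges E d F
      let F ← collectBunches k S P d F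
      let F ← collectDoubleBunches k S P d F
      collectProducts k S d F) := by
  simp only [collect, collectEdges, collectPivots, collectBunches, collectDoubleBunches,
    collectProducts, bind_bind]

/-- The number of entries that `collect` adds to the output list. -/
def collectSize (k : ℕ) (S : ℕ → List (Fin n)) (P : ℕ → SPResult n) (E : ℕ → AdjArray n)
    (d : Estimates n) : ℕ :=
  ((List.range (k - 1)).map fun _ => ((List.finRange n).map fun _ => 1).sum).sum +
  ((List.finRange n).map fun u => ((E 1 u).map fun _ => 1).sum).sum +
  ((List.range k).map fun i => ((List.finRange n).map fun u => ((S i).map fun s =>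
    if d (u, s) < (P (i + 1)).dist u then 1 else 0).sum).sum).sum +
  ((List.range (k - 1)).map fun i => ((S 1).map fun u => ((S i).map fun s =>
    if d (u, s) < (P (i + 2)).dist u then 1 else 0).sum).sum).sum +
  ((List.range k).map fun i => ((S i).map fun _ => ((S (k - 1 - i)).map fun _ => 1).sum).sum).sum

theorem collect_spec (k : ℕ) (S : ℕ → List (Fin n)) (P : ℕ → SPResult n) (E : ℕ → AdjArray n)
    (d : Estimates n) :
    (∀ u v x, (u, v, x) ∈ (collect k S P E d).val ↔
      ((∃ i < k - 1, v = (P (i + 1)).root u) ∨ (∃ e ∈ E 1 u, v = e.1) ∨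
        (∃ i < k, v ∈ S i ∧ d (u, v) < (P (i + 1)).dist u) ∨
        (∃ i < k - 1, u ∈ S 1 ∧ v ∈ S i ∧ d (u, v) < (P (i + 2)).dist u) ∨
        ∃ i < k, u ∈ S i ∧ v ∈ S (k - 1 - i)) ∧ u ≠ v ∧ d (u, v) < ⊤ ∧ x = d (u, v)) ∧
    (collect k S P E d).val.length ≤ collectSize k S P E d := by
  have h1 : Adds d (fun a b => ∃ i ∈ List.range (k - 1), ∃ u ∈ List.finRange n,
      a = u ∧ b = (P (i + 1)).root u) _ fun L => (collectPivots k P d L).val :=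
    adds_loop (n := n) _ fun i _ => adds_loop (n := n) _ fun u _ => adds_addEdge d u _
  have h2 : Adds d (fun a b => ∃ u ∈ List.finRange n, ∃ e ∈ E 1 u, a = u ∧ b = e.1) _
      fun L => (collectEdges E d L).val :=
    adds_loop (n := n) _ fun u _ => adds_loop (n := n) _ fun e _ => adds_addEdge d u _
  have h3 : Adds d (fun a b => ∃ i ∈ List.range k, ∃ u ∈ List.finRange n, ∃ s ∈ S i,
      d (u, s) < (P (i + 1)).dist u ∧ a = u ∧ b = s) _ fun L => (collectBunches k S P d L).val :=
    adds_loop (n := n) _ fun i _ => adds_loop (n := n) _ fun u _ => adds_loop (n := n) _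
      fun s _ => adds_ite d (d (u, s) < (P (i + 1)).dist u) (adds_addEdge d u s)
  have h4 : Adds d (fun a b => ∃ i ∈ List.range (k - 1), ∃ u ∈ S 1, ∃ s ∈ S i,
      d (u, s) < (P (i + 2)).dist u ∧ a = u ∧ b = s) _
      fun L => (collectDoubleBunches k S P d L).val :=
    adds_loop (n := n) _ fun i _ => adds_loop (n := n) _ fun u _ => adds_loop (n := n) _
      fun s _ => adds_ite d (d (u, s) < (P (i + 2)).dist u) (adds_addEdge d u s)
  have h5 : Adds d (fun a b => ∃ i ∈ List.range k, ∃ u ∈ S i, ∃ v ∈ S (k - 1 - i), a = u ∧ b = v) _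
      fun L => (collectProducts k S d L).val :=
    adds_loop (n := n) _ fun i _ => adds_loop (n := n) _ fun u _ => adds_loop (n := n) _
      fun v _ => adds_addEdge d u v
  obtain ⟨hmem, hlen⟩ := ((((h1.comp h2).comp h3).comp h4).comp h5) []
  rw [collect_eq]
  refine ⟨fun u v x => (hmem u v x).trans ?_, hlen.trans ?_⟩
  · simp only [List.not_mem_nil, false_or, List.mem_range, List.mem_finRange, true_and]
    refine and_congr_left fun _ => ?_
    constructor
    · rintro ((((⟨i, hi, w, rfl, rfl⟩ | ⟨w, e, he, rfl, rfl⟩) |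
        ⟨i, hi, w, s, hs, hlt, rfl, rfl⟩) | ⟨i, hi, w, hw, s, hs, hlt, rfl, rfl⟩) |
        ⟨i, hi, w, hw, s, hs, rfl, rfl⟩)
      · exact .inl ⟨i, hi, rfl⟩
      · exact .inr (.inl ⟨e, he, rfl⟩)
      · exact .inr (.inr (.inl ⟨i, hi, hs, hlt⟩))
      · exact .inr (.inr (.inr (.inl ⟨i, hi, hw, hs, hlt⟩)))
      · exact .inr (.inr (.inr (.inr ⟨i, hi, hw, hs⟩)))
    · rintro (⟨i, hi, rfl⟩ | ⟨e, he, rfl⟩ | ⟨i, hi, hs, hlt⟩ | ⟨i, hi, hw, hs, hlt⟩ |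
        ⟨i, hi, hw, hs⟩)
      · exact .inl (.inl (.inl (.inl ⟨i, hi, u, rfl, rfl⟩)))
      · exact .inl (.inl (.inl (.inr ⟨u, e, he, rfl, rfl⟩)))
      · exact .inl (.inl (.inr ⟨i, hi, u, v, hs, hlt, rfl, rfl⟩))
      · exact .inl (.inr ⟨i, hi, u, hw, v, hs, hlt, rfl, rfl⟩)
      · exact .inr ⟨i, hi, u, hw, v, hs, rfl, rfl⟩
  · exact (Nat.zero_add _).le

/-- The graph of the listed pairs, weighted by the estimates. -/
def outputGraph (L : List (Fin n × Fin n × ℝ≥0∞)) (d : Estimates n)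
    (hd : ∀ u v, d (u, v) = d (v, u)) (hL : ∀ u v x, (u, v, x) ∈ L → u ≠ v) : WGraph (Fin n) where
  graph :=
    { Adj := fun u v => ∃ x, (u, v, x) ∈ L ∨ (v, u, x) ∈ L
      symm := ⟨fun _ _ ⟨x, h⟩ => ⟨x, h.symm⟩⟩
      loopless := ⟨fun _ ⟨_, h⟩ => h.elim (fun h => hL _ _ _ h rfl) fun h => hL _ _ _ h rfl⟩ }
  weight := Sym2.lift ⟨fun u v => (d (u, v)).toNNReal, fun u v => congrArg ENNReal.toNNReal (hd u v)⟩

theorem exists_emulator {G : WGraph (Fin n)} {adj : AdjArray n} (hk : 2 ≤ k)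
    (hadj : G.IsAdjList adj) (ω : Coins k n) :
    ∃ (H : WGraph (Fin n)) (piv : ℕ → Fin n → Fin n),
      H.IsEdgeList (emulatorAlg k n adj ω).val ∧ (∀ u v, G.dist u v ≤ H.dist u v) ∧
      AuxWeights G H k (hier ω) piv := by
  have hI := isSetup hadj ω
  set S := (levelSets k (levels ω).val).val
  set P := (pivots k adj S).val
  set E := (edgeSets k adj P).val
  have hd := hI.isEstimate hk hadj (hier_anti ω)
  set d := (estimate k adj S P E).val
  have hval : (emulatorAlg k n adj ω).val = (collect k S P E d).val := by
    rw [emulatorAlg_eq]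
    rfl
  have hmem := (collect_spec k S P E d).1
  set L := (collect k S P E d).val
  have hL : ∀ u v x, (u, v, x) ∈ L → u ≠ v := fun u v x h => ((hmem u v x).1 h).2.1
  set H := outputGraph L d hd.sound.1 hL with hH
  -- Pairs with an infinite estimate are never listed, so `toNNReal` loses nothing on edges of `H`.
  have hadjH : ∀ u v, H.graph.Adj u v → (H.weight s(u, v) : ℝ≥0∞) = d (u, v) := by
    rintro u v ⟨x, h⟩
    refine ENNReal.coe_toNNReal (ne_of_lt ?_)
    rcases h with h | h
    · exact ((hmem _ _ _).1 h).2.2.1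
    · rw [hd.sound.1]
      exact ((hmem _ _ _).1 h).2.2.1
  have hpiv : ∀ i u, 1 ≤ i → i < k → G.distSet u (hier ω i) ≠ ⊤ →
      (P i).root u ∈ hier ω i ∧ G.dist u ((P i).root u) = G.distSet u (hier ω i) :=
    fun i u h1 hi hu => hI.root i h1 hi u hu
  have hexact : ∀ i j u s, i < k → j ≤ i + 2 → j ≤ k → s ∈ G.ball u (hier ω i) (hier ω j) →
      d (u, s) = G.dist u s ∧ d (u, s) < ⊤ := fun i j u s hi hj hjk hs => by
    have := hd.ball i j hi hj hjk u s hs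
    exact ⟨this, this ▸ lt_of_lt_of_le hs.2 le_top⟩
  refine ⟨H, fun i => (P i).root, ?_, ?_, hpiv, ?_, ?_, ?_, ?_, ?_⟩
  · rw [hval]
    refine ⟨fun u v x h => ?_, fun u v h => h⟩
    have hA : H.graph.Adj u v := ⟨x, .inl h⟩
    exact ⟨hA, by rw [hadjH u v hA]; exact ((hmem u v x).1 h).2.2.2⟩
  · intro u v
    refine le_iInf fun p => ?_
    induction p with
    | nil => simp
    | @cons u u' v h p ih =>
      rw [WGraph.walkWeight_cons, ENNReal.coe_add, hadjH u u' h]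
      exact (G.dist_triangle _ _ _).trans (add_le_add (hd.sound.2 u u') ih)
  · intro i u h1 hi hu hne
    have hle := hd.pivot i h1 hi u
    have hA : H.graph.Adj u ((P i).root u) := by
      obtain ⟨i, rfl⟩ := Nat.exists_eq_add_of_le' h1
      exact ⟨_, .inl ((hmem _ _ _).2 ⟨.inl ⟨i, by omega, rfl⟩, hne,
        hle.trans_lt (lt_top_iff_ne_top.2 hu), rfl⟩)⟩
    refine ⟨hA, ?_⟩
    rw [hadjH _ _ hA]
    refine le_antisymm ?_ (hd.sound.2 _ _)
    rw [(hpiv i u h1 hi hu).2]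
    exact hle
  -- An edge that is light at `u` puts `v` into the bunch of `u` between levels `0` and `1`, so its
  -- estimate is the exact distance, which may be smaller than the weight of the edge.
  · have key : ∀ u v, G.graph.Adj u v → (G.weight s(u, v) : ℝ≥0∞) < G.distSet u (hier ω 1) →
        H.graph.Adj u v ∧ (H.weight s(u, v) : ℝ≥0∞) = G.dist u v := by
      intro u v huv hlt
      have hb : v ∈ G.ball u (hier ω 0) (hier ω 1) :=
        ⟨by simp [hier_zero ω (by omega : 0 < k)], (G.dist_le_weight huv).trans_lt hlt⟩
      obtain ⟨h1, h2⟩ := hexact 0 1 u v (by omega) (by omega) (by omega) hb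
      have hA : H.graph.Adj u v := by
        refine ⟨_, .inl ((hmem _ _ _).2 ⟨.inr (.inl ⟨(v, G.weight s(u, v)), ?_, rfl⟩), huv.ne, h2,
          rfl⟩)⟩
        exact ((hI.isAdjList 1 le_rfl (by omega) u).2 _ _).2 ⟨⟨huv, .inl hlt⟩, rfl⟩
      exact ⟨hA, by rw [hadjH _ _ hA, h1]⟩
    rintro u v ⟨huv, h | h⟩
    · exact key u v huv h
    · rw [Sym2.eq_swap] at h ⊢
      obtain ⟨h1, h2⟩ := key v u huv.symm h
      exact ⟨h1.symm, h2.trans (G.dist_comm _ _)⟩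
  · intro i u s hi hs hne
    obtain ⟨h1, h2⟩ := hexact i (i + 1) u s (by omega) (by omega) hi hs
    have hA : H.graph.Adj u s := by
      refine ⟨_, .inl ((hmem _ _ _).2 ⟨.inr (.inr (.inl ⟨i, by omega,
        (hI.mem_iff i (by omega) s).2 hs.1, ?_⟩)), hne, h2, rfl⟩)⟩
      rw [h1, hI.dist_eq _ (by omega) hi]
      exact hs.2
    exact ⟨hA, by rw [hadjH _ _ hA, h1]⟩
  · intro i u s hi hu hs hne
    obtain ⟨h1, h2⟩ := hexact i (i + 2) u s (by omega) (by omega) hi hs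
    have hA : H.graph.Adj u s := by
      refine ⟨_, .inl ((hmem _ _ _).2 ⟨.inr (.inr (.inr (.inl ⟨i, by omega,
        (hI.mem_iff 1 (by omega) u).2 hu, (hI.mem_iff i (by omega) s).2 hs.1, ?_⟩))), hne, h2,
        rfl⟩)⟩
      rw [h1, hI.dist_eq _ (by omega) hi]
      exact hs.2
    exact ⟨hA, by rw [hadjH _ _ hA, h1]⟩
  · intro i j x y hi hj hij hxy hx hy hne
    have hle := hd.edge i j hi (by omega) hj (by omega) x y hxy
    obtain ⟨hx1, hx2⟩ := hpiv i x hi (by omega) hx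
    obtain ⟨hy1, hy2⟩ := hpiv j y hj (by omega) hy
    have hA : H.graph.Adj ((P i).root x) ((P j).root y) := by
      refine ⟨_, .inl ((hmem _ _ _).2 ⟨.inr (.inr (.inr (.inr ⟨i, by omega,
        (hI.mem_iff i (by omega) _).2 hx1, ?_⟩))), hne, hle.trans_lt ?_, rfl⟩)⟩
      · rw [show k - 1 - i = j by omega]
        exact (hI.mem_iff j (by omega) _).2 hy1
      · exact ENNReal.add_lt_top.2 ⟨ENNReal.add_lt_top.2 ⟨lt_top_iff_ne_top.2 hx,
          ENNReal.coe_lt_top⟩, lt_top_iff_ne_top.2 hy⟩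
    refine ⟨hA, ?_⟩
    rw [hadjH _ _ hA, hx2, hy2]
    exact hle
end

/-! ### The expected size of the output -/

open TimeM
noncomputable section

variable {k n : ℕ}

open scoped Classical in
/-- The number of members of `S_b` in `N` that are not farther than the nearest member of `S_c` in
`N`, counted if the vertex `t` belongs to `S_a`. -/
def bunchCount (ω : Coins k n) (t : Fin n) (a b c : ℕ) (N : Finset (Fin n))
    (key : Fin n → ℝ≥0∞) : ℝ :=
  ∑ s ∈ N, if t ∈ hier ω a ∧ s ∈ hier ω b ∧ ∀ v ∈ N, key v ≤ key s → v ∉ hier ω c then 1 else 0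

theorem expect_bunchCount_le (hk : 2 ≤ k) (hn : 1 ≤ n) (t : Fin n) {a b c : ℕ} (ha : a < k)
    (hb : b < k) (hc : c ≤ k) (habc : min a b ≤ c) (N : Finset (Fin n)) (key : Fin n → ℝ≥0∞) :
    expect (fun ω : Coins k n => bunchCount ω t a b c N key) ≤
      3 * sampleProb k n ^ (a + b) / sampleProb k n ^ c :=
  expect_bunch_le hk hn t ha hb hc habc N key

theorem sum_map_finRange (f : Fin n → ℕ) : ((List.finRange n).map f).sum = ∑ v, f v := by
  rw [← List.ofFn_eq_map, List.sum_ofFn]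

theorem sum_map_range (m : ℕ) (f : ℕ → ℕ) : ((List.range m).map f).sum = ∑ i ∈ Finset.range m, f i :=
  rfl

open scoped Classical in
theorem sum_map_of_mem_iff {l : List (Fin n)} (hl : l.Nodup) {T : Set (Fin n)}
    (h : ∀ v, v ∈ l ↔ v ∈ T) (f : Fin n → ℕ) :
    (l.map f).sum = ∑ v, if v ∈ T then f v else 0 := by
  rw [← List.sum_toFinset f hl, ← Finset.sum_filter]
  congr 1
  ext v
  simp [h]

open scoped Classical in
theorem length_le_card_adj {G : WGraph (Fin n)} {adj : AdjArray n} (hadj : G.IsAdjList adj)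
    (u : Fin n) : (adj u).length ≤ ∑ v, if G.graph.Adj u v then 1 else 0 := by
  have hnd : ((adj u).map Prod.fst).Nodup := by
    refine List.Nodup.map_on ?_ (hadj u).1
    rintro ⟨v, x⟩ h ⟨v', x'⟩ h' (rfl : v = v')
    rw [(((hadj u).2 _ _).1 h).2, (((hadj u).2 _ _).1 h').2]
  rw [← List.length_map (f := Prod.fst), ← List.toFinset_card_of_nodup hnd, ← Finset.card_filter]
  refine Finset.card_le_card fun v hv => ?_
  obtain ⟨⟨w, x⟩, he, rfl⟩ := List.mem_map.1 (List.mem_toFinset.1 hv)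
  simpa using (((hadj u).2 _ _).1 he).1

open scoped Classical in
/-- The size of `E_S` in terms of the edges that are lighter than the distance of their first
endpoint to `S`. -/
theorem totalDegree_restrict_le {G : WGraph (Fin n)} {S : Set (Fin n)} {A : AdjArray n}
    (hA : (G.restrict S).IsAdjList A) :
    totalDegree A ≤ 2 * ∑ u, ∑ v,
      if G.graph.Adj u v ∧ (G.weight s(u, v) : ℝ≥0∞) < G.distSet u S then 1 else 0 := by
  have h1 : totalDegree A ≤ ∑ u, ∑ v,
      ((if G.graph.Adj u v ∧ (G.weight s(u, v) : ℝ≥0∞) < G.distSet u S then 1 else 0) +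
      if G.graph.Adj v u ∧ (G.weight s(v, u) : ℝ≥0∞) < G.distSet v S then 1 else 0) := by
    refine Finset.sum_le_sum fun u _ => (length_le_card_adj hA u).trans
      (Finset.sum_le_sum fun v _ => ?_)
    by_cases h : (G.restrict S).graph.Adj u v
    · rw [if_pos h]
      obtain ⟨h1, h2 | h2⟩ := h
      · rw [if_pos ⟨h1, h2⟩]
        omega
      · rw [if_pos (c := G.graph.Adj v u ∧ _) ⟨h1.symm, by rwa [Sym2.eq_swap]⟩]
        omega
    · rw [if_neg h]
      omega
  refine h1.trans (le_of_eq ?_)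
  simp only [Finset.sum_add_distrib]
  rw [Finset.sum_comm (f := fun u v =>
    if G.graph.Adj v u ∧ (G.weight s(v, u) : ℝ≥0∞) < G.distSet v S then 1 else 0), two_mul]

-- Rank the neighbours of `u` by edge weight: a neighbour in `S_c` over an edge no heavier than `uv`
-- would bring `S_c` within the weight of `uv`. The vertex `t` need not be related to `u`; it is the
-- source of a search.
open scoped Classical in
theorem sum_light_le_bunchCount (G : WGraph (Fin n)) (ω : Coins k n) (hk : 2 ≤ k) (t u : Fin n)
    (a c : ℕ) :
    (if t ∈ hier ω a then ∑ v, if G.graph.Adj u v ∧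
      (G.weight s(u, v) : ℝ≥0∞) < G.distSet u (hier ω c) then (1 : ℝ) else 0 else 0) ≤
    bunchCount ω t a 0 c (Finset.univ.filter fun v => G.graph.Adj u v)
      fun v => G.weight s(u, v) := by
  unfold bunchCount
  by_cases ht : t ∈ hier ω a
  · rw [if_pos ht, Finset.sum_filter]
    refine Finset.sum_le_sum fun v _ => ?_
    by_cases h : G.graph.Adj u v ∧ (G.weight s(u, v) : ℝ≥0∞) < G.distSet u (hier ω c)
    · rw [if_pos h, if_pos h.1, if_pos]
      refine ⟨ht, by simp [hier_zero ω (by omega : 0 < k)], fun x hx hle hxc => ?_⟩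
      have hux : G.graph.Adj u x := by simpa using hx
      exact absurd h.2 (not_lt.2 (((G.distSet_le hxc u).trans (G.dist_le_weight hux)).trans hle))
    · rw [if_neg h]
      split_ifs <;> norm_num
  · rw [if_neg ht]
    exact Finset.sum_nonneg fun v _ => by split_ifs <;> norm_num

-- Soundness alone suffices: an estimate below the distance to `S_c` forces the true distance below
-- it, so no member of `S_c` is at least as near as `s`.
open scoped Classical in
theorem sum_ball_le_bunchCount {G : WGraph (Fin n)} (ω : Coins k n) {d : Estimates n}
    (hd : ∀ u v, G.dist u v ≤ d (u, v)) (u : Fin n) (a b c : ℕ) :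
    (if u ∈ hier ω a then ∑ s, if s ∈ hier ω b then
      (if d (u, s) < G.distSet u (hier ω c) then (1 : ℝ) else 0) else 0 else 0) ≤
    bunchCount ω u a b c Finset.univ fun v => G.dist u v := by
  unfold bunchCount
  by_cases hu : u ∈ hier ω a
  · rw [if_pos hu]
    refine Finset.sum_le_sum fun s _ => ?_
    by_cases hs : s ∈ hier ω b
    · by_cases hlt : d (u, s) < G.distSet u (hier ω c)
      · rw [if_pos hs, if_pos hlt, if_pos]
        refine ⟨hu, hs, fun v _ hle hv => ?_⟩
        exact absurd hlt (not_lt.2 (((G.distSet_le hv u).trans hle).trans (hd u s)))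
      · rw [if_pos hs, if_neg hlt]
        split_ifs <;> norm_num
    · rw [if_neg hs]
      split_ifs <;> norm_num
  · rw [if_neg hu]
    exact Finset.sum_nonneg fun v _ => by split_ifs <;> norm_num

-- With `c = k` the condition of avoiding `S_c` is void, so products of levels fit the same count.
open scoped Classical in
theorem sum_product_eq_bunchCount (ω : Coins k n) (t : Fin n) (a b : ℕ) :
    (if t ∈ hier ω a then ∑ s, if s ∈ hier ω b then (1 : ℝ) else 0 else 0) =
    bunchCount ω t a b k Finset.univ fun _ => 0 := by
  unfold bunchCount
  by_cases ht : t ∈ hier ω a <;> simp [ht, hier_self]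

/-- A bound on the size of the output in terms of bunches. -/
def sizeBound (G : WGraph (Fin n)) (ω : Coins k n) : ℝ :=
  open scoped Classical in
  k * n + 2 * ∑ u, bunchCount ω u 0 0 1 (Finset.univ.filter fun v => G.graph.Adj u v)
      (fun v => G.weight s(u, v)) +
    ∑ i ∈ Finset.range k, ∑ u, bunchCount ω u 0 i (i + 1) Finset.univ (fun v => G.dist u v) +
    ∑ i ∈ Finset.range (k - 1), ∑ u,
      bunchCount ω u 1 i (i + 2) Finset.univ (fun v => G.dist u v) +
    ∑ i ∈ Finset.range k, ∑ u, bunchCount ω u i (k - 1 - i) k Finset.univ fun _ => 0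

theorem length_le_sizeBound {G : WGraph (Fin n)} {adj : AdjArray n} (hk : 2 ≤ k)
    (hadj : G.IsAdjList adj) (ω : Coins k n) :
    ((emulatorAlg k n adj ω).val.length : ℝ) ≤ sizeBound G ω := by
  classical
  have hI := isSetup hadj ω
  set S := (levelSets k (levels ω).val).val
  set P := (pivots k adj S).val
  set E := (edgeSets k adj P).val
  have hd := (hI.isEstimate hk hadj (hier_anti ω)).sound.2
  set d := (estimate k adj S P E).val
  have hval : (emulatorAlg k n adj ω).val = (collect k S P E d).val := by
    rw [emulatorAlg_eq]
    rfl
  have hlen := (collect_spec k S P E d).2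
  rw [← hval] at hlen
  refine le_trans (b := (collectSize k S P E d : ℝ)) (by exact_mod_cast hlen) ?_
  have hmem0 : ∀ u, u ∈ hier ω 0 := fun u => by simp [hier_zero ω (by omega : 0 < k)]
  unfold collectSize sizeBound
  rw [Nat.cast_add, Nat.cast_add, Nat.cast_add, Nat.cast_add]
  refine add_le_add (add_le_add (add_le_add (add_le_add ?_ ?_) ?_) ?_) ?_
  · simp only [List.map_const', List.sum_replicate, List.length_finRange, List.length_range,
      smul_eq_mul, mul_one]
    exact_mod_cast Nat.mul_le_mul_right n (Nat.sub_le k 1)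
  · have h1 : ((List.finRange n).map fun u => ((E 1 u).map fun _ => 1).sum).sum =
        totalDegree (E 1) := by
      rw [sum_map_finRange]
      simp [totalDegree]
    rw [h1]
    refine le_trans (b := ((2 * ∑ u, ∑ v, if G.graph.Adj u v ∧ (G.weight s(u, v) : ℝ≥0∞) <
      G.distSet u (hier ω 1) then 1 else 0 : ℕ) : ℝ))
      (by exact_mod_cast totalDegree_restrict_le (hI.isAdjList 1 le_rfl (by omega))) ?_
    push_cast
    refine mul_le_mul_of_nonneg_left (Finset.sum_le_sum fun u _ => ?_) two_pos.le
    have := sum_light_le_bunchCount G ω hk u u 0 1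
    rwa [if_pos (hmem0 u)] at this
  · rw [sum_map_range, Nat.cast_sum]
    refine Finset.sum_le_sum fun i hi => ?_
    have hi := Finset.mem_range.1 hi
    rw [sum_map_finRange, Nat.cast_sum]
    refine Finset.sum_le_sum fun u _ => ?_
    rw [sum_map_of_mem_iff (hI.nodup i hi.le) (hI.mem_iff i hi.le)]
    have := sum_ball_le_bunchCount ω hd u 0 i (i + 1)
    rw [if_pos (hmem0 u)] at this
    push_cast
    rw [hI.dist_eq _ (by omega) (by omega)]
    exact this
  · rw [sum_map_range, Nat.cast_sum]
    refine Finset.sum_le_sum fun i hi => ?_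
    have hi := Finset.mem_range.1 hi
    rw [sum_map_of_mem_iff (hI.nodup 1 (by omega)) (hI.mem_iff 1 (by omega)), Nat.cast_sum]
    refine Finset.sum_le_sum fun u _ => ?_
    rw [sum_map_of_mem_iff (hI.nodup i (by omega)) (hI.mem_iff i (by omega))]
    have := sum_ball_le_bunchCount ω hd u 1 i (i + 2)
    push_cast
    rw [hI.dist_eq _ (by omega) (by omega)]
    exact this
  · rw [sum_map_range, Nat.cast_sum]
    refine Finset.sum_le_sum fun i hi => ?_
    have hi := Finset.mem_range.1 hi
    rw [sum_map_of_mem_iff (hI.nodup i hi.le) (hI.mem_iff i hi.le), Nat.cast_sum]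
    refine Finset.sum_le_sum fun u _ => ?_
    rw [sum_map_of_mem_iff (hI.nodup (k - 1 - i) (by omega)) (hI.mem_iff (k - 1 - i) (by omega)),
      ← sum_product_eq_bunchCount]
    push_cast
    exact le_rfl

theorem expect_const (c : ℝ) : expect (fun _ : Coins k n => c) = c := by
  have h := expect_prod (k := k) (n := n) fun _ _ => 1
  simp only [Finset.prod_const_one, mul_one, sum_coins_one] at h
  have := expect_const_mul c fun _ : Coins k n => (1 : ℝ)
  simpa [h] using this

theorem expect_sizeBound_le (hk : 2 ≤ k) (hn : 1 ≤ n) (G : WGraph (Fin n)) :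
    expect (fun ω : Coins k n => sizeBound G ω) ≤ 16 * k * (n / sampleProb k n) := by
  classical
  have hp := sampleProb_pos (k := k) hn
  have hp1 := sampleProb_le_one (k := k) hn
  have hone : 1 ≤ 1 / sampleProb k n := by rwa [le_div_iff₀ hp, one_mul]
  -- Every family of output pairs treated here satisfies `c = a + b + 1`, so exactly one factor `1 /
  -- p` remains.
  have hkey : ∀ (t : Fin n) (a b c : ℕ) (N : Finset (Fin n)) (key : Fin n → ℝ≥0∞), a < k → b < k →
      c ≤ k → min a b ≤ c → a + b + 1 = c →
      expect (fun ω : Coins k n => bunchCount ω t a b c N key) ≤ 3 / sampleProb k n := by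
    intro t a b c N key ha hb hc hm hab
    refine (expect_bunchCount_le hk hn t ha hb hc hm N key).trans (le_of_eq ?_)
    rw [← hab, pow_succ]
    field_simp
  have hsum : ∀ (f : Fin n → Coins k n → ℝ), (∀ u, expect (f u) ≤ 3 / sampleProb k n) →
      expect (fun ω => ∑ u, f u ω) ≤ 3 * (n / sampleProb k n) := fun f hf => by
    rw [expect_sum]
    refine (Finset.sum_le_card_nsmul _ _ _ fun u _ => hf u).trans (le_of_eq ?_)
    simp
    ring
  have hsum2 : ∀ (m : ℕ) (f : ℕ → Fin n → Coins k n → ℝ), m ≤ k →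
      (∀ i < m, ∀ u, expect (f i u) ≤ 3 / sampleProb k n) →
      expect (fun ω => ∑ i ∈ Finset.range m, ∑ u, f i u ω) ≤ k * (3 * (n / sampleProb k n)) := by
    intro m f hm hf
    rw [expect_sum]
    refine (Finset.sum_le_card_nsmul _ _ _ fun i hi => hsum _ (hf i (Finset.mem_range.1 hi))).trans ?_
    rw [Finset.card_range, nsmul_eq_mul]
    have : (m : ℝ) ≤ k := by exact_mod_cast hm
    exact mul_le_mul_of_nonneg_right this (by positivity)
  unfold sizeBound
  rw [expect_add, expect_add, expect_add, expect_add, expect_const, expect_const_mul]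
  have h2 := hsum _ fun u => hkey u 0 0 1 (Finset.univ.filter fun v => G.graph.Adj u v)
    (fun v => G.weight s(u, v)) (by omega) (by omega) (by omega) (by omega) (by omega)
  have h3 := hsum2 k _ le_rfl fun i hi u => hkey u 0 i (i + 1) Finset.univ (fun v => G.dist u v)
    (by omega) hi (by omega) (by omega) (by omega)
  have h4 := hsum2 (k - 1) _ (Nat.sub_le _ _) fun i hi u => hkey u 1 i (i + 2) Finset.univ
    (fun v => G.dist u v) (by omega) (by omega) (by omega) (by omega) (by omega)
  have h5 := hsum2 k _ le_rfl fun i hi u => hkey u i (k - 1 - i) k Finset.univ (fun _ => 0)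
    hi (by omega) (by omega) (by omega) (by omega)
  have hk' : (1 : ℝ) ≤ k := by exact_mod_cast (by omega : 1 ≤ k)
  have h1 : (k : ℝ) * n ≤ k * (n / sampleProb k n) := by
    refine mul_le_mul_of_nonneg_left ?_ (by positivity)
    rw [le_div_iff₀ hp]
    exact mul_le_of_le_one_right (by positivity) hp1
  have h6 : (n / sampleProb k n : ℝ) ≤ k * (n / sampleProb k n) :=
    le_mul_of_one_le_left (by positivity) hk'
  -- The constant is `1` for the pivots, `2 * 3` for `E_1`, and `3` for each of the three families
  -- over the levels.
  nlinarith
end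

/-! ### Running times of the phases -/

open TimeM
noncomputable section

variable {k n : ℕ}

namespace TimeM

variable {α β σ : Type}

theorem time_bind_le {m : TimeM α} {f : α → TimeM β} {a b : ℕ} (hm : m.time ≤ a)
    (hf : (f m.val).time ≤ b) : (m >>= f).time ≤ a + b :=
  Nat.add_le_add hm hf

theorem time_rd_bind_le {ι : Type} {r : ι → α} {i : ι} {f : α → TimeM β} {b : ℕ}
    (hf : (f (r i)).time ≤ b) : (rd r i >>= f).time ≤ b + 1 :=
  (Nat.add_le_add_left hf 1).trans (Nat.add_comm 1 b).le

theorem time_tick_bind_le {f : Unit → TimeM β} {b : ℕ} (hf : (f ()).time ≤ b) :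
    (tick >>= f).time ≤ b + 1 :=
  (Nat.add_le_add_left hf 1).trans (Nat.add_comm 1 b).le

theorem time_ite_le {p : Prop} {_ : Decidable p} {x y : TimeM α} {a : ℕ} (hx : x.time ≤ a)
    (hy : y.time ≤ a) : (if p then x else y).time ≤ a := by
  split_ifs
  exacts [hx, hy]

theorem time_loop_le_of_length_le {T N : ℕ} {f : σ → α → TimeM σ} {l : List α} {s : σ}
    (hl : l.length ≤ N) (h : ∀ s, ∀ a ∈ l, (f s a).time ≤ T) :
    (loop l s f).time ≤ N * (T + 1) + 1 :=
  (time_loop_le_mul T l s h).trans (Nat.add_le_add_right (Nat.mul_le_mul_right _ hl) 1)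

end TimeM

theorem length_finRange_le : (List.finRange n).length ≤ n := List.length_finRange.le

theorem length_range_pred_le : (List.range (k - 1)).length ≤ k := by simp

theorem length_range_le : (List.range k).length ≤ k := by simp

theorem time_relax_le (d : Estimates n) (u v : Fin n) (x : ℝ≥0∞) : (relax d u v x).time ≤ 4 :=
  time_rd_bind_le (time_tick_bind_le (time_ite_le le_rfl (Nat.zero_le _)))

theorem time_addEdge_le (d : Estimates n) (F : List (Fin n × Fin n × ℝ≥0∞)) (u v : Fin n) :
    (addEdge d F u v).time ≤ 2 :=
  time_rd_bind_le (time_tick_bind_le (time_ite_le le_rfl le_rfl))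

theorem time_levels_le (ω : Coins k n) : (levels ω).time ≤ n + (n * (2 * k + 3) + 1) := by
  refine time_bind_le le_rfl (time_loop_le_of_length_le length_finRange_le fun _ v _ => ?_)
  exact time_bind_le (a := 2 * k + 1) (b := 1) (time_findLevel_le ω v) le_rfl

theorem time_levelSets_le (lev : Fin n → ℕ) :
    (levelSets k lev).time ≤ (k + 1) + (k * (3 * n + 3) + 1) := by
  refine time_bind_le le_rfl (time_loop_le_of_length_le length_range_le fun _ i _ => ?_)
  exact time_bind_le (a := 3 * n + 1) (b := 1) (time_members_le lev i) le_rfl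

theorem time_pivots_le {G : WGraph (Fin n)} {adj : AdjArray n} (hadj : G.IsAdjList adj)
    {S : ℕ → List (Fin n)} (hS : ∀ i < k, (S i).length ≤ n) :
    (pivots k adj S).time ≤ 2 * n + ((k + 1) + (k * ((n + n * n + n + 1) *
      (3 * Nat.log 2 (n * n + n + 2) + 20) + 1 + 1 + 1) + 1)) := by
  refine time_bind_le (by simp [noSource, two_mul]) (time_bind_le le_rfl
    (time_loop_le_of_length_le length_range_pred_le fun _ i hi => ?_))
  refine time_rd_bind_le (time_bind_le ((dijkstra_spec hadj _).2.2.trans ?_) le_rfl)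
  have h1 := totalDegree_le hadj
  have h2 := hS (i + 1) (by have := List.mem_range.1 hi; omega)
  have h3 : Nat.log 2 (totalDegree adj + (S (i + 1)).length + 1) ≤ Nat.log 2 (n * n + n + 2) :=
    Nat.log_mono_right (by omega)
  exact Nat.mul_le_mul (by omega) (by omega)

theorem time_edgeSets_le {G : WGraph (Fin n)} {adj : AdjArray n} (hadj : G.IsAdjList adj)
    (P : ℕ → SPResult n) : (edgeSets k adj P).time ≤
      (k + 1) + (k * ((n + (n * (3 * n + 5) + 1)) + 1 + 1 + 1) + 1) := by
  refine time_bind_le le_rfl (time_loop_le_of_length_le length_range_le fun _ _ _ => ?_)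
  exact time_rd_bind_le (time_bind_le (time_restrictEdges_le hadj _) le_rfl)

theorem time_estimatePivots_le (P : ℕ → SPResult n) (d : Estimates n) :
    (estimatePivots k P d).time ≤ k * (n * 7 + 1 + 1 + 1) + 1 := by
  refine time_loop_le_of_length_le length_range_pred_le fun _ _ _ => time_rd_bind_le ?_
  refine time_loop_le_of_length_le length_finRange_le fun _ _ _ => time_rd_bind_le ?_
  exact time_rd_bind_le (time_relax_le _ _ _ _)

theorem time_estimateEdges_le {G : WGraph (Fin n)} {adj : AdjArray n} (hadj : G.IsAdjList adj)
    (P : ℕ → SPResult n) (d : Estimates n) : (estimateEdges k adj P d).time ≤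
      n * (n * (4 + (k * (k * 8 + 1 + 1 + 1 + 1 + 1) + 1) + 1) + 1 + 1 + 1) + 1 := by
  refine time_loop_le_of_length_le length_finRange_le fun _ u _ => time_rd_bind_le ?_
  refine time_loop_le_of_length_le (length_adj_le hadj u) fun _ _ _ =>
    time_bind_le (time_relax_le _ _ _ _) ?_
  refine time_loop_le_of_length_le length_range_pred_le fun _ _ _ => time_rd_bind_le ?_
  refine time_rd_bind_le (time_rd_bind_le ?_)
  refine time_loop_le_of_length_le length_range_pred_le fun _ _ _ => time_rd_bind_le ?_
  exact time_rd_bind_le (time_rd_bind_le (time_relax_le _ _ _ _))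

theorem time_collectPivots_le (P : ℕ → SPResult n) (d : Estimates n)
    (F : List (Fin n × Fin n × ℝ≥0∞)) :
    (collectPivots k P d F).time ≤ k * (n * 4 + 1 + 1 + 1) + 1 := by
  refine time_loop_le_of_length_le length_range_pred_le fun _ _ _ => time_rd_bind_le ?_
  refine time_loop_le_of_length_le length_finRange_le fun _ _ _ => time_rd_bind_le ?_
  exact time_addEdge_le _ _ _ _

theorem time_collectEdges_le {E : ℕ → AdjArray n} (hE : ∀ u, (E 1 u).length ≤ n)
    (d : Estimates n) (F : List (Fin n × Fin n × ℝ≥0∞)) :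
    (collectEdges E d F).time ≤ n * (n * 3 + 1 + 1 + 1) + 1 + 1 := by
  refine time_rd_bind_le ?_
  refine time_loop_le_of_length_le length_finRange_le fun _ u _ => time_rd_bind_le ?_
  exact time_loop_le_of_length_le (hE u) fun _ _ _ => time_addEdge_le _ _ _ _

theorem time_collectBunches_le {S : ℕ → List (Fin n)} (hS : ∀ i < k, (S i).length ≤ n)
    (P : ℕ → SPResult n) (d : Estimates n) (F : List (Fin n × Fin n × ℝ≥0∞)) :
    (collectBunches k S P d F).time ≤
      k * (n * (n * 5 + 1 + 1 + 1) + 1 + 1 + 1 + 1) + 1 := by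
  refine time_loop_le_of_length_le length_range_le fun _ i hi => time_rd_bind_le ?_
  refine time_rd_bind_le ?_
  refine time_loop_le_of_length_le length_finRange_le fun _ _ _ => time_rd_bind_le ?_
  refine time_loop_le_of_length_le (hS i (List.mem_range.1 hi)) fun _ _ _ => time_rd_bind_le ?_
  exact time_tick_bind_le (time_ite_le (time_addEdge_le _ _ _ _) (Nat.zero_le _))

theorem time_collectDoubleBunches_le (hk : 2 ≤ k) {S : ℕ → List (Fin n)}
    (hS : ∀ i < k, (S i).length ≤ n)
    (P : ℕ → SPResult n) (d : Estimates n) (F : List (Fin n × Fin n × ℝ≥0∞)) :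
    (collectDoubleBunches k S P d F).time ≤
      k * (n * (n * 5 + 1 + 1 + 1) + 1 + 1 + 1 + 1) + 1 + 1 := by
  refine time_rd_bind_le ?_
  refine time_loop_le_of_length_le length_range_pred_le fun _ i hi => time_rd_bind_le ?_
  have hi : i < k := by
    have := List.mem_range.1 hi
    omega
  refine time_rd_bind_le ?_
  refine time_loop_le_of_length_le (hS 1 (by omega)) fun _ _ _ => time_rd_bind_le ?_
  refine time_loop_le_of_length_le (hS i hi) fun _ _ _ => time_rd_bind_le ?_
  exact time_tick_bind_le (time_ite_le (time_addEdge_le _ _ _ _) (Nat.zero_le _))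

theorem time_collectProducts_le {S : ℕ → List (Fin n)} (hS : ∀ i < k, (S i).length ≤ n)
    (d : Estimates n) (F : List (Fin n × Fin n × ℝ≥0∞)) :
    (collectProducts k S d F).time ≤ k * (n * (n * 3 + 1 + 1) + 1 + 1 + 1 + 1) + 1 := by
  refine time_loop_le_of_length_le length_range_le fun _ i hi => time_rd_bind_le ?_
  have hi := List.mem_range.1 hi
  refine time_rd_bind_le ?_
  refine time_loop_le_of_length_le (hS i hi) fun _ _ _ => ?_
  exact time_loop_le_of_length_le (hS (k - 1 - i) (by omega)) fun _ _ _ => time_addEdge_le _ _ _ _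

theorem time_estimatePass_le {G : WGraph (Fin n)} {A : AdjArray n} (hA : G.IsAdjList A)
    (d : Estimates n) (s : Fin n) :
    (do
      let t ← dijkstra A [s]
      loop (List.finRange n) d fun d v => do
        let x ← rd t.dist v
        relax d s v x : TimeM (Estimates n)).time ≤
      (n + totalDegree A + 2) * (3 * Nat.log 2 (n * n + n + 2) + 20) + (n * 6 + 1) := by
  refine time_bind_le ((dijkstra_spec hA [s]).2.2.trans ?_)
    (time_loop_le_of_length_le length_finRange_le fun _ v _ =>
      time_rd_bind_le (time_relax_le _ _ _ _))
  have h1 := totalDegree_le hA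
  have h3 : Nat.log 2 (totalDegree A + 1 + 1) ≤ Nat.log 2 (n * n + n + 2) :=
    Nat.log_mono_right (by omega)
  simp only [List.length_singleton]
  exact Nat.mul_le_mul (by omega) (by omega)

/-- The only phase for which a worst-case bound would be too weak. The product of the number of
sources and the size of the edge set is kept, to be bounded in expectation. -/
theorem time_estimatePaths_le {G : WGraph (Fin n)} {T : ℕ → Set (Fin n)} {S : ℕ → List (Fin n)}
    {P : ℕ → SPResult n} {E : ℕ → AdjArray n} (hI : IsSetup k G T S P E) (hk : 2 ≤ k)
    (d : Estimates n) : (estimatePaths k S E d).time ≤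
      (3 * Nat.log 2 (n * n + n + 2) + 30) *
        (∑ i ∈ Finset.range k, (S i).length * (n + totalDegree (E (min (i + 2) k)) + 2)) +
      4 * k + 1 := by
  have h : (estimatePaths k S E d).time ≤ ((List.range k).map fun i =>
      ((S i).length * ((n + totalDegree (E (min (i + 2) k)) + 2) *
        (3 * Nat.log 2 (n * n + n + 2) + 20) + (n * 6 + 1) + 1) + 1 + 1 + 1) + 1).sum + 1 := by
    obtain ⟨T, hT⟩ : ∃ T : ℕ → ℕ, ∀ i, T i = (S i).length *
        ((n + totalDegree (E (min (i + 2) k)) + 2) * (3 * Nat.log 2 (n * n + n + 2) + 20) +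
          (n * 6 + 1) + 1) + 1 + 1 + 1 := ⟨_, fun _ => rfl⟩
    simp only [← hT]
    refine time_loop_le (fun _ => True) T (List.range k) d trivial
      fun d i hi _ => ⟨trivial, le_of_le_of_eq ?_ (hT i).symm⟩
    refine time_rd_bind_le ?_
    refine time_rd_bind_le ?_
    exact time_loop_le_of_length_le le_rfl fun d s _ =>
      time_estimatePass_le (hI.isAdjList (min (i + 2) k) (by omega) (by omega)) d s
  generalize Nat.log 2 (n * n + n + 2) = L at h ⊢
  refine h.trans ?_
  rw [sum_map_range, Finset.mul_sum]
  have h4 : 4 * k = ∑ i ∈ Finset.range k, 4 := by simp [mul_comm]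
  rw [h4, ← Finset.sum_add_distrib]
  refine Nat.add_le_add_right (Finset.sum_le_sum fun i _ => ?_) 1
  generalize totalDegree (E (min (i + 2) k)) = D
  generalize (S i).length = s
  have : s * ((n + D + 2) * (3 * L + 20) + (n * 6 + 1) + 1) ≤
      s * ((n + D + 2) * (3 * L + 30)) := Nat.mul_le_mul_left _ (by nlinarith)
  calc _ = s * ((n + D + 2) * (3 * L + 20) + (n * 6 + 1) + 1) + 4 := by ring
    _ ≤ s * ((n + D + 2) * (3 * L + 30)) + 4 := Nat.add_le_add_right this 4
    _ = _ := by ring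

theorem time_emulatorAlg_le {G : WGraph (Fin n)} {adj : AdjArray n} (hk : 2 ≤ k) (hn : 1 ≤ n)
    (hadj : G.IsAdjList adj) (ω : Coins k n) :
    let S := (levelSets k (levels ω).val).val
    let E := (edgeSets k adj (pivots k adj S).val).val
    (emulatorAlg k n adj ω).time ≤ 500 * (k ^ 2 * n ^ 2 * (Nat.log 2 (n * n + n + 2) + 1)) +
      (3 * Nat.log 2 (n * n + n + 2) + 30) *
        ∑ i ∈ Finset.range k, (S i).length * (n + totalDegree (E (min (i + 2) k)) + 2) := by
  intro S E
  have hI := isSetup hadj ω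
  set P := (pivots k adj S).val
  have hS : ∀ i < k, (S i).length ≤ n := fun i hi => by
    simpa using (hI.nodup i hi.le).length_le_card
  have h0 : (emulatorAlg k n adj ω).time = (levels ω).time + ((levelSets k (levels ω).val).time +
      ((pivots k adj S).time + ((edgeSets k adj P).time + ((estimate k adj S P E).time +
        (collect k S P E (estimate k adj S P E).val).time)))) :=
    congrArg TimeM.time (emulatorAlg_eq adj ω)
  obtain ⟨d1, d2, d3, h1⟩ : ∃ d1 d2 d3, (estimate k adj S P E).time = n * n +
      ((estimatePivots k P d1).time + ((estimateEdges k adj P d2).time +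
        (estimatePaths k S E d3).time)) :=
    ⟨_, _, _, congrArg TimeM.time (estimate_eq k adj S P E)⟩
  obtain ⟨F1, F2, F3, F4, F5, h2⟩ : ∃ F1 F2 F3 F4 F5,
      (collect k S P E (estimate k adj S P E).val).time =
        (collectPivots k P (estimate k adj S P E).val F1).time +
        ((collectEdges E (estimate k adj S P E).val F2).time +
        ((collectBunches k S P (estimate k adj S P E).val F3).time +
        ((collectDoubleBunches k S P (estimate k adj S P E).val F4).time +
        (collectProducts k S (estimate k adj S P E).val F5).time))) :=
    ⟨_, _, _, _, _, congrArg TimeM.time (collect_eq k S P E (estimate k adj S P E).val)⟩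
  have t1 := time_levels_le ω
  have t2 := time_levelSets_le (k := k) (levels ω).val
  have t3 := time_pivots_le hadj hS
  have t4 := time_edgeSets_le (k := k) hadj P
  have t5 := time_estimatePivots_le (k := k) P d1
  have t6 := time_estimateEdges_le (k := k) hadj P d2
  have t7 := time_estimatePaths_le hI hk d3
  have t8 := time_collectPivots_le (k := k) P (estimate k adj S P E).val F1
  have t9 := time_collectEdges_le (length_adj_le (hI.isAdjList 1 le_rfl (by omega)))
    (estimate k adj S P E).val F2
  have t10 := time_collectBunches_le hS P (estimate k adj S P E).val F3
  have t11 := time_collectDoubleBunches_le hk hS P (estimate k adj S P E).val F4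
  have t12 := time_collectProducts_le hS (estimate k adj S P E).val F5
  rw [h0, h1, h2]
  change (estimatePaths k S E d3).time ≤ _ * ∑ i ∈ Finset.range k,
    (S i).length * (n + totalDegree (E (min (i + 2) k)) + 2) + 4 * k + 1 at t7
  generalize (∑ i ∈ Finset.range k, (S i).length * (n + totalDegree (E (min (i + 2) k)) + 2)) = total
    at t7 ⊢
  generalize Nat.log 2 (n * n + n + 2) = L at t3 t7 ⊢
  clear h0 h1 h2 hI
  have hk1 : 1 ≤ k := by omega
  have m1 : n ≤ n * n := Nat.le_mul_self n
  have m2 : k ≤ k * k := Nat.le_mul_self k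
  have m3 : 1 ≤ k * k := m2.trans' hk1
  have m4 : 1 ≤ n * n := m1.trans' hn
  -- All bounds are polynomials of degree at most `2` in `k` and in `n`, and at most linear in `L`;
  -- each monomial is dominated by `k ^ 2 n ^ 2`, times `L` where it occurs.
  have mono : ∀ {a b : ℕ}, a ≤ k * k → b ≤ n * n → a * b ≤ k * k * (n * n) :=
    fun h1 h2 => Nat.mul_le_mul h1 h2
  have p1 := mono m3 m4
  have p2 := mono m2 m4
  have p3 := mono m3 m1
  have p4 := mono m3 le_rfl
  have p5 := mono m2 m1
  have p6 := mono m2 le_rfl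
  have q1 := Nat.mul_le_mul_left L p2
  have q2 := Nat.mul_le_mul_left L p5
  have q3 := Nat.mul_le_mul_left L p6
  have q4 : 1 ≤ k * k * (n * n) := p1.trans' (by norm_num)
  nlinarith only [t1, t2, t3, t4, t5, t6, t7, t8, t9, t10, t11, t12, p1, p2, p3, p4, p5, p6,
    q1, q2, q3]
end

/-! ### The expected running time and the final constants -/

open TimeM
noncomputable section

variable {k n : ℕ}

theorem bunchCount_nonneg (ω : Coins k n) (t : Fin n) (a b c : ℕ) (N : Finset (Fin n))
    (key : Fin n → ℝ≥0∞) : 0 ≤ bunchCount ω t a b c N key :=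
  Finset.sum_nonneg fun v _ => by split_ifs <;> norm_num

/-- A bound on the total size of the inputs of the searches from the single vertices. -/
def pathBound (G : WGraph (Fin n)) (ω : Coins k n) : ℝ :=
  open scoped Classical in
  ∑ i ∈ Finset.range k, ∑ t, (((n : ℝ) + 2) + 2 * ∑ u, bunchCount ω t i 0 (min (i + 2) k)
    (Finset.univ.filter fun v => G.graph.Adj u v) fun v => G.weight s(u, v))

theorem sum_length_mul_le_pathBound {G : WGraph (Fin n)} {S : ℕ → List (Fin n)}
    {P : ℕ → SPResult n} {E : ℕ → AdjArray n} (hk : 2 ≤ k) (ω : Coins k n)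
    (hI : IsSetup k G (hier ω) S P E) :
    ((∑ i ∈ Finset.range k, (S i).length * (n + totalDegree (E (min (i + 2) k)) + 2) : ℕ) : ℝ) ≤
      pathBound G ω := by
  classical
  unfold pathBound
  rw [Nat.cast_sum]
  refine Finset.sum_le_sum fun i hi => ?_
  have hi := Finset.mem_range.1 hi
  have hlen : (S i).length = ∑ t, if t ∈ hier ω i then 1 else 0 := by
    rw [← sum_map_of_mem_iff (hI.nodup i hi.le) (hI.mem_iff i hi.le)]
    simp
  rw [hlen, Finset.sum_mul, Nat.cast_sum]
  refine Finset.sum_le_sum fun t _ => ?_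
  by_cases ht : t ∈ hier ω i
  · rw [if_pos ht, one_mul, add_right_comm, Nat.cast_add, Nat.cast_add]
    refine add_le_add le_rfl ?_
    have h1 : ((totalDegree (E (min (i + 2) k)) : ℕ) : ℝ) ≤
        ((2 * ∑ u, ∑ v, if G.graph.Adj u v ∧ (G.weight s(u, v) : ℝ≥0∞) <
          G.distSet u (hier ω (min (i + 2) k)) then 1 else 0 : ℕ) : ℝ) := by
      exact_mod_cast totalDegree_restrict_le (hI.isAdjList (min (i + 2) k) (by omega) (by omega))
    refine h1.trans ?_
    push_cast
    refine mul_le_mul_of_nonneg_left (Finset.sum_le_sum fun u _ => ?_) two_pos.le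
    have := sum_light_le_bunchCount G ω hk t u i (min (i + 2) k)
    rwa [if_pos ht] at this
  -- A vertex outside `S_i` starts no search. The bound charges `n + 2` for it nevertheless, which
  -- is affordable: `n (n + 2)` per level is below the target.
  · rw [if_neg ht, zero_mul, Nat.cast_zero]
    have := Finset.sum_nonneg fun u (_ : u ∈ Finset.univ) => bunchCount_nonneg ω t i 0
      (min (i + 2) k) (Finset.univ.filter fun v => G.graph.Adj u v) fun v => G.weight s(u, v)
    positivity

theorem expect_pathBound_le (hk : 2 ≤ k) (hn : 1 ≤ n) (G : WGraph (Fin n)) :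
    expect (fun ω : Coins k n => pathBound G ω) ≤ 9 * k * (n ^ 2 / sampleProb k n ^ 2) := by
  classical
  have hp := sampleProb_pos (k := k) hn
  have hp1 := sampleProb_le_one (k := k) hn
  have hn1 : (1 : ℝ) ≤ n := by exact_mod_cast hn
  -- The factor `p ^ i` for being a source cancels the growth of `E_{i+2}` up to `1 / p ^ 2`; at the
  -- top levels `min (i + 2) k` only makes the quotient smaller.
  have hkey : ∀ i < k, ∀ t u : Fin n, expect (fun ω : Coins k n => bunchCount ω t i 0 (min (i + 2) k)
      (Finset.univ.filter fun v => G.graph.Adj u v) fun v => G.weight s(u, v)) ≤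
      3 / sampleProb k n ^ 2 := by
    intro i hi t u
    refine (expect_bunchCount_le hk hn t hi (by omega) (by omega) (by omega) _ _).trans ?_
    rw [add_zero, div_le_div_iff₀ (by positivity) (by positivity), mul_assoc, ← pow_add]
    exact mul_le_mul_of_nonneg_left
      (pow_le_pow_of_le_one hp.le hp1 (by omega)) (by norm_num)
  have hq : (n : ℝ) ^ 2 ≤ n ^ 2 / sampleProb k n ^ 2 := by
    rw [le_div_iff₀ (by positivity)]
    exact mul_le_of_le_one_right (by positivity) (pow_le_one₀ hp.le hp1)
  have hterm : ∀ i < k, ∀ t : Fin n, expect (fun ω : Coins k n => ((n : ℝ) + 2) +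
      2 * ∑ u, bunchCount ω t i 0 (min (i + 2) k)
        (Finset.univ.filter fun v => G.graph.Adj u v) fun v => G.weight s(u, v)) ≤
      ((n : ℝ) + 2) + 2 * (n * (3 / sampleProb k n ^ 2)) := by
    intro i hi t
    rw [expect_add, expect_const, expect_const_mul, expect_sum]
    refine add_le_add le_rfl (mul_le_mul_of_nonneg_left ?_ two_pos.le)
    refine (Finset.sum_le_card_nsmul _ _ _ fun u _ => hkey i hi t u).trans (le_of_eq ?_)
    simp
  unfold pathBound
  rw [expect_sum]
  refine (Finset.sum_le_card_nsmul _ _ (n * (((n : ℝ) + 2) + 2 * (n * (3 / sampleProb k n ^ 2))))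
    fun i hi => ?_).trans ?_
  · rw [expect_sum]
    refine (Finset.sum_le_card_nsmul _ _ _
      fun t _ => hterm i (Finset.mem_range.1 hi) t).trans (le_of_eq ?_)
    rw [Finset.card_univ, Fintype.card_fin, nsmul_eq_mul]
  · rw [Finset.card_range, nsmul_eq_mul, mul_comm (9 : ℝ), mul_assoc]
    refine mul_le_mul_of_nonneg_left ?_ (by positivity)
    calc (n : ℝ) * (((n : ℝ) + 2) + 2 * (n * (3 / sampleProb k n ^ 2)))
        = (n ^ 2 + 2 * n) + 6 * (n ^ 2 / sampleProb k n ^ 2) := by ring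
      _ ≤ 3 * n ^ 2 + 6 * (n ^ 2 / sampleProb k n ^ 2) := by nlinarith
      _ ≤ 9 * (n ^ 2 / sampleProb k n ^ 2) := by linarith

theorem div_sampleProb (hn : 1 ≤ n) : n / sampleProb k n = (n : ℝ) ^ (1 + 1 / (k : ℝ)) := by
  have hn0 : (0 : ℝ) < n := by exact_mod_cast hn
  rw [sampleProb, Real.rpow_neg hn0.le, div_inv_eq_mul, Real.rpow_add hn0, Real.rpow_one]

theorem sq_div_sampleProb_sq (hn : 1 ≤ n) :
    (n : ℝ) ^ 2 / sampleProb k n ^ 2 = (n : ℝ) ^ (2 + 2 / (k : ℝ)) := by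
  have hn0 : (0 : ℝ) < n := by exact_mod_cast hn
  rw [← div_pow, div_sampleProb hn, ← Real.rpow_natCast, ← Real.rpow_mul hn0.le]
  congr 1
  push_cast
  ring

theorem half_le_log (hn : 1 ≤ n) : 1 / 2 ≤ Real.log ((n : ℝ) + 1) := by
  have h1 : Real.log 2 ≤ Real.log ((n : ℝ) + 1) :=
    Real.log_le_log two_pos (by have : (1 : ℝ) ≤ n := by exact_mod_cast hn
                                linarith)
  have := Real.log_two_gt_d9
  linarith

/-- The argument is at most `(n + 1) ^ 2`, and `log 2 > 1 / 2` gives the second factor `2`. -/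
theorem natLog_le (hn : 1 ≤ n) :
    (Nat.log 2 (n * n + n + 2) : ℝ) ≤ 4 * Real.log ((n : ℝ) + 1) := by
  have h1 : (2 : ℝ) ^ Nat.log 2 (n * n + n + 2) ≤ ((n : ℝ) + 1) ^ 2 := by
    have h := Nat.pow_log_le_self 2 (x := n * n + n + 2) (by omega)
    have h' : n * n + n + 2 ≤ (n + 1) ^ 2 := by nlinarith
    exact_mod_cast h.trans h'
  have h2 := Real.log_le_log (by positivity) h1
  rw [Real.log_pow, Real.log_pow] at h2
  have h3 := Real.log_two_gt_d9
  have h4 : (0 : ℝ) ≤ Nat.log 2 (n * n + n + 2) := Nat.cast_nonneg _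
  push_cast at h2
  nlinarith

theorem expect_length_le {G : WGraph (Fin n)} {adj : AdjArray n} (hk : 2 ≤ k) (hn : 1 ≤ n)
    (hadj : G.IsAdjList adj) :
    expect (fun ω : Coins k n => ((emulatorAlg k n adj ω).val.length : ℝ)) ≤
      16 * k * (n : ℝ) ^ (1 + 1 / (k : ℝ)) := by
  rw [← div_sampleProb hn]
  exact (expect_mono hn fun ω => length_le_sizeBound hk hadj ω).trans (expect_sizeBound_le hk hn G)

theorem expect_time_le {G : WGraph (Fin n)} {adj : AdjArray n} (hk : 2 ≤ k) (hn : 1 ≤ n)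
    (hadj : G.IsAdjList adj) :
    expect (fun ω : Coins k n => ((emulatorAlg k n adj ω).time : ℝ)) ≤
      (500 * (k ^ 2 * (Nat.log 2 (n * n + n + 2) + 1)) +
        (3 * Nat.log 2 (n * n + n + 2) + 30) * (9 * k)) * (n : ℝ) ^ (2 + 2 / (k : ℝ)) := by
  have hp := sampleProb_pos (k := k) hn
  have hp1 := sampleProb_le_one (k := k) hn
  have hq : (n : ℝ) ^ 2 ≤ n ^ 2 / sampleProb k n ^ 2 := by
    rw [le_div_iff₀ (by positivity)]
    exact mul_le_of_le_one_right (by positivity) (pow_le_one₀ hp.le hp1)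
  have h : ∀ ω : Coins k n, ((emulatorAlg k n adj ω).time : ℝ) ≤
      500 * (k ^ 2 * n ^ 2 * (Nat.log 2 (n * n + n + 2) + 1)) +
      (3 * Nat.log 2 (n * n + n + 2) + 30) * pathBound G ω := fun ω => by
    refine (Nat.cast_le.2 (time_emulatorAlg_le hk hn hadj ω)).trans ?_
    rw [Nat.cast_add, Nat.cast_mul (3 * _ + 30)]
    refine add_le_add (le_of_eq (by push_cast; rfl)) ?_
    push_cast [-Nat.cast_sum]
    refine mul_le_mul_of_nonneg_left ?_ (by positivity)
    exact sum_length_mul_le_pathBound hk ω (isSetup hadj ω)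
  refine (expect_mono hn h).trans ?_
  rw [expect_add, expect_const, expect_const_mul, ← sq_div_sampleProb_sq hn]
  have h2 := expect_pathBound_le hk hn G
  generalize (n : ℝ) ^ 2 / sampleProb k n ^ 2 = Q at hq h2 ⊢
  have hL : (0 : ℝ) ≤ Nat.log 2 (n * n + n + 2) := Nat.cast_nonneg _
  clear h
  generalize (Nat.log 2 (n * n + n + 2) : ℝ) = L at hL ⊢
  calc _ ≤ 500 * ((k : ℝ) ^ 2 * Q * (L + 1)) + (3 * L + 30) * (9 * k * Q) := by
        refine add_le_add ?_ (mul_le_mul_of_nonneg_left h2 (by positivity))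
        gcongr
    _ = _ := by ring

end

-- For natural numbers, `k / 2` is the floor and `(k + 1) / 2` the ceiling of `k/2`; truncated
-- subtraction makes `2 * ((k + 1) / 2 - 2)` equal to `max {0, 2 (⌈k/2⌉ - 2)}`.
theorem mainTheorem4 :
    ∃ (C : ℝ) (c : ℕ), ∀ (k n : ℕ), 2 ≤ k → 1 ≤ n →
      ∀ (G : WGraph (Fin n)) (adj : AdjArray n), G.IsAdjList adj →
        (∀ ω : Coins k n, ∃ (H : WGraph (Fin n)) (piv : ℕ → Fin n → Fin n),
          H.IsEdgeList (emulatorAlg k n adj ω).val ∧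
          G.IsEmulator H ((2 * (k / 2) - 1 : ℕ) : ℝ≥0) (fun _ _ p =>
            ((2 * ((k + 1) / 2) : ℕ) : ℝ≥0) * G.heaviest 1 p +
            ((2 * ((k + 1) / 2 - 2) : ℕ) : ℝ≥0) * G.heaviest 2 p) ∧
          AuxWeights G H k (hier ω) piv) ∧
        expect (fun ω : Coins k n => ((emulatorAlg k n adj ω).val.length : ℝ)) ≤
          C * ((k : ℝ) * Real.log ((n : ℝ) + 1)) ^ c * (n : ℝ) ^ (1 + 1 / (k : ℝ)) ∧
        expect (fun ω : Coins k n => ((emulatorAlg k n adj ω).time : ℝ)) ≤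
          C * ((k : ℝ) * Real.log ((n : ℝ) + 1)) ^ c * (n : ℝ) ^ (2 + 2 / (k : ℝ)) := by
  -- With `X = k log (n + 1) ≥ 1`, one has `k ≤ 2 X` and a binary logarithm of at most `2 X`. The
  -- running time then costs `6000 X ^ 3 + 648 X ^ 2`, which fixes both constants.
  refine ⟨7000, 3, fun k n hk hn G adj hadj => ⟨fun ω => ?_, ?_, ?_⟩⟩
  · obtain ⟨H, piv, h1, h2, h3⟩ := exists_emulator hk hadj ω
    exact ⟨H, piv, h1, h3.isEmulator h2 (hier_self ω) (hier_zero ω (by omega)) hk, h3⟩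
  all_goals
    have hl := half_le_log hn
    have hk2 : (2 : ℝ) ≤ k := by exact_mod_cast hk
    have hLn := natLog_le hn
    have hL : (0 : ℝ) ≤ Nat.log 2 (n * n + n + 2) := Nat.cast_nonneg _
    have hkX : (k : ℝ) ≤ 2 * (k * Real.log ((n : ℝ) + 1)) := by nlinarith
    have hlX : 2 * Real.log ((n : ℝ) + 1) ≤ k * Real.log ((n : ℝ) + 1) :=
      mul_le_mul_of_nonneg_right hk2 (by linarith)
    have hX1 : 1 ≤ (k : ℝ) * Real.log ((n : ℝ) + 1) := by linarith
    generalize (k : ℝ) * Real.log ((n : ℝ) + 1) = X at hkX hlX hX1 ⊢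
    have hX3 : X ^ 2 ≤ X ^ 3 := pow_le_pow_right₀ hX1 (by norm_num)
    have hX2 : X ≤ X ^ 2 := le_self_pow₀ hX1 two_ne_zero
  · refine (expect_length_le hk hn hadj).trans (mul_le_mul_of_nonneg_right ?_ (by positivity))
    linarith
  · refine (expect_time_le hk hn hadj).trans (mul_le_mul_of_nonneg_right ?_ (by positivity))
    generalize (Nat.log 2 (n * n + n + 2) : ℝ) = L at hL hLn ⊢
    have hL1 : L + 1 ≤ 3 * X := by linarith
    have hL2 : 3 * L + 30 ≤ 36 * X := by linarith
    calc 500 * ((k : ℝ) ^ 2 * (L + 1)) + (3 * L + 30) * (9 * k)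
        ≤ 500 * ((2 * X) ^ 2 * (3 * X)) + 36 * X * (9 * (2 * X)) := by gcongr
      _ = 6000 * X ^ 3 + 648 * X ^ 2 := by ring
      _ ≤ 7000 * X ^ 3 := by linarith [pow_nonneg (zero_le_one.trans hX1) 3]
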